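/- Let $(M,J)$ be a compact complex manifold of complex dimension at least $2$ (real dimension $n\ge 4$), and let $g$ be a Riemannian metric on $M$ that is Hermitian, $g(JX,JY)=g(X,Y)$. Let $D$ be a torsion-free affine connection on $M$ and $\omega$ a $1$-form such that $(M,[g],D)$ is an Einstein–Weyl structure, i.e. $Dg=\omega\otimes g$ and the Ricci tensor $\rho^D$ of $D$ satisfies $\rho^D(X,Y)+\rho^D(Y,X)=\bar\Lambda\, g(X,Y)$ for some $\bar\Lambda\in C^\infty(M)$. Assume that $g$ is the standard (Gauduchon) metric of this structure, i.e. $\delta\omega=0$, where $\delta$ is the codifferential of $g$. Assume moreover that $f\in C^\infty(M)$ is such that $f^2g$ is a Kähler metric on $(M,J)$, and that $\rho^D$ is $J$-invariant: $\rho^D(JX,JY)=\rho^D(X,Y)$. Let $\xi=\omega^\sharp$ be the vector field with $g(\xi,\cdot)=\omega$. Then $\xi$ is a holomorphic Killing field of $(M,f^2g,J)$, i.e. $L_\xi J=0$ and $L_\xi(f^2g)=0$. Moreover, $J\xi$ is collinear with the gradient $\nabla f$ on $U=\{x\in M:\xi_x\neq 0\}$: for every $x\in U$ there is $c\in\mathbb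 R$ with $(\nabla f)_x=c\,J\xi_x$. -/

import Mathlib

open Bundle VectorField
open scoped Manifold ContDiff

noncomputable section

namespace EinsteinWeyl

section Real

variable {E : Type*} [NormedAddCommGroup E] [NormedSpace ℝ E]
  {M : Type*} [TopologicalSpace M] [ChartedSpace E M] [IsManifold 𝓘(ℝ, E) ∞ M]

variable (E M) in
/-- Smooth Riemannian metrics on the tangent bundle of `M`. -/
abbrev Metric := ContMDiffRiemannianMetric 𝓘(ℝ, E) ∞ E (TangentSpace 𝓘(ℝ, E) : M → Type _)

variable (E M) in
/-- Affine connections on `M`; `D Y x (X x)` is `(D_X Y)(x)`. -/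
abbrev Connection := CovariantDerivative 𝓘(ℝ, E) E (TangentSpace 𝓘(ℝ, E) : M → Type _)

/-- The vector field `X` on `M` is differentiable at `x`. -/
abbrev DiffFieldAt (X : Π x : M, TangentSpace 𝓘(ℝ, E) x) (x : M) : Prop :=
  MDifferentiableAt 𝓘(ℝ, E) 𝓘(ℝ, E).tangent
    (fun y ↦ (⟨y, X y⟩ : TangentBundle 𝓘(ℝ, E) M)) x

/-- The vector field `X` on `M` is smooth. -/
abbrev SmoothField (X : Π x : M, TangentSpace 𝓘(ℝ, E) x) : Prop :=
  ContMDiff 𝓘(ℝ, E) 𝓘(ℝ, E).tangent ∞ (fun y ↦ (⟨y, X y⟩ : TangentBundle 𝓘(ℝ, E) M))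

/-- The 1-form `α` on `M` is smooth. -/
def IsSmoothOneForm (α : Π x : M, TangentSpace 𝓘(ℝ, E) x →L[ℝ] ℝ) : Prop :=
  ContMDiff 𝓘(ℝ, E) (𝓘(ℝ, E).prod 𝓘(ℝ, E →L[ℝ] ℝ)) ∞
    (fun x ↦ TotalSpace.mk' (E →L[ℝ] ℝ)
      (E := fun x : M ↦ TangentSpace 𝓘(ℝ, E) x →L[ℝ] ℝ) x (α x))

theorem exists_sharp [FiniteDimensional ℝ E] (g : Metric E M) (x : M)
    (α : TangentSpace 𝓘(ℝ, E) x →L[ℝ] ℝ) :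
    ∃ v : TangentSpace 𝓘(ℝ, E) x, ∀ w, g.inner x v w = α w := by
  let φ : E →ₗ[ℝ] Module.Dual ℝ E :=
    { toFun := fun v ↦ ((g.inner x v : TangentSpace 𝓘(ℝ, E) x →L[ℝ] ℝ) :
        TangentSpace 𝓘(ℝ, E) x →ₗ[ℝ] ℝ)
      map_add' := fun v w ↦ by
        ext u
        exact congrArg (fun l : TangentSpace 𝓘(ℝ, E) x →L[ℝ] ℝ ↦ l u) ((g.inner x).map_add v w)
      map_smul' := fun c v ↦ by
        ext u
        exact congrArg (fun l : TangentSpace 𝓘(ℝ, E) x →L[ℝ] ℝ ↦ l u) ((g.inner x).map_smul c v) }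
  have hφ : Function.Injective φ := by
    rw [injective_iff_map_eq_zero]
    intro v hv
    by_contra hne
    exact (g.pos x v hne).ne' (congrArg (fun l : Module.Dual ℝ E ↦ l v) hv)
  have hs : Function.Surjective φ :=
    (LinearMap.injective_iff_surjective_of_finrank_eq_finrank
      Subspace.dual_finrank_eq.symm).1 hφ
  obtain ⟨v, hv⟩ := hs (α : TangentSpace 𝓘(ℝ, E) x →ₗ[ℝ] ℝ)
  exact ⟨v, fun w ↦ congrArg (fun l : Module.Dual ℝ E ↦ l w) hv⟩

/-- The vector field `α^♯` that is `g`-dual to the 1-form `α`. -/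
def sharp [FiniteDimensional ℝ E] (g : Metric E M) (α : Π x : M, TangentSpace 𝓘(ℝ, E) x →L[ℝ] ℝ)
    (x : M) : TangentSpace 𝓘(ℝ, E) x :=
  (exists_sharp g x (α x)).choose

theorem inner_sharp [FiniteDimensional ℝ E] (g : Metric E M)
    (α : Π x : M, TangentSpace 𝓘(ℝ, E) x →L[ℝ] ℝ) (x : M) (w : TangentSpace 𝓘(ℝ, E) x) :
    g.inner x (sharp g α x) w = α x w :=
  (exists_sharp g x (α x)).choose_spec w

/-- The gradient of a function with respect to `g`. -/
def gradient [FiniteDimensional ℝ E] (g : Metric E M) (f : M → ℝ) (x : M) :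
    TangentSpace 𝓘(ℝ, E) x :=
  sharp g (mvfderiv 𝓘(ℝ, E) f) x

/-- `D g = α ⊗ g`, that is
`X (g (Y, Z)) - g (D_X Y, Z) - g (Y, D_X Z) = α (X) g (Y, Z)`. -/
def DerivMetricEq (g : Metric E M) (D : Connection E M)
    (α : Π x : M, TangentSpace 𝓘(ℝ, E) x →L[ℝ] ℝ) : Prop :=
  ∀ (x : M) (v : TangentSpace 𝓘(ℝ, E) x) (Y Z : Π x : M, TangentSpace 𝓘(ℝ, E) x),
    DiffFieldAt Y x → DiffFieldAt Z x →
    mvfderiv 𝓘(ℝ, E) (fun y ↦ g.inner y (Y y) (Z y)) x v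
      - g.inner x (D Y x v) (Z x) - g.inner x (Y x) (D Z x v) = α x v * g.inner x (Y x) (Z x)

/-- `ξ` is a Killing field of `g`: it is smooth and `L_ξ g = 0`, that is
`ξ (g (X, Y)) - g ([ξ, X], Y) - g (X, [ξ, Y]) = 0`. -/
def IsKilling (g : Metric E M) (ξ : Π x : M, TangentSpace 𝓘(ℝ, E) x) : Prop :=
  SmoothField ξ ∧
  ∀ (x : M) (X Y : Π x : M, TangentSpace 𝓘(ℝ, E) x),
    DiffFieldAt X x → DiffFieldAt Y x →
    mvfderiv 𝓘(ℝ, E) (fun y ↦ g.inner y (X y) (Y y)) x (ξ x)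
      - g.inner x (mlieBracket 𝓘(ℝ, E) ξ X x) (Y x)
      - g.inner x (X x) (mlieBracket 𝓘(ℝ, E) ξ Y x) = 0

/-- `R(X, Y) Z = D_X D_Y Z - D_Y D_X Z - D_[X, Y] Z`. -/
def curvature (D : Connection E M) (X Y Z : Π x : M, TangentSpace 𝓘(ℝ, E) x) (x : M) :
    TangentSpace 𝓘(ℝ, E) x :=
  D (fun y ↦ D Z y (Y y)) x (X x) - D (fun y ↦ D Z y (X y)) x (Y x)
    - D Z x (mlieBracket 𝓘(ℝ, E) X Y x)

/-- The Ricci tensor `ρ^D (u, v) = tr (w ↦ R(w, u) v)` of a connection. The curvature is tensorial,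
so it may be computed with any smooth local extensions of the tangent vectors; the trace is
computed in a basis of the tangent space. -/
def ricci [FiniteDimensional ℝ E] (D : Connection E M) (x : M) (u v : TangentSpace 𝓘(ℝ, E) x) : ℝ :=
  letI b : Module.Basis (Fin (Module.finrank ℝ E)) ℝ (TangentSpace 𝓘(ℝ, E) x) :=
    Module.finBasis ℝ E
  ∑ i, b.coord i (curvature D (FiberBundle.extend E (b i)) (FiberBundle.extend E u)
    (FiberBundle.extend E v) x)

variable [FiniteDimensional ℝ E]

/-- The torsion `D_X Y - D_Y X - [X, Y]` of `D` vanishes. -/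
def IsTorsionFree (D : Connection E M) : Prop :=
  haveI : CompleteSpace E := FiniteDimensional.complete ℝ E
  D.torsion = 0

/-- `D` is the Levi-Civita connection of `g`: it is torsion free and `D g = 0`. -/
structure IsLeviCivita (g : Metric E M) (D : Connection E M) : Prop where
  torsion_free : IsTorsionFree D
  deriv_metric : DerivMetricEq g D 0

/-- `δα = - div α^♯ = - tr (∇ α^♯)`, where `D = ∇` is meant to be the Levi-Civita connection
of `g`. -/
def codifferential (g : Metric E M) (D : Connection E M)
    (α : Π x : M, TangentSpace 𝓘(ℝ, E) x →L[ℝ] ℝ) (x : M) : ℝ :=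
  - LinearMap.trace ℝ (TangentSpace 𝓘(ℝ, E) x) (D (sharp g α) x).toLinearMap

/-- The smooth torsion-free connection `D` preserves the conformal class of `g`, with `D g = θ ⊗ g`,
and the symmetrized Ricci tensor of `D` is a multiple of `g`. (Replacing `g` by `e^u g` replaces
`θ` by `θ + du`, so this is a property of the conformal class and `D`, with `θ` attached to the
representative `g`.) -/
structure IsEinsteinWeyl (g : Metric E M) (D : Connection E M)
    (θ : Π x : M, TangentSpace 𝓘(ℝ, E) x →L[ℝ] ℝ) : Prop where
  smooth : CovariantDerivative.ContMDiffCovariantDerivative D ∞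
  torsion_free : IsTorsionFree D
  smooth_form : IsSmoothOneForm θ
  deriv_metric : DerivMetricEq g D θ
  ricci_eq : ∃ Λ : M → ℝ, ContMDiff 𝓘(ℝ, E) 𝓘(ℝ, ℝ) ∞ Λ ∧
    ∀ (x : M) (u v : TangentSpace 𝓘(ℝ, E) x), ricci D x u v + ricci D x v u = Λ x * g.inner x u v

/-- `g` is a standard (Gauduchon) metric for the Weyl structure with 1-form `θ`: `δθ = 0`. The
connection `D` here is the Levi-Civita connection of `g`, which is unique. -/
def IsStandard (g : Metric E M)
    (θ : Π x : M, TangentSpace 𝓘(ℝ, E) x →L[ℝ] ℝ) : Prop :=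
  ∃ D : Connection E M, IsLeviCivita g D ∧ ∀ x, codifferential g D θ x = 0

end Real

section Complex

variable {E : Type*} [NormedAddCommGroup E] [NormedSpace ℂ E]
  {M : Type*} [TopologicalSpace M] [ChartedSpace E M]

/-- A complex manifold is a smooth real manifold with the same charts. -/
instance isManifold_real [h : IsManifold 𝓘(ℂ, E) ω M] : IsManifold 𝓘(ℝ, E) ∞ M := by
  apply isManifold_of_contDiffOn
  intro e e' he he'
  have h1 := contDiffGroupoid_le (I := 𝓘(ℂ, E)) (m := ∞) (n := ω) le_top (h.compatible he he')
  have h2 := ((mem_groupoid_of_pregroupoid).1 h1).1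
  exact ContDiffOn.restrict_scalars ℝ h2

/-- The complex structure `J` on the real tangent spaces of a complex manifold. The tangent space at
`x` is the model space `E`, through a holomorphic chart at `x`, and `J` is multiplication by `i`;
as coordinate changes have complex linear derivatives, every holomorphic chart gives the same `J`. -/
def J (x : M) : TangentSpace 𝓘(ℝ, E) x →L[ℝ] TangentSpace 𝓘(ℝ, E) x :=
  (Complex.I • ContinuousLinearMap.id ℝ E : E →L[ℝ] E)

variable [IsManifold 𝓘(ℂ, E) ω M]

/-- The vector field `ξ` is (real) holomorphic: it is smooth and `L_ξ J = 0`, that is `[ξ, J X] = J [ξ, X]`. -/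
def IsHolomorphicField (ξ : Π x : M, TangentSpace 𝓘(ℝ, E) x) : Prop :=
  SmoothField ξ ∧
  ∀ (x : M) (X : Π x : M, TangentSpace 𝓘(ℝ, E) x), DiffFieldAt X x →
    mlieBracket 𝓘(ℝ, E) ξ (fun y ↦ J y (X y)) x = J x (mlieBracket 𝓘(ℝ, E) ξ X x)

/-- `g (J X, J Y) = g (X, Y)`. -/
def IsHermitian (g : Metric E M) : Prop :=
  ∀ (x : M) (u v : TangentSpace 𝓘(ℝ, E) x), g.inner x (J x u) (J x v) = g.inner x u v

/-- `g` is a Kähler metric on the complex manifold `(M, J)`: it is Hermitian and `J` is parallel for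
its Levi-Civita connection, `∇ (J X) = J (∇ X)`. -/
def IsKaehler [FiniteDimensional ℝ E] (g : Metric E M) : Prop :=
  IsHermitian g ∧ ∃ D : Connection E M, IsLeviCivita g D ∧
    ∀ (x : M) (v : TangentSpace 𝓘(ℝ, E) x) (X : Π x : M, TangentSpace 𝓘(ℝ, E) x),
      DiffFieldAt X x → D (fun y ↦ J y (X y)) x v = J x (D X x v)

end Complex

end EinsteinWeyl

end

/-! Write `ξ = sharp g θ`, `n` for the real dimension, `∇` for the Levi-Civita connection of the
metric at hand and `T = ∇ξ`. Two Bochner-type arguments show that `ξ` is Killing for `g`, then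
holomorphic and Killing for the Kähler metric `g₁ = f² g`. The collinearity is then linear algebra
at a point.

Killing for `g`. Symmetrising the Ricci tensor of the Weyl connection and using `δθ = 0`, the
Einstein–Weyl equation becomes `Ric = L g - k S - k θ ⊗ θ`, where `k = (n - 2) / 4`, `S` is twice
the symmetric part of `T` and `L = Λ / 2 + k |ξ|²`. The contracted Bianchi identity, evaluated on
`ξ`, expresses `ξ(L)` through derivatives of `S`. Hence the field dual to `S(ξ, ·) / 2 + L θ` has
divergence `|S|² / 4` (`trace_covField_of_einsteinWeyl`). On a compact manifold a nonnegative
divergence vanishes (`trace_eq_zero_of_nonneg`), so `S = 0` (`IsEinsteinWeyl.covField_skew`).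

Holomorphic and Killing for `g₁`. A Killing field of `g` is conformal for `f² g`, with factor `l =
ξ(f) / f`. On a Kähler manifold the form dual to `Jξ` has a closed exterior derivative; contracting
that closedness with `J` shows that `(n - 2) l ξ - (∇_ξ ξ + J ∇_{Jξ} ξ)` has divergence `n (n - 2)
l² + |T + JTJ|² / 2` (`trace_covField_of_conformal`). Both terms are nonnegative, so `l = 0` and `T`
commutes with `J` (`covField_of_conformal`). In particular `df(ξ) = 0`.

Collinearity. The skew part of the Ricci tensor of the Weyl connection is a nonzero multiple of
`dθ`, so `dθ` is `J`-invariant. Since `T` for `g₁` commutes with `J`, so is `d(f² θ) = 2 f df ∧ θ +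
f² dθ`, hence also `df ∧ θ`. Inserting `ξ` and using `df(ξ) = 0 = θ(Jξ)` gives `|ξ|² df = df(Jξ)
g(Jξ, ·)` (`collinear_of_invariant`).

All tensor calculus takes place in charts, with Christoffel symbols as functions on the model space.
The divergence theorem is proved chart by chart with a partition of unity, without a global
Riemannian measure. -/

set_option linter.unusedSectionVars false
set_option maxSynthPendingDepth 3

noncomputable section

namespace EinsteinWeyl

/-! ### Tangent vectors, fields and brackets in a chart -/

section Charts

variable {E : Type*} [NormedAddCommGroup E] [NormedSpace ℝ E]
  {M : Type*} [TopologicalSpace M] [ChartedSpace E M] [IsManifold 𝓘(ℝ, E) ∞ M]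

/-- The linear map from the model space to the tangent space at `q` given by the chart at `p`. -/
def frame (p q : M) : E →L[ℝ] TangentSpace 𝓘(ℝ, E) q :=
  (tangentCoordChange 𝓘(ℝ, E) p q q : E →L[ℝ] E)

/-- The coordinates, in the chart at `p`, of the tangent vectors at `q`. -/
def coframe (p q : M) : TangentSpace 𝓘(ℝ, E) q →L[ℝ] E :=
  (tangentCoordChange 𝓘(ℝ, E) q p q : E →L[ℝ] E)

theorem frame_coframe {p q : M} (hq : q ∈ (chartAt E p).source) (v : TangentSpace 𝓘(ℝ, E) q) :
    frame p q (coframe p q v) = v := by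
  have h : q ∈ (extChartAt 𝓘(ℝ, E) q).source ∩ (extChartAt 𝓘(ℝ, E) p).source ∩
      (extChartAt 𝓘(ℝ, E) q).source := by simp [hq]
  exact (tangentCoordChange_comp (I := 𝓘(ℝ, E)) (v := v) h).trans
    (tangentCoordChange_self (I := 𝓘(ℝ, E)) h.2)

theorem coframe_frame {p q : M} (hq : q ∈ (chartAt E p).source) (v : E) :
    coframe p q (frame p q v) = v := by
  have h : q ∈ (extChartAt 𝓘(ℝ, E) p).source ∩ (extChartAt 𝓘(ℝ, E) q).source ∩
      (extChartAt 𝓘(ℝ, E) p).source := by simp [hq]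
  exact (tangentCoordChange_comp (I := 𝓘(ℝ, E)) (v := v) h).trans
    (tangentCoordChange_self (I := 𝓘(ℝ, E)) h.2)

/-- A vector field on `M` read in the chart at `p`. -/
def fieldIn (p : M) (X : Π x : M, TangentSpace 𝓘(ℝ, E) x) (y : E) : E :=
  coframe p ((chartAt E p).symm y) (X ((chartAt E p).symm y))

theorem symm_mem_source {p : M} {y : E} (hy : y ∈ (chartAt E p).target) :
    (chartAt E p).symm y ∈ (chartAt E p).source := (chartAt E p).map_target hy

theorem frame_fieldIn {p : M} (X : Π x : M, TangentSpace 𝓘(ℝ, E) x) {y : E}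
    (hy : y ∈ (chartAt E p).target) :
    frame p _ (fieldIn p X y) = X ((chartAt E p).symm y) :=
  frame_coframe (symm_mem_source hy) _

theorem mfderiv_chart_symm {p : M} {y : E} (hy : y ∈ (chartAt E p).target) :
    mfderiv 𝓘(ℝ, E) 𝓘(ℝ, E) (chartAt E p).symm y
      = (frame p ((chartAt E p).symm y) : E →L[ℝ] _) := by
  have h1 := TangentBundle.symmL_trivializationAt (I := 𝓘(ℝ, E)) (symm_mem_source hy)
  have h2 := TangentBundle.symmL_trivializationAt_eq_core (I := 𝓘(ℝ, E)) (symm_mem_source hy)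
  rw [h1] at h2
  simp only [mfld_simps, modelWithCornersSelf_coe, Set.range_id, mfderivWithin_univ] at h2
  have h3 : chartAt E p ((chartAt E p).symm y) = y := (chartAt E p).right_inv hy
  -- The base point occurs in dependent types, so it is generalised to `z` before being identified
  -- with `y`.
  have h4 : ∀ z, z = y → mfderiv 𝓘(ℝ, E) 𝓘(ℝ, E) (chartAt E p).symm z =
    (tangentBundleCore 𝓘(ℝ, E) M).coordChange (achart E p) (achart E ((chartAt E p).symm y))
      ((chartAt E p).symm y) → mfderiv 𝓘(ℝ, E) 𝓘(ℝ, E) (chartAt E p).symm y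
      = (frame p ((chartAt E p).symm y) : E →L[ℝ] _) := by
    rintro z rfl h
    exact h
  exact h4 _ h3 h2

theorem mdifferentiableAt_chart_symm {p : M} {y : E} (hy : y ∈ (chartAt E p).target) :
    MDifferentiableAt 𝓘(ℝ, E) 𝓘(ℝ, E) (chartAt E p).symm y :=
  mdifferentiableAt_atlas_symm (chart_mem_atlas E p) hy

theorem mvfderiv_frame {p : M} {y : E} (hy : y ∈ (chartAt E p).target) {f : M → ℝ}
    (hf : MDifferentiableAt 𝓘(ℝ, E) 𝓘(ℝ, ℝ) f ((chartAt E p).symm y)) (u : E) :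
    mvfderiv 𝓘(ℝ, E) f ((chartAt E p).symm y) (frame p _ u)
      = fderiv ℝ (f ∘ (chartAt E p).symm) y u := by
  have h := mvfderiv_comp_apply y hf (mdifferentiableAt_chart_symm hy) u
  rw [mfderiv_chart_symm hy] at h
  refine h.symm.trans ?_
  simp [mvfderiv]
  rfl

theorem contMDiffAt_comp_chart_symm_iff {p : M} {y : E} (hy : y ∈ (chartAt E p).target)
    {F : Type*} [NormedAddCommGroup F] [NormedSpace ℝ F] {f : M → F} :
    ContMDiffAt 𝓘(ℝ, E) 𝓘(ℝ, F) ∞ f ((chartAt E p).symm y) ↔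
      ContDiffAt ℝ ∞ (f ∘ (chartAt E p).symm) y := by
  rw [contMDiffAt_iff_source_of_mem_source (x := p) (symm_mem_source hy), ← contMDiffAt_iff_contDiffAt]
  simp [mfld_simps, (chartAt E p).right_inv hy, contMDiffWithinAt_univ]

theorem mdifferentiableAt_comp_chart_symm_iff {p : M} {y : E} (hy : y ∈ (chartAt E p).target)
    {F : Type*} [NormedAddCommGroup F] [NormedSpace ℝ F] {f : M → F} :
    MDifferentiableAt 𝓘(ℝ, E) 𝓘(ℝ, F) f ((chartAt E p).symm y) ↔
      DifferentiableAt ℝ (f ∘ (chartAt E p).symm) y := by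
  rw [← mdifferentiableAt_iff_differentiableAt]
  refine ⟨fun h ↦ h.comp y (mdifferentiableAt_chart_symm hy), fun h ↦ ?_⟩
  have h1 : MDifferentiableAt 𝓘(ℝ, E) 𝓘(ℝ, E) (chartAt E p) ((chartAt E p).symm y) :=
    mdifferentiableAt_atlas (chart_mem_atlas E p) (symm_mem_source hy)
  have h2 := MDifferentiableAt.comp ((chartAt E p).symm y)
    (by rw [(chartAt E p).right_inv hy]; exact h) h1
  refine h2.congr_of_eventuallyEq ?_
  filter_upwards [(chartAt E p).open_source.mem_nhds (symm_mem_source hy)] with q hq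
  simp [(chartAt E p).left_inv hq]

theorem diffFieldAt_iff {p : M} {y : E} (hy : y ∈ (chartAt E p).target)
    {X : Π x : M, TangentSpace 𝓘(ℝ, E) x} :
    DiffFieldAt X ((chartAt E p).symm y) ↔ DifferentiableAt ℝ (fieldIn p X) y :=
  ((trivializationAt E (TangentSpace 𝓘(ℝ, E)) p).mdifferentiableAt_section_iff 𝓘(ℝ, E) X
    (symm_mem_source hy)).trans (mdifferentiableAt_comp_chart_symm_iff hy)

theorem contMDiffAt_field_iff {p : M} {y : E} (hy : y ∈ (chartAt E p).target)
    {X : Π x : M, TangentSpace 𝓘(ℝ, E) x} :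
    ContMDiffAt 𝓘(ℝ, E) 𝓘(ℝ, E).tangent ∞
      (fun y ↦ (⟨y, X y⟩ : TangentBundle 𝓘(ℝ, E) M)) ((chartAt E p).symm y) ↔
    ContDiffAt ℝ ∞ (fieldIn p X) y :=
  ((trivializationAt E (TangentSpace 𝓘(ℝ, E)) p).contMDiffAt_section_iff
    (symm_mem_source hy)).trans (contMDiffAt_comp_chart_symm_iff hy)

theorem smoothField_iff {X : Π x : M, TangentSpace 𝓘(ℝ, E) x} :
    SmoothField X ↔ ∀ p : M, ∀ y ∈ (chartAt E p).target, ContDiffAt ℝ ∞ (fieldIn p X) y := by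
  refine ⟨fun h p y hy ↦ (contMDiffAt_field_iff hy).1 (h _), fun h p ↦ ?_⟩
  have := (contMDiffAt_field_iff (mem_chart_target E p)).2 (h p _ (mem_chart_target E p))
  rwa [(chartAt E p).left_inv (mem_chart_source E p)] at this

/-- The field which is constant, equal to `v`, in the chart at `p`. -/
def constField (p : M) (v : E) (q : M) : TangentSpace 𝓘(ℝ, E) q := frame p q v

theorem fieldIn_constField {p : M} (v : E) {y : E} (hy : y ∈ (chartAt E p).target) :
    fieldIn p (constField p v) y = v := coframe_frame (symm_mem_source hy) v

theorem fieldIn_constField_eventually {p : M} (v : E) {y : E} (hy : y ∈ (chartAt E p).target) :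
    fieldIn p (constField p v) =ᶠ[nhds y] fun _ ↦ v := by
  filter_upwards [(chartAt E p).open_target.mem_nhds hy] with z hz using fieldIn_constField v hz

theorem contDiffAt_constField {p : M} (v : E) {y : E} (hy : y ∈ (chartAt E p).target) :
    ContDiffAt ℝ ∞ (fieldIn p (constField p v)) y :=
  contDiffAt_const.congr_of_eventuallyEq (fieldIn_constField_eventually v hy)

theorem diffFieldAt_constField {p : M} (v : E) {y : E} (hy : y ∈ (chartAt E p).target) :
    DiffFieldAt (constField p v) ((chartAt E p).symm y) :=
  (diffFieldAt_iff hy).2 ((contDiffAt_constField v hy).differentiableAt (by simp))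

/-- The bracket is natural under pullback along the inverse chart, and on the model space it is the
usual commutator of derivatives. -/
theorem mlieBracket_frame [CompleteSpace E] {p : M} {y : E} (hy : y ∈ (chartAt E p).target)
    {X Y : Π x : M, TangentSpace 𝓘(ℝ, E) x}
    (hX : DiffFieldAt X ((chartAt E p).symm y)) (hY : DiffFieldAt Y ((chartAt E p).symm y)) :
    mlieBracket 𝓘(ℝ, E) X Y ((chartAt E p).symm y) =
      frame p _ (fderiv ℝ (fieldIn p Y) y (fieldIn p X y)
        - fderiv ℝ (fieldIn p X) y (fieldIn p Y y)) := by
  have inv : ∀ z ∈ (chartAt E p).target,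
      (mfderiv 𝓘(ℝ, E) 𝓘(ℝ, E) (chartAt E p).symm z).inverse
        = coframe p ((chartAt E p).symm z) := by
    intro z hz
    rw [mfderiv_chart_symm hz]
    apply ContinuousLinearMap.inverse_eq
    · ext v; exact frame_coframe (symm_mem_source hz) v
    · ext v; exact coframe_frame (symm_mem_source hz) v
  have hs : ContMDiffAt 𝓘(ℝ, E) 𝓘(ℝ, E) ∞ (chartAt E p).symm y :=
    (contMDiffOn_chart_symm y hy).contMDiffAt ((chartAt E p).open_target.mem_nhds hy)
  have two_le : (2 : ℕ∞ω) ≤ ∞ := WithTop.coe_le_coe.2 le_top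
  have : IsManifold 𝓘(ℝ, E) (minSmoothness ℝ 2) M := by
    rw [minSmoothness_of_isRCLikeNormedField]; exact IsManifold.of_le (n := ∞) two_le
  have h := mpullback_mlieBracket (n := ∞) hX hY hs
    (by rw [minSmoothness_of_isRCLikeNormedField]; exact two_le)
  have e : ∀ Z : Π x : M, TangentSpace 𝓘(ℝ, E) x,
      mpullback 𝓘(ℝ, E) 𝓘(ℝ, E) (chartAt E p).symm Z =ᶠ[nhds y] fieldIn p Z := by
    intro Z
    filter_upwards [(chartAt E p).open_target.mem_nhds hy] with z hz
    rw [mpullback_apply, inv z hz]; rfl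
  have hb : ∀ V W : Π z : E, TangentSpace 𝓘(ℝ, E) z,
      mlieBracket 𝓘(ℝ, E) V W = lieBracket ℝ V W := fun V W ↦ by
    rw [← mlieBracketWithin_univ, mlieBracketWithin_eq_lieBracketWithin]
    exact lieBracketWithin_univ
  rw [(e X).mlieBracket_vectorField_eq (e Y), mpullback_apply, inv y hy] at h
  have h' : coframe p _ (mlieBracket 𝓘(ℝ, E) X Y ((chartAt E p).symm y))
    = lieBracket ℝ (fieldIn p X) (fieldIn p Y) y := h.trans (congrFun (hb _ _) y)
  rw [← frame_coframe (symm_mem_source hy) (mlieBracket 𝓘(ℝ, E) X Y ((chartAt E p).symm y)), h']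
  rfl

end Charts

/-! ### Metrics and 1-forms in a chart, and smoothness of dual fields -/

section Local

variable {E : Type*} [NormedAddCommGroup E] [NormedSpace ℝ E]
  {M : Type*} [TopologicalSpace M] [ChartedSpace E M] [IsManifold 𝓘(ℝ, E) ∞ M]

/-- The metric read in the chart at `p`. -/
def metricIn (g : Metric E M) (p : M) (y : E) : E →L[ℝ] E →L[ℝ] ℝ :=
  let B : E →L[ℝ] E →L[ℝ] ℝ := g.inner ((chartAt E p).symm y)
  let F : E →L[ℝ] E := frame p ((chartAt E p).symm y)
  B.bilinearComp F F

theorem metricIn_apply (g : Metric E M) (p : M) (y u v : E) :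
    metricIn g p y u v = g.inner ((chartAt E p).symm y) (frame p _ u) (frame p _ v) := rfl

/-- A 1-form read in the chart at `p`. -/
def formIn (p : M) (α : Π x : M, TangentSpace 𝓘(ℝ, E) x →L[ℝ] ℝ) (y : E) : E →L[ℝ] ℝ :=
  (α ((chartAt E p).symm y)).comp (frame p ((chartAt E p).symm y))

theorem formIn_apply (p : M) (α : Π x : M, TangentSpace 𝓘(ℝ, E) x →L[ℝ] ℝ) (y u : E) :
    formIn p α y u = α ((chartAt E p).symm y) (frame p _ u) := rfl

theorem metricIn_symm (g : Metric E M) (p : M) (y u v : E) :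
    metricIn g p y u v = metricIn g p y v u := by
  rw [metricIn_apply, metricIn_apply, g.symm]

theorem metricIn_pos (g : Metric E M) {p : M} {y : E} (hy : y ∈ (chartAt E p).target) {u : E}
    (hu : u ≠ 0) : 0 < metricIn g p y u u := by
  rw [metricIn_apply]
  refine g.pos _ _ fun h ↦ hu ?_
  rw [← coframe_frame (symm_mem_source hy) u, h, map_zero]

theorem inner_eq_metricIn (g : Metric E M) {p : M} {y : E} (hy : y ∈ (chartAt E p).target)
    (X Y : Π x : M, TangentSpace 𝓘(ℝ, E) x) :
    g.inner ((chartAt E p).symm y) (X _) (Y _) = metricIn g p y (fieldIn p X y) (fieldIn p Y y) := by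
  rw [metricIn_apply, frame_fieldIn X hy, frame_fieldIn Y hy]

theorem contMDiffAt_constField {p : M} (v : E) {q : M} (hq : q ∈ (chartAt E p).source) :
    ContMDiffAt 𝓘(ℝ, E) 𝓘(ℝ, E).tangent ∞
      (fun x ↦ (⟨x, constField p v x⟩ : TangentBundle 𝓘(ℝ, E) M)) q := by
  have := (contMDiffAt_field_iff ((chartAt E p).map_source hq)).2
    (contDiffAt_constField v ((chartAt E p).map_source hq))
  rwa [(chartAt E p).left_inv hq] at this

theorem contMDiffAt_inner (g : Metric E M) {q : M} {X Y : Π x : M, TangentSpace 𝓘(ℝ, E) x}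
    (hX : ContMDiffAt 𝓘(ℝ, E) 𝓘(ℝ, E).tangent ∞
      (fun x ↦ (⟨x, X x⟩ : TangentBundle 𝓘(ℝ, E) M)) q)
    (hY : ContMDiffAt 𝓘(ℝ, E) 𝓘(ℝ, E).tangent ∞
      (fun x ↦ (⟨x, Y x⟩ : TangentBundle 𝓘(ℝ, E) M)) q) :
    ContMDiffAt 𝓘(ℝ, E) 𝓘(ℝ, ℝ) ∞ (fun x ↦ g.inner x (X x) (Y x)) q := by
  have : ContMDiffAt 𝓘(ℝ, E) (𝓘(ℝ, E).prod 𝓘(ℝ)) ∞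
      (fun m ↦ TotalSpace.mk' ℝ (E := Bundle.Trivial M ℝ) m (g.inner m (X m) (Y m))) q := by
    apply ContMDiffAt.clm_bundle_apply₂ (F₁ := E) (F₂ := E)
    · exact g.contMDiff.contMDiffAt
    · exact hX
    · exact hY
  simp only [contMDiffAt_totalSpace] at this
  exact this.2

theorem contMDiffAt_form {α : Π x : M, TangentSpace 𝓘(ℝ, E) x →L[ℝ] ℝ} (hα : IsSmoothOneForm α)
    {q : M} {X : Π x : M, TangentSpace 𝓘(ℝ, E) x}
    (hX : ContMDiffAt 𝓘(ℝ, E) 𝓘(ℝ, E).tangent ∞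
      (fun x ↦ (⟨x, X x⟩ : TangentBundle 𝓘(ℝ, E) M)) q) :
    ContMDiffAt 𝓘(ℝ, E) 𝓘(ℝ, ℝ) ∞ (fun x ↦ α x (X x)) q := by
  have : ContMDiffAt 𝓘(ℝ, E) (𝓘(ℝ, E).prod 𝓘(ℝ)) ∞
      (fun m ↦ TotalSpace.mk' ℝ (E := Bundle.Trivial M ℝ) m (α m (X m))) q := by
    apply ContMDiffAt.clm_bundle_apply (F₁ := E)
    · exact hα.contMDiffAt
    · exact hX
  simp only [contMDiffAt_totalSpace] at this
  exact this.2

variable [FiniteDimensional ℝ E]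

theorem contDiffOn_metricIn (g : Metric E M) (p : M) :
    ContDiffOn ℝ ∞ (metricIn g p) (chartAt E p).target := by
  rw [contDiffOn_clm_apply]; intro u
  rw [contDiffOn_clm_apply]; intro v y hy
  refine ContDiffAt.contDiffWithinAt ?_
  exact (contMDiffAt_comp_chart_symm_iff hy).1 (contMDiffAt_inner g
    (contMDiffAt_constField u (symm_mem_source hy)) (contMDiffAt_constField v (symm_mem_source hy)))

theorem contDiffOn_formIn {α : Π x : M, TangentSpace 𝓘(ℝ, E) x →L[ℝ] ℝ} (hα : IsSmoothOneForm α)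
    (p : M) : ContDiffOn ℝ ∞ (formIn p α) (chartAt E p).target := by
  rw [contDiffOn_clm_apply]; intro u y hy
  refine ContDiffAt.contDiffWithinAt ?_
  exact (contMDiffAt_comp_chart_symm_iff hy).1 (contMDiffAt_form hα
    (contMDiffAt_constField u (symm_mem_source hy)))

theorem contDiffAt_metricIn (g : Metric E M) {p : M} {y : E} (hy : y ∈ (chartAt E p).target) :
    ContDiffAt ℝ ∞ (metricIn g p) y :=
  (contDiffOn_metricIn g p).contDiffAt ((chartAt E p).open_target.mem_nhds hy)

theorem contDiffAt_formIn {α : Π x : M, TangentSpace 𝓘(ℝ, E) x →L[ℝ] ℝ} (hα : IsSmoothOneForm α)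
    {p : M} {y : E} (hy : y ∈ (chartAt E p).target) : ContDiffAt ℝ ∞ (formIn p α) y :=
  (contDiffOn_formIn hα p).contDiffAt ((chartAt E p).open_target.mem_nhds hy)

/-- A vector field is determined smoothly by its `g`-dual 1-form. -/
theorem contDiffAt_of_metric {k : ℕ∞ω} {y₀ : E} {G : E → E →L[ℝ] E →L[ℝ] ℝ} {X : E → E}
    {α : E → E →L[ℝ] ℝ} (hG : ContDiffAt ℝ k G y₀) (hα : ContDiffAt ℝ k α y₀)
    (hpos : ∀ u, u ≠ 0 → 0 < G y₀ u u) (h : ∀ᶠ y in nhds y₀, ∀ u, G y (X y) u = α y u) :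
    ContDiffAt ℝ k X y₀ := by
  have : CompleteSpace E := FiniteDimensional.complete ℝ E
  have hinj : Function.Injective (G y₀) := by
    rw [injective_iff_map_eq_zero]
    intro v hv
    by_contra hne
    exact (hpos v hne).ne' (by rw [hv]; rfl)
  have hdim : Module.finrank ℝ E = Module.finrank ℝ (E →L[ℝ] ℝ) := by
    rw [← (LinearMap.toContinuousLinearMap (𝕜 := ℝ) (E := E) (F' := ℝ)).finrank_eq]
    exact Subspace.dual_finrank_eq.symm
  let e : E ≃L[ℝ] (E →L[ℝ] ℝ) := (LinearEquiv.ofInjectiveOfFinrankEq (G y₀ : E →ₗ[ℝ] _)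
    hinj hdim).toContinuousLinearEquiv
  have he : (e : E →L[ℝ] (E →L[ℝ] ℝ)) = G y₀ := by
    ext v w; rfl
  have hinv : ContDiffAt ℝ k (fun y ↦ ContinuousLinearMap.inverse (G y)) y₀ := by
    have h1 := contDiffAt_map_inverse (𝕜 := ℝ) (n := k) e
    rw [he] at h1
    exact h1.comp y₀ hG
  -- `ContinuousLinearMap.inverse` is a true inverse only at invertible maps; these form an open set
  -- containing `G y₀`.
  have hev : ∀ᶠ y in nhds y₀, G y ∈ Set.range
      ((↑) : (E ≃L[ℝ] (E →L[ℝ] ℝ)) → (E →L[ℝ] (E →L[ℝ] ℝ))) :=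
    hG.continuousAt.eventually (by rw [← he]; exact ContinuousLinearEquiv.nhds e)
  refine (hinv.clm_apply hα).congr_of_eventuallyEq ?_
  filter_upwards [hev, h] with y ⟨e', he'⟩ hy
  have : α y = e' (X y) := by
    ext u; rw [← hy u, ← he']; rfl
  rw [this, ← he', ContinuousLinearMap.inverse_equiv]
  simp

theorem inner_sharp_in (g : Metric E M) (α : Π x : M, TangentSpace 𝓘(ℝ, E) x →L[ℝ] ℝ)
    {p : M} {y : E} (hy : y ∈ (chartAt E p).target) (u : E) :
    metricIn g p y (fieldIn p (sharp g α) y) u = formIn p α y u := by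
  rw [metricIn_apply, frame_fieldIn _ hy, inner_sharp]; rfl

theorem contDiffAt_sharp (g : Metric E M) {α : Π x : M, TangentSpace 𝓘(ℝ, E) x →L[ℝ] ℝ}
    {p : M} {y : E} (hy : y ∈ (chartAt E p).target) {k : ℕ∞} (hα : ContDiffAt ℝ k (formIn p α) y) :
    ContDiffAt ℝ k (fieldIn p (sharp g α)) y := by
  refine contDiffAt_of_metric ((contDiffAt_metricIn g hy).of_le (WithTop.coe_le_coe.2 le_top)) hα
    (fun u hu ↦ metricIn_pos g hy hu) ?_
  filter_upwards [(chartAt E p).open_target.mem_nhds hy] with z hz using inner_sharp_in g α hz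

theorem smoothField_sharp (g : Metric E M) {α : Π x : M, TangentSpace 𝓘(ℝ, E) x →L[ℝ] ℝ}
    (hα : IsSmoothOneForm α) : SmoothField (sharp g α) :=
  smoothField_iff.2 fun _ _ hy ↦ contDiffAt_sharp g hy (k := ⊤) (contDiffAt_formIn hα hy)

end Local

/-! ### Christoffel symbols of a connection -/

section Christoffel

variable {E : Type*} [NormedAddCommGroup E] [NormedSpace ℝ E] [FiniteDimensional ℝ E]
  {M : Type*} [TopologicalSpace M] [ChartedSpace E M] [IsManifold 𝓘(ℝ, E) ∞ M]

/-- The Christoffel symbols of `D` in the chart at `p`: `christoffel D p y u v` is the derivative at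
`y`, in the direction `u`, of the field with constant coordinates `v`. -/
def christoffel (D : Connection E M) (p : M) (y : E) : E →L[ℝ] E →L[ℝ] E :=
  ∑ i, (ContinuousLinearMap.smulRightL ℝ E E
    (LinearMap.toContinuousLinearMap ((Module.finBasis ℝ E).coord i))).comp
    ((coframe p ((chartAt E p).symm y)).comp
      ((D (constField p (Module.finBasis ℝ E i)) ((chartAt E p).symm y)).comp
        (frame p ((chartAt E p).symm y))))

theorem christoffel_apply (D : Connection E M) (p : M) (y u v : E) :
    christoffel D p y u v = ∑ i, (Module.finBasis ℝ E).repr v i •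
      coframe p ((chartAt E p).symm y) (D (constField p (Module.finBasis ℝ E i))
        ((chartAt E p).symm y) (frame p _ u)) := by
  simp [christoffel]

theorem diffFieldAt_sum {ι : Type*} (s : Finset ι) {q : M}
    {X : ι → Π x : M, TangentSpace 𝓘(ℝ, E) x} (h : ∀ i ∈ s, DiffFieldAt (X i) q) :
    DiffFieldAt (∑ i ∈ s, X i) q := by
  have hq := mem_chart_target E q
  have e : q = (chartAt E q).symm (chartAt E q q) :=
    ((chartAt E q).left_inv (mem_chart_source E q)).symm
  rw [e, diffFieldAt_iff hq]
  have : fieldIn q (∑ i ∈ s, X i) = fun y ↦ ∑ i ∈ s, fieldIn q (X i) y := by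
    ext y; simp [fieldIn, map_sum]
  rw [this]
  refine DifferentiableAt.fun_sum fun i hi ↦ ?_
  rw [← diffFieldAt_iff hq, ← e]
  exact h i hi

theorem connection_sum (D : Connection E M) {ι : Type*} (s : Finset ι) {q : M}
    {X : ι → Π x : M, TangentSpace 𝓘(ℝ, E) x} (h : ∀ i ∈ s, DiffFieldAt (X i) q) :
    D (∑ i ∈ s, X i) q = ∑ i ∈ s, D (X i) q := by
  classical
  induction s using Finset.induction_on with
  | empty => simp
  | insert a s ha ih =>
    rw [Finset.sum_insert ha, Finset.sum_insert ha,
      D.isCovariantDerivativeOnUniv.add (h a (Finset.mem_insert_self a s))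
        (diffFieldAt_sum s fun i hi ↦ h i (Finset.mem_insert_of_mem hi)),
      ih fun i hi ↦ h i (Finset.mem_insert_of_mem hi)]

/-- Near the point the field is a combination of constant-coordinate fields; locality, additivity
and the Leibniz rule reduce `D` to its values on these, which define `christoffel`. -/
theorem connection_frame (D : Connection E M) {p : M} {y : E} (hy : y ∈ (chartAt E p).target)
    {X : Π x : M, TangentSpace 𝓘(ℝ, E) x} (hX : DiffFieldAt X ((chartAt E p).symm y)) (u : E) :
    D X ((chartAt E p).symm y) (frame p _ u) =
      frame p _ (fderiv ℝ (fieldIn p X) y u + christoffel D p y u (fieldIn p X y)) := by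
  set b := Module.finBasis ℝ E with hb
  let c : Fin (Module.finrank ℝ E) → M → ℝ := fun i q ↦ b.repr (coframe p q (X q)) i
  let L : Fin (Module.finrank ℝ E) → E →L[ℝ] ℝ := fun i ↦ LinearMap.toContinuousLinearMap (b.coord i)
  have hL : ∀ i v, L i v = b.repr v i := fun i v ↦ rfl
  have hXd := (diffFieldAt_iff hy).1 hX
  have hcc : ∀ i, c i ∘ (chartAt E p).symm = fun z ↦ L i (fieldIn p X z) := fun i ↦ rfl
  have hcd : ∀ i, MDifferentiableAt 𝓘(ℝ, E) 𝓘(ℝ, ℝ) (c i) ((chartAt E p).symm y) := fun i ↦ by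
    rw [mdifferentiableAt_comp_chart_symm_iff hy, hcc]
    exact (L i).differentiableAt.comp y hXd
  have hcf : ∀ i, mvfderiv 𝓘(ℝ, E) (c i) ((chartAt E p).symm y) (frame p _ u)
      = L i (fderiv ℝ (fieldIn p X) y u) := fun i ↦ by
    rw [mvfderiv_frame hy (hcd i), hcc, fderiv_fun_comp y (L i).differentiableAt hXd]
    simp
  have hd : ∀ i ∈ Finset.univ, DiffFieldAt (c i • constField p (b i)) ((chartAt E p).symm y) := by
    intro i _
    rw [diffFieldAt_iff hy]
    have : fieldIn p (c i • constField p (b i))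
        = fun z ↦ (c i ∘ (chartAt E p).symm) z • fieldIn p (constField p (b i)) z := by
      ext z; simp [fieldIn]
    rw [this]
    exact ((mdifferentiableAt_comp_chart_symm_iff hy).1 (hcd i)).smul
      ((diffFieldAt_iff hy).1 (diffFieldAt_constField _ hy))
  have hev : ∀ᶠ q in nhds ((chartAt E p).symm y), X q = (∑ i, c i • constField p (b i)) q := by
    filter_upwards [(chartAt E p).open_source.mem_nhds (symm_mem_source hy)] with q hq
    have h1 := congrArg (frame p q) (b.sum_repr (coframe p q (X q)))
    rw [map_sum, frame_coframe hq] at h1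
    rw [← h1]
    simp [c, constField]
  rw [D.isCovariantDerivativeOnUniv.congr_of_eventuallyEq hX (diffFieldAt_sum _ hd)
    Filter.univ_mem hev, connection_sum D _ hd]
  have hlei : ∀ i, D (c i • constField p (b i)) ((chartAt E p).symm y) (frame p _ u) =
      frame p _ (L i (fieldIn p X y) • coframe p _ (D (constField p (b i))
        ((chartAt E p).symm y) (frame p _ u)) + L i (fderiv ℝ (fieldIn p X) y u) • b i) := by
    intro i
    rw [D.isCovariantDerivativeOnUniv.leibniz (diffFieldAt_constField _ hy) (hcd i)]
    rw [add_apply, smul_apply,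
      ContinuousLinearMap.smulRight_apply, hcf, map_add, map_smul, map_smul,
      frame_coframe (symm_mem_source hy)]
    rfl
  rw [sum_apply, Finset.sum_congr rfl fun i _ ↦ hlei i, ← map_sum,
    Finset.sum_add_distrib, add_comm]
  congr 2
  · exact b.sum_repr _
  · rw [christoffel_apply]; rfl

theorem connection_constField (D : Connection E M) {p : M} {y : E} (hy : y ∈ (chartAt E p).target)
    (u v : E) : D (constField p v) ((chartAt E p).symm y) (frame p _ u) =
      frame p _ (christoffel D p y u v) := by
  rw [connection_frame D hy (diffFieldAt_constField v hy), fieldIn_constField v hy,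
    (fieldIn_constField_eventually v hy).fderiv_eq]
  simp

theorem fieldIn_connection (D : Connection E M) {p : M} {y : E} (hy : y ∈ (chartAt E p).target)
    {X Y : Π x : M, TangentSpace 𝓘(ℝ, E) x} (hX : DiffFieldAt X ((chartAt E p).symm y)) :
    fieldIn p (fun q ↦ D X q (Y q)) y =
      fderiv ℝ (fieldIn p X) y (fieldIn p Y y) + christoffel D p y (fieldIn p Y y) (fieldIn p X y) := by
  have h := connection_frame D hy hX (fieldIn p Y y)
  rw [frame_fieldIn Y hy] at h
  change coframe p _ (D X _ (Y _)) = _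
  rw [h, coframe_frame (symm_mem_source hy)]

theorem frame_injective {p q : M} (hq : q ∈ (chartAt E p).source) :
    Function.Injective (frame (E := E) p q) := fun u v h ↦ by
  rw [← coframe_frame hq u, h, coframe_frame hq]

theorem christoffel_symm {D : Connection E M} (hD : IsTorsionFree D) {p : M} {y : E}
    (hy : y ∈ (chartAt E p).target) (u v : E) :
    christoffel D p y u v = christoffel D p y v u := by
  have : CompleteSpace E := FiniteDimensional.complete ℝ E
  have h := (CovariantDerivative.torsion_eq_zero_iff (cov := D)).1 hD
    (diffFieldAt_constField u hy) (diffFieldAt_constField v hy)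
  rw [mlieBracket_frame hy (diffFieldAt_constField u hy) (diffFieldAt_constField v hy),
    (fieldIn_constField_eventually v hy).fderiv_eq,
    (fieldIn_constField_eventually u hy).fderiv_eq] at h
  have e : D (constField p v) ((chartAt E p).symm y) (frame p _ u)
      - D (constField p u) ((chartAt E p).symm y) (frame p _ v) = 0 := by
    refine h.trans ?_
    simp
  rw [connection_constField D hy, connection_constField D hy, sub_eq_zero] at e
  exact frame_injective (symm_mem_source hy) e

theorem fderiv_metricIn {g : Metric E M} {D : Connection E M}
    {α : Π x : M, TangentSpace 𝓘(ℝ, E) x →L[ℝ] ℝ} (h : DerivMetricEq g D α) {p : M} {y : E}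
    (hy : y ∈ (chartAt E p).target) (u v w : E) :
    fderiv ℝ (metricIn g p) y u v w = metricIn g p y (christoffel D p y u v) w
      + metricIn g p y v (christoffel D p y u w) + formIn p α y u * metricIn g p y v w := by
  have h1 := h ((chartAt E p).symm y) (frame p _ u) (constField p v) (constField p w)
    (diffFieldAt_constField v hy) (diffFieldAt_constField w hy)
  have hs : ContMDiffAt 𝓘(ℝ, E) 𝓘(ℝ, ℝ) ∞
      (fun x ↦ g.inner x (constField p v x) (constField p w x)) ((chartAt E p).symm y) :=
    contMDiffAt_inner g (contMDiffAt_constField v (symm_mem_source hy))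
      (contMDiffAt_constField w (symm_mem_source hy))
  rw [mvfderiv_frame hy (hs.mdifferentiableAt (by simp)), connection_constField D hy,
    connection_constField D hy] at h1
  have hd : DifferentiableAt ℝ (metricIn g p) y :=
    (contDiffAt_metricIn g hy).differentiableAt (by simp)
  have h2 : fderiv ℝ ((fun x ↦ g.inner x (constField p v x) (constField p w x)) ∘
      (chartAt E p).symm) y u = fderiv ℝ (metricIn g p) y u v w := by
    change fderiv ℝ (fun z ↦ metricIn g p z v w) y u = _
    rw [fderiv_clm_apply (hd.clm_apply (differentiableAt_const v)) (differentiableAt_const w),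
      fderiv_clm_apply hd (differentiableAt_const v)]
    simp
  rw [h2] at h1
  simp only [metricIn_apply, formIn_apply]
  simp only [constField] at h1
  linarith

/-- Smoothness of a connection is tested on global smooth fields, whereas `constField` is controlled
only on one chart; a bump function supported in the chart bridges the gap. -/
theorem exists_smoothField_eventuallyEq [T2Space M] {p : M} {y : E}
    (hy : y ∈ (chartAt E p).target) (v : E) :
    ∃ X : Π x : M, TangentSpace 𝓘(ℝ, E) x, SmoothField X ∧
      ∀ᶠ q in nhds ((chartAt E p).symm y), X q = constField p v q := by
  obtain ⟨χ, -, hχ⟩ := (SmoothBumpFunction.nhds_basis_tsupport (I := 𝓘(ℝ, E))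
    ((chartAt E p).symm y)).mem_iff.1 ((chartAt E p).open_source.mem_nhds (symm_mem_source hy))
  refine ⟨(χ : M → ℝ) • constField p v, fun q ↦ ?_, ?_⟩
  · by_cases hq : q ∈ (chartAt E p).source
    · exact χ.contMDiff.contMDiffAt.smul_section (contMDiffAt_constField v hq)
    · have hq' : q ∉ tsupport χ := fun h ↦ hq (hχ h)
      have h0 : ContMDiffAt 𝓘(ℝ, E) 𝓘(ℝ, E).tangent ∞
          (fun x ↦ (⟨x, 0⟩ : TangentBundle 𝓘(ℝ, E) M)) q :=
        (contMDiff_zeroSection ℝ (TangentSpace 𝓘(ℝ, E) : M → Type _)).contMDiffAt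
      refine h0.congr_of_eventuallyEq ?_
      filter_upwards [(isClosed_tsupport χ).isOpen_compl.mem_nhds hq'] with x hx
      have : χ x = 0 := image_eq_zero_of_notMem_tsupport hx
      simp [this]
  · filter_upwards [χ.eventuallyEq_one] with q hq
    simp [hq]

theorem contDiffOn_christoffel [T2Space M] {D : Connection E M}
    (hD : CovariantDerivative.ContMDiffCovariantDerivative D ∞) (p : M) :
    ContDiffOn ℝ ∞ (christoffel D p) (chartAt E p).target := by
  have key : ∀ u v, ∀ y ∈ (chartAt E p).target,
      ContDiffAt ℝ ∞ (fun z ↦ coframe p ((chartAt E p).symm z)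
      (D (constField p v) ((chartAt E p).symm z) (frame p _ u))) y := by
    intro u v y hy
    obtain ⟨X, hX, hXv⟩ := exists_smoothField_eventuallyEq hy v
    have h1 := hD.contMDiff.contMDiff (σ := X) (by simpa using! hX.contMDiffOn)
    have h2 := (h1.contMDiffAt (x := (chartAt E p).symm y) Filter.univ_mem).clm_bundle_apply
      (contMDiffAt_constField u (symm_mem_source hy))
    have h3 := (contMDiffAt_field_iff hy).1 h2
    refine h3.congr_of_eventuallyEq ?_
    have hc : Filter.Tendsto (chartAt E p).symm (nhds y) (nhds ((chartAt E p).symm y)) :=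
      (chartAt E p).continuousAt_symm hy
    filter_upwards [(chartAt E p).open_target.mem_nhds hy, hc.eventually hXv.eventually_nhds]
      with z hz hz2
    have : D X ((chartAt E p).symm z) = D (constField p v) ((chartAt E p).symm z) :=
      D.isCovariantDerivativeOnUniv.congr_of_eventuallyEq
        (hX.contMDiffAt.mdifferentiableAt (by simp)) (diffFieldAt_constField v hz)
        Filter.univ_mem hz2
    rw [← this]; rfl
  rw [contDiffOn_clm_apply]; intro u
  rw [contDiffOn_clm_apply]; intro v y hy
  simp only [christoffel_apply]
  exact ContDiffWithinAt.sum fun i _ ↦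
    (contDiffAt_const.smul (key u _ y hy)).contDiffWithinAt

theorem contDiffAt_christoffel [T2Space M] {D : Connection E M}
    (hD : CovariantDerivative.ContMDiffCovariantDerivative D ∞) {p : M} {y : E}
    (hy : y ∈ (chartAt E p).target) : ContDiffAt ℝ ∞ (christoffel D p) y :=
  (contDiffOn_christoffel hD p).contDiffAt ((chartAt E p).open_target.mem_nhds hy)

end Christoffel

/-! ### Product rules and symmetry of second derivatives -/

section Calculus

variable {E : Type*} [NormedAddCommGroup E] [NormedSpace ℝ E]
  {F F' F'' : Type*} [NormedAddCommGroup F] [NormedSpace ℝ F] [NormedAddCommGroup F']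
  [NormedSpace ℝ F'] [NormedAddCommGroup F''] [NormedSpace ℝ F'']

theorem fderiv_apply_const {A : E → F →L[ℝ] F'} {y : E} (hA : DifferentiableAt ℝ A y) (v : F)
    (u : E) : fderiv ℝ (fun z ↦ A z v) y u = fderiv ℝ A y u v := by
  rw [fderiv_clm_apply hA (differentiableAt_const v)]; simp

theorem fderiv_apply_const₂ {A : E → F →L[ℝ] F' →L[ℝ] F''} {y : E} (hA : DifferentiableAt ℝ A y)
    (v : F) (w : F') (u : E) : fderiv ℝ (fun z ↦ A z v w) y u = fderiv ℝ A y u v w := by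
  rw [fderiv_apply_const (hA.clm_apply (differentiableAt_const v)), fderiv_apply_const hA]

theorem fderiv_apply {A : E → F →L[ℝ] F'} {B : E → F} {y : E} (hA : DifferentiableAt ℝ A y)
    (hB : DifferentiableAt ℝ B y) (u : E) :
    fderiv ℝ (fun z ↦ A z (B z)) y u = fderiv ℝ A y u (B y) + A y (fderiv ℝ B y u) := by
  rw [fderiv_clm_apply hA hB]; simp [add_comm]

theorem fderiv_apply₂ {A : E → F →L[ℝ] F' →L[ℝ] F''} {B : E → F} {C : E → F'} {y : E}
    (hA : DifferentiableAt ℝ A y) (hB : DifferentiableAt ℝ B y) (hC : DifferentiableAt ℝ C y)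
    (u : E) : fderiv ℝ (fun z ↦ A z (B z) (C z)) y u =
      fderiv ℝ A y u (B y) (C y) + A y (fderiv ℝ B y u) (C y) + A y (B y) (fderiv ℝ C y u) := by
  rw [fderiv_apply (hA.clm_apply hB) hC, fderiv_apply hA hB]; simp

theorem differentiableAt_fderiv {f : E → F} {y : E} (hf : ContDiffAt ℝ ∞ f y) :
    DifferentiableAt ℝ (fderiv ℝ f) y :=
  (hf.fderiv_right (m := 1) (WithTop.coe_le_coe.2 le_top)).differentiableAt (by simp)

theorem fderiv_fderiv_symm {f : E → F} {y : E} (hf : ContDiffAt ℝ ∞ f y) (u v : E) :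
    fderiv ℝ (fderiv ℝ f) y u v = fderiv ℝ (fderiv ℝ f) y v u :=
  hf.isSymmSndFDerivAt (by rw [minSmoothness_of_isRCLikeNormedField]; exact WithTop.coe_le_coe.2 le_top) u v

end Calculus

/-! ### Curvature and Ricci tensors of given Christoffel symbols -/

section Curvature

variable {E : Type*} [NormedAddCommGroup E] [NormedSpace ℝ E]

/-- The curvature tensor of the connection with Christoffel symbols `Γ`. -/
def riem (Γ : E → E →L[ℝ] E →L[ℝ] E) (y : E) : E →L[ℝ] E →L[ℝ] E →L[ℝ] E :=
  fderiv ℝ Γ y - (fderiv ℝ Γ y).flip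
    + (ContinuousLinearMap.compL ℝ E E E).bilinearComp (Γ y) (Γ y)
    - ((ContinuousLinearMap.compL ℝ E E E).bilinearComp (Γ y) (Γ y)).flip

theorem riem_apply (Γ : E → E →L[ℝ] E →L[ℝ] E) (y u v w : E) :
    riem Γ y u v w = fderiv ℝ Γ y u v w - fderiv ℝ Γ y v u w
      + Γ y u (Γ y v w) - Γ y v (Γ y u w) := rfl

theorem riem_swap (Γ : E → E →L[ℝ] E →L[ℝ] E) (y u v w : E) :
    riem Γ y u v w = - riem Γ y v u w := by
  simp only [riem_apply]; abel

/-- The curvature operator applied to vector fields on an open set is given by the curvature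
tensor. -/
theorem riem_fields {Γ : E → E →L[ℝ] E →L[ℝ] E} {y : E} (hΓ : ContDiffAt ℝ ∞ Γ y) {X Y Z : E → E}
    (hX : ContDiffAt ℝ ∞ X y) (hY : ContDiffAt ℝ ∞ Y y) (hZ : ContDiffAt ℝ ∞ Z y) :
    (fderiv ℝ (fun z ↦ fderiv ℝ Z z (Y z) + Γ z (Y z) (Z z)) y (X y)
        + Γ y (X y) (fderiv ℝ Z y (Y y) + Γ y (Y y) (Z y)))
      - (fderiv ℝ (fun z ↦ fderiv ℝ Z z (X z) + Γ z (X z) (Z z)) y (Y y)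
        + Γ y (Y y) (fderiv ℝ Z y (X y) + Γ y (X y) (Z y)))
      - (fderiv ℝ Z y (fderiv ℝ Y y (X y) - fderiv ℝ X y (Y y))
        + Γ y (fderiv ℝ Y y (X y) - fderiv ℝ X y (Y y)) (Z y))
      = riem Γ y (X y) (Y y) (Z y) := by
  have dΓ := hΓ.differentiableAt (by simp)
  have dX := hX.differentiableAt (by simp)
  have dY := hY.differentiableAt (by simp)
  have dZ := hZ.differentiableAt (by simp)
  have dZ' := differentiableAt_fderiv hZ
  rw [fderiv_fun_add (dZ'.clm_apply dY) ((dΓ.clm_apply dY).clm_apply dZ),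
    fderiv_fun_add (dZ'.clm_apply dX) ((dΓ.clm_apply dX).clm_apply dZ)]
  simp only [add_apply]
  rw [fderiv_apply dZ' dY, fderiv_apply dZ' dX, fderiv_apply₂ dΓ dY dZ, fderiv_apply₂ dΓ dX dZ,
    fderiv_fderiv_symm hZ (X y) (Y y), riem_apply]
  simp only [map_add, map_sub, sub_apply]
  abel

variable [FiniteDimensional ℝ E]

/-- The Ricci tensor of the connection with Christoffel symbols `Γ`. -/
def ric (Γ : E → E →L[ℝ] E →L[ℝ] E) (y v w : E) : ℝ :=
  ∑ i, (Module.finBasis ℝ E).repr (riem Γ y (Module.finBasis ℝ E i) v w) i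

theorem trace_eq_sum_repr {ι : Type*} [Fintype ι] (b : Module.Basis ι ℝ E) (A : E →ₗ[ℝ] E) :
    LinearMap.trace ℝ E A = ∑ i, b.repr (A (b i)) i := by
  classical
  rw [LinearMap.trace_eq_matrix_trace ℝ b, Matrix.trace]
  simp [LinearMap.toMatrix_apply]

theorem ric_eq_trace (Γ : E → E →L[ℝ] E →L[ℝ] E) (y v w : E) :
    ric Γ y v w = LinearMap.trace ℝ E (((riem Γ y).flip v).flip w : E →L[ℝ] E).toLinearMap := by
  rw [trace_eq_sum_repr (Module.finBasis ℝ E)]; rfl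

end Curvature

/-! ### Curvature on the manifold against curvature in a chart -/

section Dictionary

variable {E : Type*} [NormedAddCommGroup E] [NormedSpace ℝ E] [FiniteDimensional ℝ E]
  {M : Type*} [TopologicalSpace M] [ChartedSpace E M] [IsManifold 𝓘(ℝ, E) ∞ M]

theorem curvature_frame [T2Space M] {D : Connection E M}
    (hD : CovariantDerivative.ContMDiffCovariantDerivative D ∞) {p : M} {y : E}
    (hy : y ∈ (chartAt E p).target) {X Y Z : Π x : M, TangentSpace 𝓘(ℝ, E) x}
    (hX : ContDiffAt ℝ ∞ (fieldIn p X) y) (hY : ContDiffAt ℝ ∞ (fieldIn p Y) y)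
    (hZ : ContDiffAt ℝ ∞ (fieldIn p Z) y) :
    curvature D X Y Z ((chartAt E p).symm y) =
      frame p _ (riem (christoffel D p) y (fieldIn p X y) (fieldIn p Y y) (fieldIn p Z y)) := by
  have : CompleteSpace E := FiniteDimensional.complete ℝ E
  have hΓ := contDiffAt_christoffel hD hy
  have dΓ := hΓ.differentiableAt (by simp)
  have dX := hX.differentiableAt (by simp)
  have dY := hY.differentiableAt (by simp)
  have dZ := hZ.differentiableAt (by simp)
  have dZ' := differentiableAt_fderiv hZ
  have hZev : ∀ᶠ z in nhds y, z ∈ (chartAt E p).target ∧ DifferentiableAt ℝ (fieldIn p Z) z := by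
    filter_upwards [(chartAt E p).open_target.mem_nhds hy,
      (hZ.of_le (m := 1) (WithTop.coe_le_coe.2 le_top)).eventually (by simp)] with z hz hz'
    exact ⟨hz, hz'.differentiableAt (by simp)⟩
  have hin : ∀ W : Π x : M, TangentSpace 𝓘(ℝ, E) x, fieldIn p (fun q ↦ D Z q (W q)) =ᶠ[nhds y]
      fun z ↦ fderiv ℝ (fieldIn p Z) z (fieldIn p W z)
        + christoffel D p z (fieldIn p W z) (fieldIn p Z z) := by
    intro W
    filter_upwards [hZev] with z hz
    exact fieldIn_connection D hz.1 ((diffFieldAt_iff hz.1).2 hz.2)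
  have hdiff : ∀ W : Π x : M, TangentSpace 𝓘(ℝ, E) x, DifferentiableAt ℝ (fieldIn p W) y →
      DiffFieldAt (fun q ↦ D Z q (W q)) ((chartAt E p).symm y) := by
    intro W dW
    rw [diffFieldAt_iff hy]
    exact ((dZ'.clm_apply dW).add ((dΓ.clm_apply dW).clm_apply dZ)).congr_of_eventuallyEq (hin W)
  rw [curvature, mlieBracket_frame hy ((diffFieldAt_iff hy).2 dX) ((diffFieldAt_iff hy).2 dY),
    connection_frame D hy ((diffFieldAt_iff hy).2 dZ), ← frame_fieldIn X hy, ← frame_fieldIn Y hy,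
    connection_frame D hy (hdiff Y dY), connection_frame D hy (hdiff X dX), ← map_sub, ← map_sub,
    (hin Y).fderiv_eq, (hin X).fderiv_eq, (hin Y).eq_of_nhds, (hin X).eq_of_nhds,
    riem_fields hΓ hX hY hZ]

/-- `ricci` takes its trace in the basis of the model space, seen as the tangent space through the
preferred chart at the point, not through the chart at `p`. The two traces agree because `frame`
conjugates one endomorphism into the other. By tensoriality the extended fields matter only through
their values. -/
theorem ricci_frame [T2Space M] {D : Connection E M}
    (hD : CovariantDerivative.ContMDiffCovariantDerivative D ∞) {p : M} {y : E}
    (hy : y ∈ (chartAt E p).target) (u v : E) :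
    ricci D ((chartAt E p).symm y) (frame p _ u) (frame p _ v) = ric (christoffel D p) y u v := by
  set q := (chartAt E p).symm y with hq
  have hext : ∀ w : TangentSpace 𝓘(ℝ, E) q,
      ContDiffAt ℝ ∞ (fieldIn p (FiberBundle.extend E w)) y := fun w ↦
    (contMDiffAt_field_iff hy).1 (FiberBundle.contMDiffAt_extend 𝓘(ℝ, E) E w)
  have hval : ∀ w : TangentSpace 𝓘(ℝ, E) q,
      fieldIn p (FiberBundle.extend E w) y = coframe p q w := fun w ↦ by
    change coframe p q (FiberBundle.extend E w q) = _
    rw [FiberBundle.extend_apply_self]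
  rw [ric_eq_trace]
  let A : E →ₗ[ℝ] E := (((riem (christoffel D p) y).flip u).flip v : E →L[ℝ] E).toLinearMap
  let e : E ≃ₗ[ℝ] E := LinearEquiv.ofLinearMap (frame p q : E →L[ℝ] E).toLinearMap
    (coframe p q : E →L[ℝ] E).toLinearMap
    (LinearMap.ext fun w ↦ frame_coframe (symm_mem_source hy) w)
    (LinearMap.ext fun w ↦ coframe_frame (symm_mem_source hy) w)
  rw [← LinearMap.trace_conj' A e, trace_eq_sum_repr (Module.finBasis ℝ E), ricci]
  refine Finset.sum_congr rfl fun i _ ↦ ?_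
  rw [hq, curvature_frame hD hy (hext _) (hext _) (hext _)]
  rw [hval, hval, hval, coframe_frame (symm_mem_source hy), coframe_frame (symm_mem_source hy)]
  rfl

end Dictionary

/-! ### Bianchi identities and symmetries of the curvature -/

section LeviCivita

variable {E : Type*} [NormedAddCommGroup E] [NormedSpace ℝ E] [FiniteDimensional ℝ E]

/-- `Γ` are the Christoffel symbols of the Levi-Civita connection of the metric `G` on the open
set `U`. -/
structure LocalLeviCivita (U : Set E) (G : E → E →L[ℝ] E →L[ℝ] ℝ) (Γ : E → E →L[ℝ] E →L[ℝ] E) :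
    Prop where
  isOpen : IsOpen U
  smooth_metric : ContDiffOn ℝ ∞ G U
  smooth_symbols : ContDiffOn ℝ ∞ Γ U
  metric_symm : ∀ y ∈ U, ∀ u v, G y u v = G y v u
  metric_pos : ∀ y ∈ U, ∀ u, u ≠ 0 → 0 < G y u u
  torsion_free : ∀ y ∈ U, ∀ u v, Γ y u v = Γ y v u
  deriv_metric : ∀ y ∈ U, ∀ u v w, fderiv ℝ G y u v w = G y (Γ y u v) w + G y v (Γ y u w)

theorem contDiffOn_fderiv {F : Type*} [NormedAddCommGroup F] [NormedSpace ℝ F] {U : Set E}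
    (hU : IsOpen U) {f : E → F} (hf : ContDiffOn ℝ ∞ f U) : ContDiffOn ℝ ∞ (fderiv ℝ f) U :=
  hf.fderiv_of_isOpen hU le_rfl

theorem contDiffOn_riem {U : Set E} (hU : IsOpen U) {Γ : E → E →L[ℝ] E →L[ℝ] E}
    (hΓ : ContDiffOn ℝ ∞ Γ U) : ContDiffOn ℝ ∞ (riem Γ) U := by
  have h' := contDiffOn_fderiv hU hΓ
  rw [contDiffOn_clm_apply]; intro u
  rw [contDiffOn_clm_apply]; intro v
  rw [contDiffOn_clm_apply]; intro w
  simp only [riem_apply]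
  have h1 : ∀ a b c : E, ContDiffOn ℝ ∞ (fun y ↦ fderiv ℝ Γ y a b c) U := fun a b c ↦
    ((h'.clm_apply contDiffOn_const).clm_apply contDiffOn_const).clm_apply contDiffOn_const
  have h2 : ∀ a b c : E, ContDiffOn ℝ ∞ (fun y ↦ Γ y a (Γ y b c)) U := fun a b c ↦
    (hΓ.clm_apply contDiffOn_const).clm_apply
      ((hΓ.clm_apply contDiffOn_const).clm_apply contDiffOn_const)
  exact (((h1 _ _ _).sub (h1 _ _ _)).add (h2 _ _ _)).sub (h2 _ _ _)

section TorsionFree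

variable {U : Set E} {Γ : E → E →L[ℝ] E →L[ℝ] E} (hU : IsOpen U) (hΓ : ContDiffOn ℝ ∞ Γ U)
  (hsymm : ∀ y ∈ U, ∀ u v, Γ y u v = Γ y v u) {y : E} (hy : y ∈ U)

include hU hΓ hsymm hy

theorem fderiv_symbols_symm (u v w : E) : fderiv ℝ Γ y u v w = fderiv ℝ Γ y u w v := by
  have hd := (hΓ.contDiffAt (hU.mem_nhds hy)).differentiableAt (by simp)
  rw [← fderiv_apply_const₂ hd, ← fderiv_apply_const₂ hd]
  have : (fun z ↦ Γ z v w) =ᶠ[nhds y] fun z ↦ Γ z w v := by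
    filter_upwards [hU.mem_nhds hy] with z hz using hsymm z hz v w
  rw [this.fderiv_eq]

/-- The first Bianchi identity. -/
theorem first_bianchi (u v w : E) : riem Γ y u v w + riem Γ y v w u + riem Γ y w u v = 0 := by
  have h := fderiv_symbols_symm hU hΓ hsymm hy
  have s := hsymm y hy
  simp only [riem_apply]
  rw [h u v w, h v u w, h w u v, s v w, s u w, s u v]
  abel

/-- This is the first Bianchi identity traced over its first slot. -/
theorem ric_sub_ric (v w : E) : ric Γ y v w - ric Γ y w v =
    - LinearMap.trace ℝ E (riem Γ y v w : E →L[ℝ] E).toLinearMap := by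
  rw [ric, ric, trace_eq_sum_repr (Module.finBasis ℝ E), ← Finset.sum_sub_distrib,
    ← Finset.sum_neg_distrib]
  refine Finset.sum_congr rfl fun i _ ↦ ?_
  have h := first_bianchi hU hΓ hsymm hy (Module.finBasis ℝ E i) v w
  rw [riem_swap Γ y w] at h
  have h2 : riem Γ y (Module.finBasis ℝ E i) v w - riem Γ y (Module.finBasis ℝ E i) w v
      = - riem Γ y v w (Module.finBasis ℝ E i) := by
    rw [← sub_eq_zero, ← h]; abel
  have h3 := congrArg (fun t ↦ (Module.finBasis ℝ E).repr t i) h2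
  simpa using h3

/-- The covariant derivative of the curvature tensor. -/
def covRiem (Γ : E → E →L[ℝ] E →L[ℝ] E) (y u v w x : E) : E :=
  fderiv ℝ (riem Γ) y u v w x + Γ y u (riem Γ y v w x) - riem Γ y (Γ y u v) w x
    - riem Γ y v (Γ y u w) x - riem Γ y v w (Γ y u x)

theorem fderiv_riem_apply (u v w x : E) : fderiv ℝ (riem Γ) y u v w x =
    fderiv ℝ (fderiv ℝ Γ) y u v w x - fderiv ℝ (fderiv ℝ Γ) y u w v x
      + (fderiv ℝ Γ y u v (Γ y w x) + Γ y v (fderiv ℝ Γ y u w x))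
      - (fderiv ℝ Γ y u w (Γ y v x) + Γ y w (fderiv ℝ Γ y u v x)) := by
  have hc := hΓ.contDiffAt (hU.mem_nhds hy)
  have hd := hc.differentiableAt (by simp)
  have hdd := differentiableAt_fderiv hc
  have hR := ((contDiffOn_riem hU hΓ).contDiffAt (hU.mem_nhds hy)).differentiableAt (by simp)
  have c1 : ∀ a : E, DifferentiableAt ℝ (fun _ : E ↦ a) y := fun a ↦ differentiableAt_const a
  have e : fderiv ℝ (riem Γ) y u v w x = fderiv ℝ (fun z ↦ riem Γ z v w x) y u := by
    rw [fderiv_apply_const ((hR.clm_apply (c1 v)).clm_apply (c1 w)), fderiv_apply_const₂ hR]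
  have d2 : ∀ a b : E, DifferentiableAt ℝ (fun z ↦ fderiv ℝ Γ z a b) y := fun a b ↦
    (hdd.clm_apply (c1 a)).clm_apply (c1 b)
  have d3 : ∀ a b c : E, DifferentiableAt ℝ (fun z ↦ fderiv ℝ Γ z a b c) y := fun a b c ↦
    (d2 a b).clm_apply (c1 c)
  have d4 : ∀ a b : E, DifferentiableAt ℝ (fun z ↦ Γ z a b) y := fun a b ↦
    (hd.clm_apply (c1 a)).clm_apply (c1 b)
  have d5 : ∀ a b c : E, DifferentiableAt ℝ (fun z ↦ Γ z a (Γ z b c)) y := fun a b c ↦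
    (hd.clm_apply (c1 a)).clm_apply (d4 b c)
  have e3 : ∀ a b c : E, fderiv ℝ (fun z ↦ fderiv ℝ Γ z a b c) y u
      = fderiv ℝ (fderiv ℝ Γ) y u a b c := fun a b c ↦ by
    rw [fderiv_apply_const (d2 a b), fderiv_apply_const₂ hdd]
  have e5 : ∀ a b c : E, fderiv ℝ (fun z ↦ Γ z a (Γ z b c)) y u
      = fderiv ℝ Γ y u a (Γ y b c) + Γ y a (fderiv ℝ Γ y u b c) := fun a b c ↦ by
    rw [fderiv_apply (hd.clm_apply (c1 a)) (d4 b c), fderiv_apply_const hd,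
      fderiv_apply_const₂ hd]
  rw [e]
  simp only [riem_apply]
  rw [fderiv_fun_sub (((d3 _ _ _).fun_sub (d3 _ _ _)).fun_add (d5 _ _ _)) (d5 _ _ _),
    fderiv_fun_add ((d3 _ _ _).fun_sub (d3 _ _ _)) (d5 _ _ _), fderiv_fun_sub (d3 _ _ _) (d3 _ _ _)]
  simp only [sub_apply, add_apply, e3, e5]

/-- The second Bianchi identity. -/
theorem second_bianchi (u v w x : E) :
    covRiem Γ y u v w x + covRiem Γ y v w u x + covRiem Γ y w u v x = 0 := by
  have hc := hΓ.contDiffAt (hU.mem_nhds hy)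
  have s := hsymm y hy
  have s2 : ∀ a b c, fderiv ℝ (fderiv ℝ Γ) y a b c x = fderiv ℝ (fderiv ℝ Γ) y b a c x :=
    fun a b c ↦ by rw [fderiv_fderiv_symm hc a b]
  simp only [covRiem, fderiv_riem_apply hU hΓ hsymm hy]
  rw [s2 v u w, s2 w u v, s2 w v u, s v u, s w u, s w v,
    riem_swap Γ y v (Γ y u w), riem_swap Γ y w (Γ y u v), riem_swap Γ y u (Γ y v w)]
  simp only [riem_apply, map_add, map_sub]
  abel

end TorsionFree

namespace LocalLeviCivita

variable {U : Set E} {G : E → E →L[ℝ] E →L[ℝ] ℝ} {Γ : E → E →L[ℝ] E →L[ℝ] E}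
  (h : LocalLeviCivita U G Γ) {y : E} (hy : y ∈ U)

include h hy

theorem mem_nhds : U ∈ nhds y := h.isOpen.mem_nhds hy

theorem differentiableAt_metric : DifferentiableAt ℝ G y :=
  (h.smooth_metric.contDiffAt (h.mem_nhds hy)).differentiableAt (by simp)

theorem differentiableAt_symbols : DifferentiableAt ℝ Γ y :=
  (h.smooth_symbols.contDiffAt (h.mem_nhds hy)).differentiableAt (by simp)

/-- Derivative of the inner product of two vector fields. -/
theorem fderiv_inner {X Y : E → E} (hX : DifferentiableAt ℝ X y) (hY : DifferentiableAt ℝ Y y)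
    (u : E) : fderiv ℝ (fun z ↦ G z (X z) (Y z)) y u =
      G y (fderiv ℝ X y u + Γ y u (X y)) (Y y) + G y (X y) (fderiv ℝ Y y u + Γ y u (Y y)) := by
  rw [fderiv_apply₂ (h.differentiableAt_metric hy) hX hY, h.deriv_metric y hy]
  simp only [map_add, add_apply]
  ring

/-- Differentiating the metric compatibility once more, the symmetry of the second derivative of `G`
says that the curvature operator acts trivially on the metric. -/
theorem riem_skew (u v x w : E) : G y (riem Γ y u v x) w + G y x (riem Γ y u v w) = 0 := by
  have hG := h.smooth_metric.contDiffAt (h.mem_nhds hy)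
  have dG := h.differentiableAt_metric hy
  have dΓ := h.differentiableAt_symbols hy
  have c1 : ∀ a : E, DifferentiableAt ℝ (fun _ : E ↦ a) y := fun a ↦ differentiableAt_const a
  have dd := differentiableAt_fderiv hG
  have key : ∀ a b, fderiv ℝ (fderiv ℝ G) y a b x w =
      fderiv ℝ G y a (Γ y b x) w + G y (fderiv ℝ Γ y a b x) w
        + (fderiv ℝ G y a x (Γ y b w) + G y x (fderiv ℝ Γ y a b w)) := by
    intro a b
    have d1 : ∀ c, DifferentiableAt ℝ (fun z ↦ Γ z b c) y := fun c ↦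
      (dΓ.clm_apply (c1 b)).clm_apply (c1 c)
    have e1 : fderiv ℝ (fderiv ℝ G) y a b x w = fderiv ℝ (fun z ↦ fderiv ℝ G z b x w) y a := by
      rw [fderiv_apply_const ((dd.clm_apply (c1 b)).clm_apply (c1 x)), fderiv_apply_const₂ dd]
    have e2 : (fun z ↦ fderiv ℝ G z b x w) =ᶠ[nhds y]
        fun z ↦ G z (Γ z b x) w + G z x (Γ z b w) := by
      filter_upwards [h.mem_nhds hy] with z hz using h.deriv_metric z hz b x w
    rw [e1, e2.fderiv_eq, fderiv_fun_add ((dG.clm_apply (d1 x)).clm_apply (c1 w))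
      ((dG.clm_apply (c1 x)).clm_apply (d1 w)), add_apply, fderiv_apply₂ dG (d1 x) (c1 w),
      fderiv_apply₂ dG (c1 x) (d1 w), fderiv_apply_const₂ dΓ, fderiv_apply_const₂ dΓ]
    simp
  have e := congrArg (fun t ↦ t x w) (fderiv_fderiv_symm hG u v)
  simp only [key, h.deriv_metric y hy] at e
  simp only [riem_apply, map_add, map_sub, add_apply, sub_apply]
  linarith

theorem differentiableAt_riem : DifferentiableAt ℝ (riem Γ) y :=
  ((contDiffOn_riem h.isOpen h.smooth_symbols).contDiffAt (h.mem_nhds hy)).differentiableAt (by simp)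

/-- Differentiate `riem_skew` along `u`; the terms in `Γ` are absorbed by `riem_skew` with one
argument replaced by its image under `Γ y u`. -/
theorem covRiem_skew (u v w x t : E) :
    G y (covRiem Γ y u v w x) t + G y x (covRiem Γ y u v w t) = 0 := by
  have dG := h.differentiableAt_metric hy
  have dR := h.differentiableAt_riem hy
  have c1 : ∀ a : E, DifferentiableAt ℝ (fun _ : E ↦ a) y := fun a ↦ differentiableAt_const a
  have d1 : ∀ c, DifferentiableAt ℝ (fun z ↦ riem Γ z v w c) y := fun c ↦
    ((dR.clm_apply (c1 v)).clm_apply (c1 w)).clm_apply (c1 c)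
  have e1 : ∀ c, fderiv ℝ (fun z ↦ riem Γ z v w c) y u = fderiv ℝ (riem Γ) y u v w c := fun c ↦ by
    rw [fderiv_apply_const ((dR.clm_apply (c1 v)).clm_apply (c1 w)), fderiv_apply_const₂ dR]
  have e2 : (fun z ↦ G z (riem Γ z v w x) t + G z x (riem Γ z v w t)) =ᶠ[nhds y] fun _ ↦ 0 := by
    filter_upwards [h.mem_nhds hy] with z hz using h.riem_skew hz v w x t
  have e3 := congrArg (fun L : E →L[ℝ] ℝ ↦ L u) e2.fderiv_eq
  simp only [fderiv_fun_const] at e3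
  rw [fderiv_fun_add ((dG.clm_apply (d1 x)).clm_apply (c1 t))
      ((dG.clm_apply (c1 x)).clm_apply (d1 t)), add_apply, fderiv_apply₂ dG (d1 x) (c1 t),
      fderiv_apply₂ dG (c1 x) (d1 t), e1, e1, h.deriv_metric y hy, h.deriv_metric y hy] at e3
  have s := h.riem_skew hy
  simp only [fderiv_fun_const, Pi.zero_apply, zero_apply, map_zero, add_zero] at e3
  have s1 := s (Γ y u v) w x t
  have s2 := s v (Γ y u w) x t
  have s3 := s v w (Γ y u x) t
  have s4 := s v w x (Γ y u t)
  simp only [covRiem, map_add, map_sub, add_apply, sub_apply]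
  linarith

end LocalLeviCivita

end LeviCivita

/-! ### Orthonormal bases and traces -/

section Orthonormal

variable {E : Type*} [NormedAddCommGroup E] [NormedSpace ℝ E] [FiniteDimensional ℝ E]

/-- The basis `e` is orthonormal for the bilinear form `B`. -/
def IsOrthonormal {ι : Type*} [DecidableEq ι] (B : E →L[ℝ] E →L[ℝ] ℝ) (e : Module.Basis ι ℝ E) :
    Prop := ∀ i j, B (e i) (e j) = if i = j then 1 else 0

theorem exists_isOrthonormal (B : E →L[ℝ] E →L[ℝ] ℝ) (hs : ∀ u v, B u v = B v u)
    (hp : ∀ u, u ≠ 0 → 0 < B u u) :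
    ∃ e : Module.Basis (Fin (Module.finrank ℝ E)) ℝ E, IsOrthonormal B e := by
  let B' : LinearMap.BilinForm ℝ E := LinearMap.mk₂ ℝ (fun u v ↦ B u v) (by simp) (by simp)
    (by simp) (by simp)
  have hB' : LinearMap.IsSymm B' := ⟨fun u v ↦ hs u v⟩
  obtain ⟨v, hv⟩ := LinearMap.BilinForm.exists_orthogonal_basis hB'
  have hpos : ∀ i, 0 < B (v i) (v i) := fun i ↦ hp _ (v.ne_zero i)
  have hsq : ∀ i, IsUnit (Real.sqrt (B (v i) (v i)))⁻¹ := fun i ↦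
    isUnit_iff_ne_zero.2 (inv_ne_zero (Real.sqrt_pos.2 (hpos i)).ne')
  refine ⟨v.isUnitSMul hsq, fun i j ↦ ?_⟩
  rw [Module.Basis.isUnitSMul_apply, Module.Basis.isUnitSMul_apply]
  simp only [map_smul, smul_apply, smul_eq_mul]
  split_ifs with hij
  · subst hij
    have := Real.mul_self_sqrt (hpos i).le
    have h0 := (Real.sqrt_pos.2 (hpos i)).ne'
    field_simp
    rw [sq, this]
  · have : B (v i) (v j) = 0 := hv hij
    rw [this]; simp

section

variable {ι : Type*} [Fintype ι] [DecidableEq ι] {B : E →L[ℝ] E →L[ℝ] ℝ} {e : Module.Basis ι ℝ E}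
  (he : IsOrthonormal B e)

include he

theorem IsOrthonormal.repr_eq (v : E) (i : ι) : e.repr v i = B v (e i) := by
  have he' : ∀ i j, B (e i) (e j) = if i = j then 1 else 0 := he
  conv_rhs => rw [← e.sum_repr v]
  simp only [map_sum, map_smul, sum_apply, smul_apply, he', smul_eq_mul]
  simp

theorem IsOrthonormal.sum_smul (v : E) : ∑ i, B v (e i) • e i = v := by
  conv_rhs => rw [← e.sum_repr v]
  simp [he.repr_eq]

theorem IsOrthonormal.sum_mul (L : E →L[ℝ] ℝ) (v : E) : ∑ i, L (e i) * B v (e i) = L v := by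
  conv_rhs => rw [← he.sum_smul v]
  simp [map_sum, mul_comm]

theorem IsOrthonormal.trace_eq (A : E →ₗ[ℝ] E) :
    LinearMap.trace ℝ E A = ∑ i, B (A (e i)) (e i) := by
  simp [trace_eq_sum_repr e, he.repr_eq]

theorem IsOrthonormal.sum_inner_self : ∑ i, B (e i) (e i) = Module.finrank ℝ E := by
  simp [he _ _, Module.finrank_eq_card_basis e]

theorem IsOrthonormal.sum_sum_mul (A : E →ₗ[ℝ] E) :
    ∑ i, ∑ j, B (A (e i)) (e j) * B (A (e i)) (e j) = ∑ i, B (A (e i)) (A (e i)) := by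
  refine Finset.sum_congr rfl fun i _ ↦ ?_
  exact he.sum_mul (B (A (e i))) (A (e i))

end

end Orthonormal

/-! ### Derivative of the Ricci tensor and the contracted Bianchi identity -/

section ContractedBianchi

variable {E : Type*} [NormedAddCommGroup E] [NormedSpace ℝ E] [FiniteDimensional ℝ E]

/-- The covariant derivative of the Ricci tensor. -/
def covRic (Γ : E → E →L[ℝ] E →L[ℝ] E) (y u v w : E) : ℝ :=
  fderiv ℝ (fun z ↦ ric Γ z v w) y u - ric Γ y (Γ y u v) w - ric Γ y v (Γ y u w)

namespace LocalLeviCivita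

variable {U : Set E} {G : E → E →L[ℝ] E →L[ℝ] ℝ} {Γ : E → E →L[ℝ] E →L[ℝ] E}
  (h : LocalLeviCivita U G Γ) {y : E} (hy : y ∈ U)

include h hy

theorem exists_basis : ∃ e : Module.Basis (Fin (Module.finrank ℝ E)) ℝ E, IsOrthonormal (G y) e :=
  exists_isOrthonormal (G y) (h.metric_symm y hy) (h.metric_pos y hy)

theorem trace_eq_zero_of_skew (A : E →ₗ[ℝ] E) (hA : ∀ u v, G y (A u) v + G y u (A v) = 0) :
    LinearMap.trace ℝ E A = 0 := by
  obtain ⟨e, he⟩ := h.exists_basis hy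
  rw [he.trace_eq]
  refine Finset.sum_eq_zero fun i _ ↦ ?_
  have := hA (e i) (e i)
  rw [h.metric_symm y hy (e i)] at this
  linarith

theorem trace_riem (u v : E) :
    LinearMap.trace ℝ E (riem Γ y u v : E →L[ℝ] E).toLinearMap = 0 :=
  h.trace_eq_zero_of_skew hy _ fun x w ↦ h.riem_skew hy u v x w

theorem ric_symm (v w : E) : ric Γ y v w = ric Γ y w v := by
  have := ric_sub_ric h.isOpen h.smooth_symbols h.torsion_free hy v w
  rw [h.trace_riem hy] at this
  linarith

/-- Covariant differentiation commutes with the trace, since the correction in the traced slot is a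
commutator with `Γ y u` and has trace zero. -/
theorem covRic_eq {ι : Type*} [Fintype ι] [DecidableEq ι] {e : Module.Basis ι ℝ E}
    (he : IsOrthonormal (G y) e) (u v w : E) :
    covRic Γ y u v w = ∑ i, G y (covRiem Γ y u (e i) v w) (e i) := by
  have dR := h.differentiableAt_riem hy
  have c1 : ∀ a : E, DifferentiableAt ℝ (fun _ : E ↦ a) y := fun a ↦ differentiableAt_const a
  let R : E →L[ℝ] E := ((riem Γ y).flip v).flip w
  let R' : E →L[ℝ] E := (((fderiv ℝ (riem Γ) y u)).flip v).flip w
  have e1 : fderiv ℝ (fun z ↦ ric Γ z v w) y u = LinearMap.trace ℝ E R'.toLinearMap := by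
    rw [trace_eq_sum_repr (Module.finBasis ℝ E)]
    simp only [ric]
    have hd : ∀ i, DifferentiableAt ℝ (fun z ↦ riem Γ z (Module.finBasis ℝ E i) v w) y := fun i ↦
      ((dR.clm_apply (c1 _)).clm_apply (c1 _)).clm_apply (c1 _)
    let L : Fin (Module.finrank ℝ E) → E →L[ℝ] ℝ := fun i ↦
      LinearMap.toContinuousLinearMap ((Module.finBasis ℝ E).coord i)
    have hd' : ∀ i, DifferentiableAt ℝ
        (fun z ↦ (Module.finBasis ℝ E).repr (riem Γ z (Module.finBasis ℝ E i) v w) i) y := fun i ↦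
      (L i).differentiableAt.comp y (hd i)
    rw [fderiv_fun_sum fun i _ ↦ hd' i, sum_apply]
    refine Finset.sum_congr rfl fun i _ ↦ ?_
    have : fderiv ℝ (fun z ↦ L i (riem Γ z (Module.finBasis ℝ E i) v w)) y u
        = L i (fderiv ℝ (riem Γ) y u (Module.finBasis ℝ E i) v w) := by
      rw [fderiv_fun_comp y (L i).differentiableAt (hd i)]
      simp only [ContinuousLinearMap.fderiv, ContinuousLinearMap.comp_apply]
      rw [fderiv_apply_const ((dR.clm_apply (c1 _)).clm_apply (c1 _)), fderiv_apply_const₂ dR]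
    exact this
  have e2 : LinearMap.trace ℝ E ((Γ y u).toLinearMap ∘ₗ R.toLinearMap)
      = LinearMap.trace ℝ E (R.toLinearMap ∘ₗ (Γ y u).toLinearMap) := LinearMap.trace_comp_comm' _ _
  have e3 : covRic Γ y u v w = LinearMap.trace ℝ E (R'.toLinearMap
      + (Γ y u).toLinearMap ∘ₗ R.toLinearMap - R.toLinearMap ∘ₗ (Γ y u).toLinearMap
      - (((riem Γ y).flip (Γ y u v)).flip w : E →L[ℝ] E).toLinearMap
      - (((riem Γ y).flip v).flip (Γ y u w) : E →L[ℝ] E).toLinearMap) := by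
    rw [covRic, e1, ric_eq_trace, ric_eq_trace, map_sub, map_sub, map_sub, map_add, e2]
    ring
  rw [e3, he.trace_eq]
  rfl

/-- The contracted second Bianchi identity. -/
theorem contracted_bianchi {ι : Type*} [Fintype ι] [DecidableEq ι] {e : Module.Basis ι ℝ E}
    (he : IsOrthonormal (G y) e) (v : E) :
    2 * ∑ i, covRic Γ y (e i) v (e i) = ∑ i, covRic Γ y v (e i) (e i) := by
  have swap : ∀ u a b x, covRiem Γ y u a b x = - covRiem Γ y u b a x := by
    intro u a b x
    have hR : ∀ a b c, fderiv ℝ (riem Γ) y u a b c = - fderiv ℝ (riem Γ) y u b a c := by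
      intro a b c
      have := h.differentiableAt_riem hy
      simp only [fderiv_riem_apply h.isOpen h.smooth_symbols h.torsion_free hy]
      abel
    simp only [covRiem]
    rw [hR, riem_swap Γ y a b, riem_swap Γ y (Γ y u a), riem_swap Γ y a (Γ y u b),
      riem_swap Γ y a b (Γ y u x), map_neg]
    abel
  simp only [h.covRic_eq hy he]
  -- For each pair of indices this is the second Bianchi identity for `v, e j, e i` applied to `e i`
  -- and paired with `e j`; skewness turns the other two terms into two copies of the same double
  -- sum, with the indices exchanged.
  have h1 : ∑ i, ∑ j, G y (covRiem Γ y v (e j) (e i) (e i)) (e j)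
      = (∑ i, ∑ j, G y (covRiem Γ y (e i) (e j) v (e i)) (e j))
        + ∑ i, ∑ j, G y (covRiem Γ y (e j) (e i) v (e j)) (e i) := by
    rw [← Finset.sum_add_distrib]
    refine Finset.sum_congr rfl fun i _ ↦ ?_
    rw [← Finset.sum_add_distrib]
    refine Finset.sum_congr rfl fun j _ ↦ ?_
    have b := congrArg (fun t ↦ G y t (e j)) (second_bianchi h.isOpen h.smooth_symbols
      h.torsion_free hy v (e j) (e i) (e i))
    have s := h.covRiem_skew hy (e j) (e i) v (e i) (e j)
    rw [h.metric_symm y hy (e i)] at s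
    simp only [map_add, add_apply, map_zero, zero_apply] at b
    rw [swap (e i) v (e j)] at b
    simp only [map_neg, neg_apply] at b
    linarith
  rw [h1, Finset.sum_comm (f := fun i j ↦ G y (covRiem Γ y (e j) (e i) v (e j)) (e i))]
  ring

end LocalLeviCivita

end ContractedBianchi

/-! ### Covariant derivatives of fields and endomorphisms -/

section CovariantDerivative

variable {E : Type*} [NormedAddCommGroup E] [NormedSpace ℝ E]

/-- The covariant derivative of the vector field `X`. -/
def covField (Γ : E → E →L[ℝ] E →L[ℝ] E) (X : E → E) (y : E) : E →L[ℝ] E :=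
  fderiv ℝ X y + (Γ y).flip (X y)

theorem covField_apply (Γ : E → E →L[ℝ] E →L[ℝ] E) (X : E → E) (y u : E) :
    covField Γ X y u = fderiv ℝ X y u + Γ y u (X y) := rfl

/-- The covariant derivative of the field of endomorphisms `A`. -/
def covEnd (Γ : E → E →L[ℝ] E →L[ℝ] E) (A : E → E →L[ℝ] E) (y u : E) : E →L[ℝ] E :=
  fderiv ℝ A y u + (Γ y u).comp (A y) - (A y).comp (Γ y u)

theorem covEnd_apply (Γ : E → E →L[ℝ] E →L[ℝ] E) (A : E → E →L[ℝ] E) (y u v : E) :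
    covEnd Γ A y u v = fderiv ℝ A y u v + Γ y u (A y v) - A y (Γ y u v) := rfl

theorem covEnd_add (Γ : E → E →L[ℝ] E →L[ℝ] E) (A : E → E →L[ℝ] E) (y u u' v : E) :
    covEnd Γ A y (u + u') v = covEnd Γ A y u v + covEnd Γ A y u' v := by
  simp only [covEnd_apply, map_add, add_apply]; abel

theorem contDiffOn_covField {Γ : E → E →L[ℝ] E →L[ℝ] E} {X : E → E} {U : Set E} (hU : IsOpen U)
    (hΓ : ContDiffOn ℝ ∞ Γ U) (hX : ContDiffOn ℝ ∞ X U) : ContDiffOn ℝ ∞ (covField Γ X) U := by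
  have h1 : ContDiffOn ℝ ∞ (fderiv ℝ X) U := hX.fderiv_of_isOpen hU le_rfl
  have h2 : ContDiffOn ℝ ∞ (fun y ↦ (Γ y).flip) U :=
    (ContinuousLinearMap.flipₗᵢ ℝ E E E).contDiff.comp_contDiffOn hΓ
  exact h1.add (h2.clm_apply hX)

theorem differentiableAt_covField {Γ : E → E →L[ℝ] E →L[ℝ] E} {X : E → E} {U : Set E}
    (hU : IsOpen U) (hΓ : ContDiffOn ℝ ∞ Γ U) (hX : ContDiffOn ℝ ∞ X U) {y : E} (hy : y ∈ U) :
    DifferentiableAt ℝ (covField Γ X) y :=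
  ((contDiffOn_covField hU hΓ hX).contDiffAt (hU.mem_nhds hy)).differentiableAt (by simp)

/-- The Ricci identity. -/
theorem covEnd_covField_sub {Γ : E → E →L[ℝ] E →L[ℝ] E} {X : E → E} {U : Set E} (hU : IsOpen U)
    (hΓ : ContDiffOn ℝ ∞ Γ U) (hX : ContDiffOn ℝ ∞ X U)
    (hsymm : ∀ y ∈ U, ∀ u v, Γ y u v = Γ y v u) {y : E} (hy : y ∈ U) (u v : E) :
    covEnd Γ (covField Γ X) y u v - covEnd Γ (covField Γ X) y v u = riem Γ y u v (X y) := by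
  have dΓ := (hΓ.contDiffAt (hU.mem_nhds hy)).differentiableAt (by simp)
  have cX := hX.contDiffAt (hU.mem_nhds hy)
  have dX := cX.differentiableAt (by simp)
  have dX' := differentiableAt_fderiv cX
  have dT := differentiableAt_covField hU hΓ hX hy
  have c1 : ∀ a : E, DifferentiableAt ℝ (fun _ : E ↦ a) y := fun a ↦ differentiableAt_const a
  have e : ∀ a b, fderiv ℝ (covField Γ X) y a b = fderiv ℝ (fderiv ℝ X) y a b
      + (fderiv ℝ Γ y a b (X y) + Γ y b (fderiv ℝ X y a)) := by
    intro a b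
    rw [← fderiv_apply_const dT]
    simp only [covField_apply]
    rw [fderiv_fun_add (dX'.clm_apply (c1 b)) ((dΓ.clm_apply (c1 b)).clm_apply dX), add_apply,
      fderiv_apply_const dX', fderiv_apply (dΓ.clm_apply (c1 b)) dX, fderiv_apply_const dΓ]
  simp only [covEnd_apply, e, covField_apply, riem_apply, map_add]
  rw [fderiv_fderiv_symm cX v u, hsymm y hy v u]
  abel

variable [FiniteDimensional ℝ E]

theorem trace_covEnd {Γ : E → E →L[ℝ] E →L[ℝ] E} {A : E → E →L[ℝ] E} {y : E}
    (hA : DifferentiableAt ℝ A y) (u : E) :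
    LinearMap.trace ℝ E (covEnd Γ A y u).toLinearMap =
      fderiv ℝ (fun z ↦ LinearMap.trace ℝ E (A z).toLinearMap) y u := by
  let L : (E →L[ℝ] E) →L[ℝ] ℝ := LinearMap.toContinuousLinearMap
    ((LinearMap.trace ℝ E) ∘ₗ (ContinuousLinearMap.coeLM ℝ : (E →L[ℝ] E) →ₗ[ℝ] (E →ₗ[ℝ] E)))
  have hL : ∀ B : E →L[ℝ] E, L B = LinearMap.trace ℝ E B.toLinearMap := fun B ↦ rfl
  have e1 : fderiv ℝ (fun z ↦ LinearMap.trace ℝ E (A z).toLinearMap) y u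
      = L (fderiv ℝ A y u) := by
    change fderiv ℝ (fun z ↦ L (A z)) y u = _
    rw [fderiv_fun_comp y L.differentiableAt hA]; simp
  have e2 : LinearMap.trace ℝ E ((Γ y u).toLinearMap ∘ₗ (A y).toLinearMap)
      = LinearMap.trace ℝ E ((A y).toLinearMap ∘ₗ (Γ y u).toLinearMap) :=
    LinearMap.trace_comp_comm' _ _
  have e3 : (covEnd Γ A y u).toLinearMap = (fderiv ℝ A y u).toLinearMap
      + (Γ y u).toLinearMap ∘ₗ (A y).toLinearMap - (A y).toLinearMap ∘ₗ (Γ y u).toLinearMap := rfl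
  rw [e3, map_sub, map_add, e2, e1, hL]
  ring

end CovariantDerivative

/-! ### Curvature of a Weyl connection -/

section Weyl

variable {E : Type*} [NormedAddCommGroup E] [NormedSpace ℝ E] [FiniteDimensional ℝ E]

theorem IsOrthonormal.ric_eq {ι : Type*} [Fintype ι] [DecidableEq ι] {B : E →L[ℝ] E →L[ℝ] ℝ}
    {e : Module.Basis ι ℝ E} (he : IsOrthonormal B e) (Γ : E → E →L[ℝ] E →L[ℝ] E) (y v w : E) :
    ric Γ y v w = ∑ i, B (riem Γ y (e i) v w) (e i) := by
  rw [ric_eq_trace, he.trace_eq]; rfl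

/-- The Christoffel symbols of the Weyl connection determined by the metric `G` and the 1-form that
is dual to the field `Ξ`, where `Γ` are those of the Levi-Civita connection. -/
def weylSymbols (G : E → E →L[ℝ] E →L[ℝ] ℝ) (Γ : E → E →L[ℝ] E →L[ℝ] E) (Ξ : E → E) (y u v : E) :
    E := Γ y u v - (1 / 2 * G y (Ξ y) u) • v - (1 / 2 * G y (Ξ y) v) • u + (1 / 2 * G y u v) • Ξ y

namespace LocalLeviCivita

variable {U : Set E} {G : E → E →L[ℝ] E →L[ℝ] ℝ} {Γ Γ' : E → E →L[ℝ] E →L[ℝ] E} {Ξ : E → E}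
  (h : LocalLeviCivita U G Γ) (hΞ : ContDiffOn ℝ ∞ Ξ U) (hΓ' : ContDiffOn ℝ ∞ Γ' U)
  (hW : ∀ y ∈ U, ∀ u v, Γ' y u v = weylSymbols G Γ Ξ y u v)
  {y : E} (hy : y ∈ U)

include h hΞ hΓ' hW hy

/-- Substitute `weylSymbols` into the curvature. Writing derivatives of `Ξ` and `G` through
`covField` and `Γ`, the remaining bare symbols cancel because `Γ` is symmetric, which leaves a
tensorial formula. -/
theorem riem_weyl (u v w : E) : riem Γ' y u v w = riem Γ y u v w
    - (1 / 2 * G y (covField Γ Ξ y u) v) • w - (1 / 2 * G y (covField Γ Ξ y u) w) • v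
    + (1 / 2 * G y v w) • covField Γ Ξ y u
    + (1 / 2 * G y (covField Γ Ξ y v) u) • w + (1 / 2 * G y (covField Γ Ξ y v) w) • u
    - (1 / 2 * G y u w) • covField Γ Ξ y v
    + (1 / 4 * G y (Ξ y) v * G y (Ξ y) w - 1 / 4 * G y (Ξ y) (Ξ y) * G y v w) • u
    - (1 / 4 * G y (Ξ y) u * G y (Ξ y) w - 1 / 4 * G y (Ξ y) (Ξ y) * G y u w) • v
    + (1 / 4 * (G y (Ξ y) u * G y v w - G y (Ξ y) v * G y u w)) • Ξ y := by
  have dΓ := h.differentiableAt_symbols hy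
  have dG := h.differentiableAt_metric hy
  have dΓ' := (hΓ'.contDiffAt (h.mem_nhds hy)).differentiableAt (by simp)
  have dΞ := (hΞ.contDiffAt (h.mem_nhds hy)).differentiableAt (by simp)
  have c1 : ∀ a : E, DifferentiableAt ℝ (fun _ : E ↦ a) y := fun a ↦ differentiableAt_const a
  have s := h.metric_symm y hy
  have t := h.torsion_free y hy
  have key : ∀ a b c, fderiv ℝ Γ' y a b c = fderiv ℝ Γ y a b c
      - (1 / 2 * (G y (covField Γ Ξ y a) b + G y (Ξ y) (Γ y a b))) • c
      - (1 / 2 * (G y (covField Γ Ξ y a) c + G y (Ξ y) (Γ y a c))) • b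
      + ((1 / 2 * G y b c) • (covField Γ Ξ y a - Γ y a (Ξ y))
        + (1 / 2 * (G y (Γ y a b) c + G y b (Γ y a c))) • Ξ y) := by
    intro a b c
    rw [← fderiv_apply_const₂ dΓ']
    have ev : (fun z ↦ Γ' z b c) =ᶠ[nhds y] fun z ↦ Γ z b c - (1 / 2 * G z (Ξ z) b) • c
        - (1 / 2 * G z (Ξ z) c) • b + (1 / 2 * G z b c) • Ξ z := by
      filter_upwards [h.mem_nhds hy] with z hz using hW z hz b c
    have d0 : DifferentiableAt ℝ (fun z ↦ Γ z b c) y := (dΓ.clm_apply (c1 b)).clm_apply (c1 c)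
    have d1 : ∀ x, DifferentiableAt ℝ (fun z ↦ G z (Ξ z) x) y := fun x ↦
      (dG.clm_apply dΞ).clm_apply (c1 x)
    have d2 : DifferentiableAt ℝ (fun z ↦ G z b c) y := (dG.clm_apply (c1 b)).clm_apply (c1 c)
    have f1 : ∀ x, fderiv ℝ (fun z ↦ G z (Ξ z) x) y a
        = G y (covField Γ Ξ y a) x + G y (Ξ y) (Γ y a x) := fun x ↦ by
      rw [h.fderiv_inner hy dΞ (c1 x)]; simp [covField_apply]
    have f2 : fderiv ℝ (fun z ↦ G z b c) y a = G y (Γ y a b) c + G y b (Γ y a c) := by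
      rw [h.fderiv_inner hy (c1 b) (c1 c)]; simp
    have f3 : fderiv ℝ Ξ y a = covField Γ Ξ y a - Γ y a (Ξ y) := by simp [covField_apply]
    rw [ev.fderiv_eq, fderiv_fun_add ((d0.fun_sub (((d1 b).const_mul _).smul_const c)).fun_sub
        (((d1 c).const_mul _).smul_const b)) ((d2.const_mul _).fun_smul dΞ),
      fderiv_fun_sub (d0.fun_sub (((d1 b).const_mul _).smul_const c))
        (((d1 c).const_mul _).smul_const b),
      fderiv_fun_sub d0 (((d1 b).const_mul _).smul_const c),
      fderiv_smul_const ((d1 b).const_mul _), fderiv_smul_const ((d1 c).const_mul _),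
      fderiv_fun_smul (d2.const_mul _) dΞ, fderiv_const_mul (d1 b), fderiv_const_mul (d1 c),
      fderiv_const_mul d2]
    simp only [add_apply, sub_apply, ContinuousLinearMap.smulRight_apply, smul_apply, f1, f2, f3,
      fderiv_apply_const₂ dΓ, smul_eq_mul]
  rw [riem_apply, riem_apply]
  simp only [key, hW y hy, weylSymbols, map_add, map_sub, map_smul, smul_eq_mul]
  rw [t v u, t u (Ξ y), t v (Ξ y), s v u, s u (Ξ y), s v (Ξ y)]
  module

/-- The Ricci tensor of a Weyl connection. -/
theorem ric_weyl (v w : E) : ric Γ' y v w = ric Γ y v w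
    - 1 / 2 * (G y (covField Γ Ξ y v) w + G y (covField Γ Ξ y w) v)
    + 1 / 2 * G y v w * LinearMap.trace ℝ E (covField Γ Ξ y).toLinearMap
    + (Module.finrank ℝ E : ℝ) / 2 * G y (covField Γ Ξ y v) w
    + ((Module.finrank ℝ E : ℝ) - 2) / 4
      * (G y (Ξ y) v * G y (Ξ y) w - G y (Ξ y) (Ξ y) * G y v w) := by
  obtain ⟨e, he⟩ := h.exists_basis hy
  have s := h.metric_symm y hy
  rw [he.ric_eq, he.ric_eq, he.trace_eq]
  simp only [h.riem_weyl hΞ hΓ' hW hy, map_add, map_sub, map_smul, add_apply, sub_apply, smul_apply,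
    smul_eq_mul, Finset.sum_add_distrib, Finset.sum_sub_distrib, ContinuousLinearMap.coe_coe]
  set T := covField Γ Ξ y
  have a1 : ∀ x z, ∑ i, (1 / 2 * G y (T (e i)) x) * G y z (e i) = 1 / 2 * G y (T z) x := by
    intro x z
    have := he.sum_mul (((G y).flip x).comp T) z
    simp only [ContinuousLinearMap.comp_apply, ContinuousLinearMap.flip_apply] at this
    rw [← this, Finset.mul_sum]
    exact Finset.sum_congr rfl fun i _ ↦ by ring
  have a2 : ∀ x z, ∑ i, (1 / 2 * G y x (e i)) * G y z (e i) = 1 / 2 * G y x z := by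
    intro x z
    rw [← he.sum_mul (G y x) z, Finset.mul_sum]
    exact Finset.sum_congr rfl fun i _ ↦ by ring
  have a3 := he.sum_inner_self
  have a4 : ∀ c : ℝ, ∑ i, c * G y (e i) (e i) = c * Module.finrank ℝ E := fun c ↦ by
    rw [← Finset.mul_sum, a3]
  have a5 : ∑ i, (1 / 4 * G y (Ξ y) (e i) * G y (Ξ y) w
      - 1 / 4 * G y (Ξ y) (Ξ y) * G y (e i) w) * G y v (e i)
      = 1 / 4 * G y (Ξ y) v * G y (Ξ y) w - 1 / 4 * G y (Ξ y) (Ξ y) * G y v w := by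
    have := he.sum_mul ((1 / 4 * G y (Ξ y) w) • G y (Ξ y) - (1 / 4 * G y (Ξ y) (Ξ y)) • G y w) v
    simp only [sub_apply, smul_apply, smul_eq_mul] at this
    rw [s v w]
    refine (Finset.sum_congr rfl fun i _ ↦ ?_).trans (this.trans (by ring))
    rw [s w (e i)]; ring
  have a6 : ∑ i, (1 / 4 * (G y (Ξ y) (e i) * G y v w - G y (Ξ y) v * G y (e i) w))
      * G y (Ξ y) (e i)
      = 1 / 4 * (G y (Ξ y) (Ξ y) * G y v w - G y (Ξ y) v * G y (Ξ y) w) := by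
    have := he.sum_mul ((1 / 4 * G y v w) • G y (Ξ y) - (1 / 4 * G y (Ξ y) v) • G y w) (Ξ y)
    simp only [sub_apply, smul_apply, smul_eq_mul] at this
    rw [s (Ξ y) w]
    refine (Finset.sum_congr rfl fun i _ ↦ ?_).trans (this.trans (by ring))
    rw [s w (e i)]; ring
  have a7 : ∀ x z, ∑ i, (1 / 2 * G y (e i) x) * G y z (e i) = 1 / 2 * G y x z := fun x z ↦ by
    simpa only [s _ x] using a2 x z
  rw [a1, a1, a2, a4, a7, a4, a5, a6, ← Finset.mul_sum]
  rw [s w (T v)]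
  ring

end LocalLeviCivita

end Weyl

/-! ### The divergence identity behind the Killing property for a Gauduchon metric -/

section Tod

variable {E : Type*} [NormedAddCommGroup E] [NormedSpace ℝ E] [FiniteDimensional ℝ E]

namespace LocalLeviCivita

theorem fderiv_inner_end {U : Set E} {G : E → E →L[ℝ] E →L[ℝ] ℝ} {Γ : E → E →L[ℝ] E →L[ℝ] E}
    (h : LocalLeviCivita U G Γ) {y : E} (hy : y ∈ U) {A : E → E →L[ℝ] E}
    (hA : DifferentiableAt ℝ A y) (u v w : E) :
    fderiv ℝ (fun z ↦ G z (A z v) w) y u = G y (covEnd Γ A y u v) w + G y (A y (Γ y u v)) w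
      + G y (A y v) (Γ y u w) := by
  have c1 : ∀ a : E, DifferentiableAt ℝ (fun _ : E ↦ a) y := fun a ↦ differentiableAt_const a
  rw [h.fderiv_inner hy (hA.clm_apply (c1 v)) (c1 w), fderiv_apply_const hA]
  simp [covEnd_apply]

variable {U : Set E} {G : E → E →L[ℝ] E →L[ℝ] ℝ} {Γ Γ' : E → E →L[ℝ] E →L[ℝ] E} {Ξ : E → E}
  {Λ : E → ℝ}
  (h : LocalLeviCivita U G Γ) (hΞ : ContDiffOn ℝ ∞ Ξ U) (hΓ' : ContDiffOn ℝ ∞ Γ' U)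
  (hW : ∀ y ∈ U, ∀ u v, Γ' y u v = weylSymbols G Γ Ξ y u v)
  (hΛ : DifferentiableOn ℝ Λ U)
  (hdiv : ∀ y ∈ U, LinearMap.trace ℝ E (covField Γ Ξ y).toLinearMap = 0)
  (hric : ∀ y ∈ U, ∀ v w, ric Γ' y v w + ric Γ' y w v = Λ y * G y v w)

/-- The function `Λ / 2 + (n - 2) / 4 * |Ξ|²`. -/
def einsteinFactor (G : E → E →L[ℝ] E →L[ℝ] ℝ) (Ξ : E → E) (Λ : E → ℝ) (y : E) : ℝ :=
  1 / 2 * Λ y + ((Module.finrank ℝ E : ℝ) - 2) / 4 * G y (Ξ y) (Ξ y)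

include h hΞ hΛ in
theorem differentiableAt_einsteinFactor {y : E} (hy : y ∈ U) :
    DifferentiableAt ℝ (einsteinFactor G Ξ Λ) y := by
  have dG := h.differentiableAt_metric hy
  have dΞ := (hΞ.contDiffAt (h.mem_nhds hy)).differentiableAt (by simp)
  have dΛ := hΛ.differentiableAt (h.mem_nhds hy)
  exact (dΛ.const_mul _).add (((dG.clm_apply dΞ).clm_apply dΞ).const_mul _)

include h hΞ hΓ' hW hdiv hric

/-- Symmetrise `ric_weyl`: the Levi-Civita Ricci tensor is already symmetric, and the divergence
term vanishes by the Gauduchon condition. -/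
theorem ric_eq_of_einsteinWeyl {y : E} (hy : y ∈ U) (v w : E) :
    ric Γ y v w = einsteinFactor G Ξ Λ y * G y v w
      - ((Module.finrank ℝ E : ℝ) - 2) / 4
        * (G y (covField Γ Ξ y v) w + G y (covField Γ Ξ y w) v)
      - ((Module.finrank ℝ E : ℝ) - 2) / 4 * (G y (Ξ y) v * G y (Ξ y) w) := by
  have h1 := hric y hy v w
  rw [h.ric_weyl hΞ hΓ' hW hy, h.ric_weyl hΞ hΓ' hW hy, hdiv y hy, h.ric_symm hy w v,
    h.metric_symm y hy w v] at h1
  simp only [einsteinFactor]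
  linarith

include hΛ

theorem covRic_eq_of_einsteinWeyl {y : E} (hy : y ∈ U) (u v w : E) :
    covRic Γ y u v w = fderiv ℝ (einsteinFactor G Ξ Λ) y u * G y v w
      - ((Module.finrank ℝ E : ℝ) - 2) / 4 * (G y (covEnd Γ (covField Γ Ξ) y u v) w
        + G y (covEnd Γ (covField Γ Ξ) y u w) v)
      - ((Module.finrank ℝ E : ℝ) - 2) / 4 * (G y (covField Γ Ξ y u) v * G y (Ξ y) w
        + G y (Ξ y) v * G y (covField Γ Ξ y u) w) := by
  have dG := h.differentiableAt_metric hy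
  have dΞ := (hΞ.contDiffAt (h.mem_nhds hy)).differentiableAt (by simp)
  have dT := differentiableAt_covField h.isOpen h.smooth_symbols hΞ hy
  have dL := h.differentiableAt_einsteinFactor hΞ hΛ hy
  have c1 : ∀ a : E, DifferentiableAt ℝ (fun _ : E ↦ a) y := fun a ↦ differentiableAt_const a
  have d1 : DifferentiableAt ℝ (fun z ↦ G z v w) y := (dG.clm_apply (c1 v)).clm_apply (c1 w)
  have d2 : ∀ a b, DifferentiableAt ℝ (fun z ↦ G z (covField Γ Ξ z a) b) y := fun a b ↦
    (dG.clm_apply (dT.clm_apply (c1 a))).clm_apply (c1 b)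
  have d3 : ∀ a, DifferentiableAt ℝ (fun z ↦ G z (Ξ z) a) y := fun a ↦
    (dG.clm_apply dΞ).clm_apply (c1 a)
  have f1 : fderiv ℝ (fun z ↦ G z v w) y u = G y (Γ y u v) w + G y v (Γ y u w) := by
    rw [h.fderiv_inner hy (c1 v) (c1 w)]; simp
  have f3 : ∀ x, fderiv ℝ (fun z ↦ G z (Ξ z) x) y u
      = G y (covField Γ Ξ y u) x + G y (Ξ y) (Γ y u x) := fun x ↦ by
    rw [h.fderiv_inner hy dΞ (c1 x)]; simp [covField_apply]
  have ev : (fun z ↦ ric Γ z v w) =ᶠ[nhds y] fun z ↦ einsteinFactor G Ξ Λ z * G z v w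
      - ((Module.finrank ℝ E : ℝ) - 2) / 4
        * (G z (covField Γ Ξ z v) w + G z (covField Γ Ξ z w) v)
      - ((Module.finrank ℝ E : ℝ) - 2) / 4 * (G z (Ξ z) v * G z (Ξ z) w) := by
    filter_upwards [h.mem_nhds hy] with z hz
    exact h.ric_eq_of_einsteinWeyl hΞ hΓ' hW hdiv hric hz v w
  rw [covRic, ev.fderiv_eq, fderiv_fun_sub ((dL.fun_mul d1).fun_sub
      (((d2 v w).fun_add (d2 w v)).const_mul _)) (((d3 v).fun_mul (d3 w)).const_mul _),
    fderiv_fun_sub (dL.fun_mul d1) (((d2 v w).fun_add (d2 w v)).const_mul _),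
    fderiv_fun_mul dL d1, fderiv_const_mul ((d2 v w).fun_add (d2 w v)),
    fderiv_const_mul ((d3 v).fun_mul (d3 w)), fderiv_fun_add (d2 v w) (d2 w v),
    fderiv_fun_mul (d3 v) (d3 w), h.ric_eq_of_einsteinWeyl hΞ hΓ' hW hdiv hric hy,
    h.ric_eq_of_einsteinWeyl hΞ hΓ' hW hdiv hric hy]
  simp only [add_apply, sub_apply, smul_apply, smul_eq_mul, f1, f3, h.fderiv_inner_end hy dT]
  ring

/-- The divergence of the field `∇ (|ξ|² / 2) / 2 + (∇_ξ ξ) / 2 + L ξ` of an Einstein-Weyl structure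
with a Gauduchon metric is the squared norm of the symmetric part of `∇ ξ`. -/
theorem trace_covField_of_einsteinWeyl {y : E} (hy : y ∈ U) (hn : 2 < Module.finrank ℝ E)
    {W : E → E} (dW : DifferentiableAt ℝ W y)
    (hWf : ∀ z ∈ U, ∀ u, G z (W z) u = 1 / 2 * (G z (covField Γ Ξ z (Ξ z)) u
      + G z (covField Γ Ξ z u) (Ξ z)) + einsteinFactor G Ξ Λ z * G z (Ξ z) u)
    {ι : Type*} [Fintype ι] [DecidableEq ι] {e : Module.Basis ι ℝ E} (he : IsOrthonormal (G y) e) :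
    LinearMap.trace ℝ E (covField Γ W y).toLinearMap =
      1 / 4 * ∑ i, ∑ j, (G y (covField Γ Ξ y (e i)) (e j) + G y (covField Γ Ξ y (e j)) (e i)) ^ 2 := by
  have dG := h.differentiableAt_metric hy
  have dΞ := (hΞ.contDiffAt (h.mem_nhds hy)).differentiableAt (by simp)
  have dT := differentiableAt_covField h.isOpen h.smooth_symbols hΞ hy
  have dL := h.differentiableAt_einsteinFactor hΞ hΛ hy
  have s := h.metric_symm y hy
  have c1 : ∀ a : E, DifferentiableAt ℝ (fun _ : E ↦ a) y := fun a ↦ differentiableAt_const a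
  set T := covField Γ Ξ y with hT
  set T' := covEnd Γ (covField Γ Ξ) y with hT'
  set L := einsteinFactor G Ξ Λ with hL
  set k := ((Module.finrank ℝ E : ℝ) - 2) / 4 with hk
  -- Real dimension greater than two enters here: the Bianchi identity below carries a factor `k`
  -- that must be divided out.
  have hk0 : k ≠ 0 := by
    have : (2 : ℝ) < Module.finrank ℝ E := by exact_mod_cast hn
    rw [hk]; intro h0; linarith
  have trT : ∑ i, G y (T (e i)) (e i) = 0 := by rw [← hdiv y hy, he.trace_eq]; rfl
  -- The divergence of `Ξ` vanishes on all of `U`, so its derivative vanishes too.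
  have trT' : ∀ v, ∑ i, G y (T' v (e i)) (e i) = 0 := by
    intro v
    have h1 := trace_covEnd (Γ := Γ) dT v
    have ev : (fun z ↦ LinearMap.trace ℝ E (covField Γ Ξ z).toLinearMap) =ᶠ[nhds y] fun _ ↦ 0 := by
      filter_upwards [h.mem_nhds hy] with z hz using hdiv z hz
    rw [ev.fderiv_eq, he.trace_eq] at h1
    simpa using h1
  have cWT : ∀ v u, G y (covField Γ W y v) u = 1 / 2 * (G y (T' v (Ξ y)) u + G y (T (T v)) u
      + G y (T' v u) (Ξ y) + G y (T u) (T v)) + fderiv ℝ L y v * G y (Ξ y) u + L y * G y (T v) u := by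
    intro v u
    have ev : (fun z ↦ G z (W z) u) =ᶠ[nhds y] fun z ↦ 1 / 2 * (G z (covField Γ Ξ z (Ξ z)) u
        + G z (covField Γ Ξ z u) (Ξ z)) + L z * G z (Ξ z) u := by
      filter_upwards [h.mem_nhds hy] with z hz using hWf z hz u
    have d1 : DifferentiableAt ℝ (fun z ↦ G z (covField Γ Ξ z (Ξ z)) u) y :=
      (dG.clm_apply (dT.clm_apply dΞ)).clm_apply (c1 u)
    have d2 : DifferentiableAt ℝ (fun z ↦ G z (covField Γ Ξ z u) (Ξ z)) y :=
      (dG.clm_apply (dT.clm_apply (c1 u))).clm_apply dΞ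
    have d3 : DifferentiableAt ℝ (fun z ↦ G z (Ξ z) u) y := (dG.clm_apply dΞ).clm_apply (c1 u)
    have e0 := h.fderiv_inner hy dW (c1 u) v
    rw [ev.fderiv_eq, fderiv_fun_add ((d1.fun_add d2).const_mul _) (dL.fun_mul d3),
      fderiv_const_mul (d1.fun_add d2), fderiv_fun_add d1 d2, fderiv_fun_mul dL d3] at e0
    simp only [add_apply, smul_apply, smul_eq_mul] at e0
    rw [h.fderiv_inner hy (dT.clm_apply dΞ) (c1 u), h.fderiv_inner hy (dT.clm_apply (c1 u)) dΞ,
      h.fderiv_inner hy dΞ (c1 u), fderiv_apply dT dΞ, fderiv_apply_const dT] at e0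
    simp only [fderiv_fun_const, Pi.zero_apply, zero_apply, zero_add] at e0
    rw [hWf y hy (Γ y v u)] at e0
    have t1 : T' v (Ξ y) = fderiv ℝ (covField Γ Ξ) y v (Ξ y) + Γ y v (T (Ξ y)) - T (Γ y v (Ξ y)) :=
      rfl
    have t2 : T' v u = fderiv ℝ (covField Γ Ξ) y v u + Γ y v (T u) - T (Γ y v u) := rfl
    have t3 : T v = fderiv ℝ Ξ y v + Γ y v (Ξ y) := rfl
    have t4 : covField Γ W y v = fderiv ℝ W y v + Γ y v (W y) := rfl
    rw [t4, t1, t2, t3]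
    simp only [map_add, map_sub, add_apply, sub_apply, ← hT] at e0 ⊢
    linarith
  have bian := h.contracted_bianchi hy he (Ξ y)
  simp only [h.covRic_eq_of_einsteinWeyl hΞ hΓ' hW hΛ hdiv hric hy, ← hT, ← hT', ← hL, ← hk,
    Finset.sum_add_distrib, Finset.sum_sub_distrib, ← Finset.mul_sum, mul_add] at bian
  have a1 : ∑ i, fderiv ℝ L y (e i) * G y (Ξ y) (e i) = fderiv ℝ L y (Ξ y) := he.sum_mul _ _
  have a2 : ∑ i, G y (e i) (e i) = Module.finrank ℝ E := he.sum_inner_self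
  have a3 : ∑ i, G y (T (e i)) (Ξ y) * G y (Ξ y) (e i) = G y (T (Ξ y)) (Ξ y) := by
    have := he.sum_mul (((G y).flip (Ξ y)).comp T) (Ξ y)
    simpa using this
  have a4 : ∑ i, G y (T (Ξ y)) (e i) * G y (Ξ y) (e i) = G y (T (Ξ y)) (Ξ y) := he.sum_mul _ _
  have a4' : ∑ i, G y (Ξ y) (e i) * G y (T (Ξ y)) (e i) = G y (T (Ξ y)) (Ξ y) := by
    rw [← a4]; exact Finset.sum_congr rfl fun i _ ↦ mul_comm _ _
  rw [a1, a2, a3, a4, a4', trT, trT'] at bian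
  -- In the contracted Bianchi identity on `Ξ y`, the contributions `G (T Ξ) Ξ` from the derivative
  -- of `θ ⊗ θ` are equal on both sides and drop out. What remains cancels exactly the derivative of
  -- the factor `L` in the divergence of `W`.
  have hX : (∑ i, G y (T' (e i) (Ξ y)) (e i)) + ∑ i, G y (T' (e i) (e i)) (Ξ y)
      = - 2 * fderiv ℝ L y (Ξ y) := by
    have hk4 : (Module.finrank ℝ E : ℝ) = 4 * k + 2 := by rw [hk]; ring
    rw [hk4] at bian
    apply mul_left_cancel₀ hk0
    linarith
  rw [he.trace_eq]
  simp only [ContinuousLinearMap.coe_coe, cWT, Finset.sum_add_distrib, ← Finset.mul_sum, trT, a1]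
  have b1 : ∑ i, G y (T (T (e i))) (e i) = ∑ i, ∑ j, G y (T (e i)) (e j) * G y (T (e j)) (e i) := by
    refine Finset.sum_congr rfl fun i _ ↦ ?_
    have := he.sum_mul (((G y).flip (e i)).comp T) (T (e i))
    simp only [ContinuousLinearMap.comp_apply, ContinuousLinearMap.flip_apply] at this
    rw [← this]
    exact Finset.sum_congr rfl fun j _ ↦ mul_comm _ _
  have b2 : ∑ i, G y (T (e i)) (T (e i)) = ∑ i, ∑ j, G y (T (e i)) (e j) * G y (T (e i)) (e j) :=
    (he.sum_sum_mul T.toLinearMap).symm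
  have b3 : ∑ i, G y (T (e i)) (T (e i)) = ∑ i, ∑ j, G y (T (e j)) (e i) * G y (T (e j)) (e i) := by
    rw [Finset.sum_comm, b2]
  have b4 : ∑ i, ∑ j, (G y (T (e i)) (e j) + G y (T (e j)) (e i)) ^ 2
      = 2 * (∑ i, G y (T (e i)) (T (e i)) + ∑ i, G y (T (T (e i))) (e i)) := by
    have : ∀ i j, (G y (T (e i)) (e j) + G y (T (e j)) (e i)) ^ 2
        = G y (T (e i)) (e j) * G y (T (e i)) (e j) + G y (T (e j)) (e i) * G y (T (e j)) (e i)
          + 2 * (G y (T (e i)) (e j) * G y (T (e j)) (e i)) := fun i j ↦ by ring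
    simp only [this, Finset.sum_add_distrib, ← Finset.mul_sum]
    rw [← b2, ← b3, ← b1]; ring
  rw [b4]
  linarith

end LocalLeviCivita

end Tod

/-! ### The divergence identity for conformal fields on Kähler manifolds -/

section Kaehler

variable {E : Type*} [NormedAddCommGroup E] [NormedSpace ℝ E] [FiniteDimensional ℝ E]

/-- `J` is an orthogonal complex structure for the bilinear form `B`. -/
structure IsOrthogonalComplex (B : E →L[ℝ] E →L[ℝ] ℝ) (J : E →L[ℝ] E) : Prop where
  sq : ∀ u, J (J u) = - u
  inner : ∀ u v, B (J u) (J v) = B u v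

theorem IsOrthogonalComplex.skew {B : E →L[ℝ] E →L[ℝ] ℝ} {J : E →L[ℝ] E}
    (hJ : IsOrthogonalComplex B J) (u v : E) : B (J u) v = - B u (J v) := by
  have := hJ.inner u (J v)
  rw [hJ.sq, map_neg] at this
  linarith

/-- The matrix of `J` in an orthonormal basis is skew. This moves `J` between the two slots of a
contraction without a basis adapted to `J`, and `F` need not be symmetric. -/
theorem IsOrthonormal.sum_complex {ι : Type*} [Fintype ι] [DecidableEq ι]
    {B : E →L[ℝ] E →L[ℝ] ℝ} {e : Module.Basis ι ℝ E} (he : IsOrthonormal B e)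
    (hs : ∀ u v, B u v = B v u) {J : E →L[ℝ] E} (hJ : IsOrthogonalComplex B J)
    (F : E →ₗ[ℝ] E →ₗ[ℝ] ℝ) : ∑ i, F (J (e i)) (e i) = - ∑ i, F (e i) (J (e i)) := by
  have h1 : ∀ i, F (J (e i)) (e i) = ∑ j, B (J (e i)) (e j) * F (e j) (e i) := fun i ↦ by
    conv_lhs => rw [← he.sum_smul (J (e i))]
    simp [map_sum]
  have h2 : ∀ i, F (e i) (J (e i)) = ∑ j, B (J (e i)) (e j) * F (e i) (e j) := fun i ↦ by
    conv_lhs => rw [← he.sum_smul (J (e i))]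
    simp [map_sum]
  simp only [h1, h2]
  rw [Finset.sum_comm, ← Finset.sum_neg_distrib]
  refine Finset.sum_congr rfl fun i _ ↦ ?_
  rw [← Finset.sum_neg_distrib]
  refine Finset.sum_congr rfl fun j _ ↦ ?_
  rw [hJ.skew, hs]; ring

namespace LocalLeviCivita

variable {U : Set E} {H : E → E →L[ℝ] E →L[ℝ] ℝ} {Γ : E → E →L[ℝ] E →L[ℝ] E} {Ξ : E → E}
  {l : E → ℝ} {J : E →L[ℝ] E}
  (h : LocalLeviCivita U H Γ) (hJ : ∀ y ∈ U, IsOrthogonalComplex (H y) J)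
  (hJΓ : ∀ y ∈ U, ∀ u v, Γ y u (J v) = J (Γ y u v)) (hΞ : ContDiffOn ℝ ∞ Ξ U)
  (hl : DifferentiableOn ℝ l U)
  (hconf : ∀ y ∈ U, ∀ u v, H y (covField Γ Ξ y u) v + H y (covField Γ Ξ y v) u = 2 * l y * H y u v)
  {y : E} (hy : y ∈ U)

include h hJΓ hy in
-- The constant endomorphism `J` commutes with `Γ` at every point of `U`, hence also with the
-- derivative of `Γ`.
theorem riem_complex (u v w : E) : riem Γ y u v (J w) = J (riem Γ y u v w) := by
  have dΓ := h.differentiableAt_symbols hy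
  have c1 : ∀ a : E, DifferentiableAt ℝ (fun _ : E ↦ a) y := fun a ↦ differentiableAt_const a
  have key : ∀ a b, fderiv ℝ Γ y a b (J w) = J (fderiv ℝ Γ y a b w) := by
    intro a b
    rw [← fderiv_apply_const₂ dΓ]
    have ev : (fun z ↦ Γ z b (J w)) =ᶠ[nhds y] fun z ↦ J (Γ z b w) := by
      filter_upwards [h.mem_nhds hy] with z hz using hJΓ z hz b w
    rw [ev.fderiv_eq, fderiv_fun_comp y J.differentiableAt
      ((dΓ.clm_apply (c1 b)).clm_apply (c1 w))]
    simp [fderiv_apply_const₂ dΓ]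
  simp only [riem_apply, key, hJΓ y hy, map_add, map_sub]

include h hΞ hl hconf hy

/-- This is the covariant derivative of the conformal equation, in which `H` is parallel and only
`l` is differentiated on the right. -/
theorem covEnd_conformal (u v w : E) : H y (covEnd Γ (covField Γ Ξ) y u v) w
    + H y (covEnd Γ (covField Γ Ξ) y u w) v = 2 * fderiv ℝ l y u * H y v w := by
  have dG := h.differentiableAt_metric hy
  have dT := differentiableAt_covField h.isOpen h.smooth_symbols hΞ hy
  have dl := hl.differentiableAt (h.mem_nhds hy)
  have c1 : ∀ a : E, DifferentiableAt ℝ (fun _ : E ↦ a) y := fun a ↦ differentiableAt_const a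
  have d1 : DifferentiableAt ℝ (fun z ↦ H z v w) y := (dG.clm_apply (c1 v)).clm_apply (c1 w)
  have d2 : ∀ a b, DifferentiableAt ℝ (fun z ↦ H z (covField Γ Ξ z a) b) y := fun a b ↦
    (dG.clm_apply (dT.clm_apply (c1 a))).clm_apply (c1 b)
  have ev : (fun z ↦ H z (covField Γ Ξ z v) w + H z (covField Γ Ξ z w) v) =ᶠ[nhds y]
      fun z ↦ 2 * l z * H z v w := by
    filter_upwards [h.mem_nhds hy] with z hz using hconf z hz v w
  have f1 : fderiv ℝ (fun z ↦ H z v w) y u = H y (Γ y u v) w + H y v (Γ y u w) := by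
    rw [h.fderiv_inner hy (c1 v) (c1 w)]; simp
  have e0 := congrArg (fun L : E →L[ℝ] ℝ ↦ L u) ev.fderiv_eq
  rw [fderiv_fun_add (d2 v w) (d2 w v), fderiv_fun_mul (dl.const_mul _) d1, fderiv_const_mul dl] at e0
  simp only [add_apply, smul_apply, smul_eq_mul, f1, h.fderiv_inner_end hy dT] at e0
  have e1 := hconf y hy (Γ y u v) w
  have e2 := hconf y hy v (Γ y u w)
  linarith

include hJ hJΓ

/-- On a Kähler manifold, the divergence of `(n - 2) λ ξ - (∇_ξ ξ + J ∇_{J ξ} ξ)` for a conformal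
field `ξ` with factor `λ`. -/
theorem trace_covField_of_conformal {W : E → E}
    (hW : ∀ z ∈ U, W z = (((Module.finrank ℝ E : ℝ) - 2) * l z) • Ξ z
      - (covField Γ Ξ z (Ξ z) + J (covField Γ Ξ z (J (Ξ z)))))
    {ι : Type*} [Fintype ι] [DecidableEq ι] {e : Module.Basis ι ℝ E} (he : IsOrthonormal (H y) e) :
    LinearMap.trace ℝ E (covField Γ W y).toLinearMap =
      (Module.finrank ℝ E : ℝ) * ((Module.finrank ℝ E : ℝ) - 2) * l y ^ 2
      + 1 / 2 * ∑ i, H y (covField Γ Ξ y (e i) + J (covField Γ Ξ y (J (e i))))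
        (covField Γ Ξ y (e i) + J (covField Γ Ξ y (J (e i)))) := by
  have dΞ := (hΞ.contDiffAt (h.mem_nhds hy)).differentiableAt (by simp)
  have dT := differentiableAt_covField h.isOpen h.smooth_symbols hΞ hy
  have dl := hl.differentiableAt (h.mem_nhds hy)
  have s := h.metric_symm y hy
  have c1 : ∀ a : E, DifferentiableAt ℝ (fun _ : E ↦ a) y := fun a ↦ differentiableAt_const a
  have J2 := (hJ y hy).sq
  have JJ := (hJ y hy).inner
  have Js := (hJ y hy).skew
  have sumJ := fun F : E →ₗ[ℝ] E →ₗ[ℝ] ℝ ↦ he.sum_complex s (hJ y hy) F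
  have conf := hconf y hy
  have conf' := h.covEnd_conformal hΞ hl hconf hy
  have ricid := covEnd_covField_sub h.isOpen h.smooth_symbols hΞ h.torsion_free hy
  have Tadd := covEnd_add Γ (covField Γ Ξ) y
  have Tsmul : ∀ (c : ℝ) u v, covEnd Γ (covField Γ Ξ) y (c • u) v
      = c • covEnd Γ (covField Γ Ξ) y u v := fun c u v ↦ by
    simp only [covEnd_apply, map_smul, smul_apply, smul_sub, smul_add]
  set T := covField Γ Ξ y with hT
  set T' := covEnd Γ (covField Γ Ξ) y with hT'
  set n := (Module.finrank ℝ E : ℝ) with hn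
  -- the 2-form dual to `J ξ` is closed
  have cyc : ∀ u v w, (H y (J (T' u v)) w - H y (J (T' u w)) v)
      + (H y (J (T' v w)) u - H y (J (T' v u)) w)
      + (H y (J (T' w u)) v - H y (J (T' w v)) u) = 0 := by
    intro u v w
    have r : ∀ a b c, H y (J (T' a b)) c - H y (J (T' b a)) c
        = - H y (J (Ξ y)) (riem Γ y a b c) := by
      intro a b c
      have r1 := h.riem_skew hy a b (J (Ξ y)) c
      rw [h.riem_complex hJΓ hy, ← ricid, map_sub, map_sub, sub_apply] at r1
      linarith
    have b := congrArg (H y (J (Ξ y))) (first_bianchi h.isOpen h.smooth_symbols h.torsion_free hy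
      u v w)
    simp only [map_add, map_zero] at b
    have r1 := r u v w
    have r2 := r v w u
    have r3 := r w u v
    linarith
  have nsum : ∑ i, H y (e i) (e i) = n := he.sum_inner_self
  have asum : ∑ i, fderiv ℝ l y (e i) * H y (Ξ y) (e i) = fderiv ℝ l y (Ξ y) := he.sum_mul _ _
  -- contraction
  let F : E →ₗ[ℝ] E →ₗ[ℝ] ℝ := LinearMap.mk₂ ℝ
    (fun a b ↦ H y (J (T' a (Ξ y))) b - H y (J (T' a b)) (Ξ y))
    (fun a a' b ↦ by simp only [Tadd, map_add, add_apply]; ring)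
    (fun c a b ↦ by simp only [Tsmul, map_smul, smul_apply, smul_eq_mul]; ring)
    (fun a b b' ↦ by simp only [map_add, add_apply]; ring)
    (fun c a b ↦ by simp only [map_smul, smul_apply, smul_eq_mul]; ring)
  have hF : ∑ i, (H y (J (T' (J (e i)) (Ξ y))) (e i) - H y (J (T' (J (e i)) (e i))) (Ξ y))
      = - ∑ i, (H y (J (T' (e i) (Ξ y))) (J (e i)) - H y (J (T' (e i) (J (e i)))) (Ξ y)) := sumJ F
  have main : 2 * (n - 2) * fderiv ℝ l y (Ξ y)
      + 2 * ∑ i, H y (T' (e i) (e i) + J (T' (e i) (J (e i)))) (Ξ y) = 0 := by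
    have c := Finset.sum_congr (s₁ := Finset.univ) rfl
      fun i (_ : i ∈ Finset.univ) ↦ cyc (Ξ y) (e i) (J (e i))
    rw [Finset.sum_const_zero, Finset.sum_add_distrib, Finset.sum_add_distrib, hF] at c
    have c2 : ∑ i, (H y (J (T' (Ξ y) (e i))) (J (e i)) - H y (J (T' (Ξ y) (J (e i)))) (e i))
        = 2 * n * fderiv ℝ l y (Ξ y) := by
      rw [← nsum, Finset.mul_sum, Finset.sum_mul]
      refine Finset.sum_congr rfl fun i _ ↦ ?_
      have q1 := conf' (Ξ y) (e i) (e i)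
      have q2 := conf' (Ξ y) (J (e i)) (J (e i))
      rw [JJ] at q2
      rw [JJ, Js]
      linarith
    have c3 : ∑ i, (H y (J (T' (e i) (J (e i)))) (Ξ y) - H y (J (T' (e i) (Ξ y))) (J (e i)))
        = ∑ i, H y (T' (e i) (e i) + J (T' (e i) (J (e i)))) (Ξ y) - 2 * fderiv ℝ l y (Ξ y) := by
      rw [← asum, Finset.mul_sum, ← Finset.sum_sub_distrib]
      refine Finset.sum_congr rfl fun i _ ↦ ?_
      have q1 := conf' (e i) (Ξ y) (e i)
      rw [JJ, map_add, add_apply]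
      linarith
    have c4 : ∑ i, (H y (J (T' (e i) (Ξ y))) (J (e i)) - H y (J (T' (e i) (J (e i)))) (Ξ y))
        = - ∑ i, (H y (J (T' (e i) (J (e i)))) (Ξ y) - H y (J (T' (e i) (Ξ y))) (J (e i))) := by
      rw [← Finset.sum_neg_distrib]
      exact Finset.sum_congr rfl fun i _ ↦ by ring
    rw [c4, c3, c2] at c
    linarith
  -- The differentiated conformal equation exchanges `Ξ y` and `e i`; its contributions from `T'`
  -- and from `J T' J` involve the same multiple of the derivative of `l`, and they cancel.
  have main' : ∑ i, H y (T' (e i) (Ξ y) + J (T' (e i) (J (Ξ y)))) (e i)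
      = (n - 2) * fderiv ℝ l y (Ξ y) := by
    have : ∑ i, H y (T' (e i) (Ξ y) + J (T' (e i) (J (Ξ y)))) (e i)
        = - ∑ i, H y (T' (e i) (e i) + J (T' (e i) (J (e i)))) (Ξ y) := by
      rw [← Finset.sum_neg_distrib]
      refine Finset.sum_congr rfl fun i _ ↦ ?_
      have q1 := conf' (e i) (Ξ y) (e i)
      have q2 := conf' (e i) (J (Ξ y)) (J (e i))
      rw [JJ] at q2
      rw [map_add, map_add, add_apply, add_apply, Js, Js]
      linarith
    rw [this]; linarith
  have trT : ∑ i, H y (T (e i)) (e i) = n * l y := by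
    rw [← nsum, Finset.sum_mul]
    refine Finset.sum_congr rfl fun i _ ↦ ?_
    have := conf (e i) (e i)
    linarith
  have Pskew : ∀ u v, H y (T u + J (T (J u))) v = - H y (T v + J (T (J v))) u := by
    intro u v
    have q1 := conf u v
    have q2 := conf (J u) (J v)
    rw [JJ] at q2
    simp only [map_add, add_apply]
    rw [Js (T (J u)), Js (T (J v))]
    linarith
  -- With `P = T + JTJ` this says `|P|² = 2 ⟨T, P⟩`: since `JPJ = P`, both summands of `P` have the
  -- same inner product with `P`.
  have Pnorm : ∑ i, H y (T (e i) + J (T (J (e i)))) (T (e i) + J (T (J (e i))))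
      = 2 * ∑ i, H y (T (e i)) (T (e i) + J (T (J (e i)))) := by
    let F' : E →ₗ[ℝ] E →ₗ[ℝ] ℝ := LinearMap.mk₂ ℝ
      (fun a b ↦ H y (T a) (T (J b) + J (T (J (J b)))))
      (fun a a' b ↦ by simp only [map_add, add_apply]; ring)
      (fun c a b ↦ by simp only [map_add, map_smul, smul_apply, smul_eq_mul]; ring)
      (fun a b b' ↦ by simp only [map_add]; ring)
      (fun c a b ↦ by simp only [map_smul, map_add, smul_eq_mul]; ring)
    have hF' : ∑ i, H y (T (J (e i))) (T (J (e i)) + J (T (J (J (e i)))))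
        = - ∑ i, H y (T (e i)) (T (J (J (e i))) + J (T (J (J (J (e i)))))) := sumJ F'
    have hF2 : - ∑ i, H y (T (e i)) (T (J (J (e i))) + J (T (J (J (J (e i))))))
        = ∑ i, H y (T (e i)) (T (e i) + J (T (J (e i)))) := by
      rw [← Finset.sum_neg_distrib]
      refine Finset.sum_congr rfl fun i _ ↦ ?_
      rw [J2]; simp only [map_neg, map_add]; ring
    have hF3 : ∑ i, H y (J (T (J (e i)))) (T (e i) + J (T (J (e i))))
        = ∑ i, H y (T (J (e i))) (T (J (e i)) + J (T (J (J (e i))))) := by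
      refine Finset.sum_congr rfl fun i _ ↦ ?_
      rw [Js, map_add J, J2, J2]
      simp only [map_neg, map_add]; ring
    have : ∀ i, H y (T (e i) + J (T (J (e i)))) (T (e i) + J (T (J (e i))))
        = H y (T (e i)) (T (e i) + J (T (J (e i))))
          + H y (J (T (J (e i)))) (T (e i) + J (T (J (e i)))) := fun i ↦ by
      rw [map_add (H y), add_apply]
    simp only [this, Finset.sum_add_distrib]
    rw [hF3, hF', hF2]; ring
  have cW : ∀ v, covField Γ W y v = ((n - 2) * fderiv ℝ l y v) • Ξ y + ((n - 2) * l y) • T v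
      - (T' v (Ξ y) + J (T' v (J (Ξ y)))) - (T (T v) + J (T (J (T v)))) := by
    intro v
    have ev : W =ᶠ[nhds y] fun z ↦ ((n - 2) * l z) • Ξ z
      - (covField Γ Ξ z (Ξ z) + J (covField Γ Ξ z (J (Ξ z)))) := by
      filter_upwards [h.mem_nhds hy] with z hz using hW z hz
    have dJ : DifferentiableAt ℝ (fun z ↦ J (Ξ z)) y := J.differentiableAt.comp y dΞ
    have d1 : DifferentiableAt ℝ (fun z ↦ ((n - 2) * l z) • Ξ z) y := (dl.const_mul _).fun_smul dΞ
    have d2 : DifferentiableAt ℝ (fun z ↦ covField Γ Ξ z (Ξ z)) y := dT.clm_apply dΞ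
    have d3 : DifferentiableAt ℝ (fun z ↦ covField Γ Ξ z (J (Ξ z))) y := dT.clm_apply dJ
    have d4 : DifferentiableAt ℝ (fun z ↦ J (covField Γ Ξ z (J (Ξ z)))) y :=
      J.differentiableAt.comp y d3
    have f1 : fderiv ℝ (fun z ↦ J (Ξ z)) y v = J (fderiv ℝ Ξ y v) := by
      rw [fderiv_fun_comp y J.differentiableAt dΞ]; simp
    have f4 : fderiv ℝ (fun z ↦ J (covField Γ Ξ z (J (Ξ z)))) y v
        = J (fderiv ℝ (fun z ↦ covField Γ Ξ z (J (Ξ z))) y v) := by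
      rw [fderiv_fun_comp y J.differentiableAt d3]; simp
    have t3 : T v = fderiv ℝ Ξ y v + Γ y v (Ξ y) := rfl
    rw [covField_apply, ev.fderiv_eq, ev.eq_of_nhds, fderiv_fun_sub d1 (d2.fun_add d4),
      fderiv_fun_add d2 d4, fderiv_fun_smul (dl.const_mul _) dΞ, fderiv_const_mul dl]
    simp only [sub_apply, add_apply, smul_apply, ContinuousLinearMap.smulRight_apply, smul_eq_mul]
    rw [f4, fderiv_apply dT dΞ, fderiv_apply dT dJ, f1]
    simp only [hT', covEnd_apply, ← hT, t3, map_add, map_sub, map_smul, hJΓ y hy]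
    module
  rw [he.trace_eq]
  simp only [ContinuousLinearMap.coe_coe, cW, map_sub (H y), sub_apply, map_add (H y) (_ • _),
    add_apply, map_smul (H y), smul_apply, smul_eq_mul, Finset.sum_sub_distrib,
    Finset.sum_add_distrib]
  rw [main', Pnorm]
  have g1 : ∑ i, (n - 2) * fderiv ℝ l y (e i) * H y (Ξ y) (e i) = (n - 2) * fderiv ℝ l y (Ξ y) := by
    rw [← asum, Finset.mul_sum]
    exact Finset.sum_congr rfl fun i _ ↦ by ring
  have g2 : ∑ i, (n - 2) * l y * H y (T (e i)) (e i) = (n - 2) * l y * (n * l y) := by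
    rw [← trT, Finset.mul_sum]
  have g3 : ∑ i, H y (T (T (e i)) + J (T (J (T (e i))))) (e i)
      = - ∑ i, H y (T (e i)) (T (e i) + J (T (J (e i)))) := by
    rw [← Finset.sum_neg_distrib]
    refine Finset.sum_congr rfl fun i _ ↦ ?_
    rw [Pskew, s]
  rw [g1, g2, g3]
  ring

end LocalLeviCivita

end Kaehler

/-! ### Riemannian density and the divergence theorem in the model space -/

section Density

variable {E : Type*} [NormedAddCommGroup E] [NormedSpace ℝ E] [FiniteDimensional ℝ E]

/-- The Gram determinant of a bilinear form in a fixed basis of `E`. -/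
def gramDet (B : E →L[ℝ] E →L[ℝ] ℝ) : ℝ :=
  (Matrix.of fun i j ↦ B (Module.finBasis ℝ E i) (Module.finBasis ℝ E j)).det

/-- Pulling back by a matrix `P` turns a Gram matrix `Q` into `Pᵀ Q P`. This is the source of the
Jacobi formula and of the change of variables for `density`. -/
theorem gramDet_comp (B : E →L[ℝ] E →L[ℝ] ℝ) (A : E →L[ℝ] E) :
    gramDet (B.bilinearComp A A) = LinearMap.det A.toLinearMap ^ 2 * gramDet B := by
  set b := Module.finBasis ℝ E
  set P := LinearMap.toMatrix b b A.toLinearMap with hP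
  have hA : ∀ i, A (b i) = ∑ k, P k i • b k := fun i ↦ by
    rw [hP]
    simp only [LinearMap.toMatrix_apply]
    exact (b.sum_repr _).symm
  have : (Matrix.of fun i j ↦ B.bilinearComp A A (b i) (b j))
      = P.transpose * (Matrix.of fun i j ↦ B (b i) (b j)) * P := by
    ext i j
    simp only [Matrix.of_apply, ContinuousLinearMap.bilinearComp_apply, hA, map_sum, map_smul,
      sum_apply, smul_apply, smul_eq_mul, Matrix.mul_apply, Matrix.transpose_apply,
      Finset.mul_sum, Finset.sum_mul]
    refine Finset.sum_congr rfl fun k _ ↦ Finset.sum_congr rfl fun l _ ↦ by ring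
  rw [gramDet, this, Matrix.det_mul, Matrix.det_mul, Matrix.det_transpose, hP,
    LinearMap.det_toMatrix, gramDet]
  ring

/-- Passing to an orthonormal basis multiplies `gramDet B` by a square and gives `1`. -/
theorem gramDet_pos {B : E →L[ℝ] E →L[ℝ] ℝ} (hs : ∀ u v, B u v = B v u)
    (hp : ∀ u, u ≠ 0 → 0 < B u u) : 0 < gramDet B := by
  obtain ⟨e, he⟩ := exists_isOrthonormal B hs hp
  let A : E →L[ℝ] E := LinearMap.toContinuousLinearMap
    ((Module.finBasis ℝ E).equiv e (Equiv.refl _)).toLinearMap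
  have hA : ∀ i, A (Module.finBasis ℝ E i) = e i := fun i ↦ by simp [A]
  have h1 := gramDet_comp B A
  have h2 : gramDet (B.bilinearComp A A) = 1 := by
    rw [gramDet]
    convert Matrix.det_one (n := Fin (Module.finrank ℝ E)) (R := ℝ) using 2
    ext i j
    rw [Matrix.of_apply, ContinuousLinearMap.bilinearComp_apply, hA, hA, he i j, Matrix.one_apply]
  rw [h2] at h1
  by_contra hn
  nlinarith [sq_nonneg (LinearMap.det A.toLinearMap)]

theorem contDiff_gramDet : ContDiff ℝ ∞ (gramDet (E := E)) := by
  unfold gramDet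
  simp only [Matrix.det_apply, Matrix.of_apply]
  refine ContDiff.sum fun σ _ ↦ ContDiff.const_smul _ (contDiff_prod fun i _ ↦ ?_)
  exact (contDiff_id.clm_apply contDiff_const).clm_apply contDiff_const

/-- The Jacobi formula. -/
theorem fderiv_gramDet (B : E →L[ℝ] E →L[ℝ] ℝ) (A : E →L[ℝ] E) :
    fderiv ℝ gramDet B (B.bilinearComp A (.id ℝ E) + B.bilinearComp (.id ℝ E) A)
      = 2 * LinearMap.trace ℝ E A.toLinearMap * gramDet B := by
  set C := B.bilinearComp A (.id ℝ E) + B.bilinearComp (.id ℝ E) A with hC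
  -- The quadratic term does not affect the velocity at `0`, and it makes `c t` exactly the pullback
  -- of `B` by `1 + t A`, so its Gram determinant is `det (1 + t A) ^ 2 * gramDet B`.
  let c : ℝ → E →L[ℝ] E →L[ℝ] ℝ := fun t ↦ B + t • C + t ^ 2 • B.bilinearComp A A
  have hc0 : c 0 = B := by simp [c]
  have hc : HasDerivAt c C 0 := by
    have h1 : HasDerivAt (fun t : ℝ ↦ t • C) C 0 := by
      simpa using (hasDerivAt_id (0 : ℝ)).smul_const C
    have h2 : HasDerivAt (fun t : ℝ ↦ t ^ 2 • B.bilinearComp A A) 0 0 := by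
      simpa using (hasDerivAt_pow 2 (0 : ℝ)).smul_const (B.bilinearComp A A)
    simpa using (h1.const_add B).fun_add h2
  have hd : HasDerivAt (fun t ↦ gramDet (c t)) (fderiv ℝ gramDet B C) 0 := by
    have h1 : HasFDerivAt gramDet (fderiv ℝ gramDet B) (c 0) := by
      rw [hc0]
      exact (contDiff_gramDet.contDiffAt.differentiableAt (by simp)).hasFDerivAt
    exact h1.comp_hasDerivAt 0 hc
  have key : ∀ t : ℝ, gramDet (c t) = LinearMap.det (LinearMap.id + t • A.toLinearMap) ^ 2
      * gramDet B := by
    intro t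
    have : c t = B.bilinearComp (.id ℝ E + t • A) (.id ℝ E + t • A) := by
      ext u v
      simp only [c, hC, add_apply, smul_apply, ContinuousLinearMap.bilinearComp_apply,
        ContinuousLinearMap.id_apply, map_add, map_smul, smul_eq_mul]
      ring
    rw [this, gramDet_comp]
    rfl
  set b := Module.finBasis ℝ E
  have hdet : HasDerivAt (fun t : ℝ ↦ LinearMap.det (LinearMap.id + t • A.toLinearMap))
      (LinearMap.trace ℝ E A.toLinearMap) 0 := by
    set P := LinearMap.toMatrix b b A.toLinearMap with hP
    have e : ∀ t : ℝ, LinearMap.det (LinearMap.id + t • A.toLinearMap)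
        = 1 + P.trace * t
          + Polynomial.eval t (Polynomial.divX (Polynomial.divX
            (Matrix.det (1 + (Polynomial.X : Polynomial ℝ) • P.map Polynomial.C)))) * t ^ 2 := by
      intro t
      rw [← LinearMap.det_toMatrix b, map_add, map_smul, LinearMap.toMatrix_id, ← hP,
        Matrix.det_one_add_smul]
    rw [funext e, LinearMap.trace_eq_matrix_trace ℝ b, ← hP]
    set q := Polynomial.divX (Polynomial.divX
            (Matrix.det (1 + (Polynomial.X : Polynomial ℝ) • P.map Polynomial.C)))
    have h1 : HasDerivAt (fun t : ℝ ↦ 1 + P.trace * t) P.trace 0 := by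
      simpa using ((hasDerivAt_id (0 : ℝ)).const_mul P.trace).const_add 1
    have h2 : HasDerivAt (fun t : ℝ ↦ q.eval t * t ^ 2) 0 0 := by
      simpa using (q.hasDerivAt 0).fun_mul (hasDerivAt_pow 2 (0 : ℝ))
    simpa using h1.fun_add h2
  have hd2 := (hdet.fun_pow 2).mul_const (gramDet B)
  rw [← funext key] at hd2
  rw [hd.unique hd2]
  simp

/-- The Riemannian density of a metric, with respect to Lebesgue measure. -/
def density (B : E →L[ℝ] E →L[ℝ] ℝ) : ℝ := Real.sqrt (gramDet B)

theorem density_comp (B : E →L[ℝ] E →L[ℝ] ℝ) (A : E →L[ℝ] E) :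
    density (B.bilinearComp A A) = |A.det| * density B := by
  rw [density, gramDet_comp, Real.sqrt_mul (sq_nonneg _), Real.sqrt_sq_eq_abs]
  rfl

namespace LocalLeviCivita

variable {U : Set E} {G : E → E →L[ℝ] E →L[ℝ] ℝ} {Γ : E → E →L[ℝ] E →L[ℝ] E}
  (h : LocalLeviCivita U G Γ)

include h

theorem density_pos {y : E} (hy : y ∈ U) : 0 < density (G y) :=
  Real.sqrt_pos.2 (gramDet_pos (h.metric_symm y hy) (h.metric_pos y hy))

theorem contDiffOn_density : ContDiffOn ℝ ∞ (fun y ↦ density (G y)) U :=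
  (contDiff_gramDet.comp_contDiffOn h.smooth_metric).sqrt fun y hy ↦
    (gramDet_pos (h.metric_symm y hy) (h.metric_pos y hy)).ne'

/-- Metric compatibility puts the derivative of `G` in the form required by the Jacobi formula, with
`A = Γ y u`; the square root halves the factor two. -/
theorem fderiv_density {y : E} (hy : y ∈ U) (u : E) :
    fderiv ℝ (fun z ↦ density (G z)) y u
      = LinearMap.trace ℝ E (Γ y u).toLinearMap * density (G y) := by
  have dG := h.differentiableAt_metric hy
  have pos := gramDet_pos (h.metric_symm y hy) (h.metric_pos y hy)
  have dg : DifferentiableAt ℝ gramDet (G y) := contDiff_gramDet.contDiffAt.differentiableAt (by simp)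
  have e1 : fderiv ℝ G y u
      = (G y).bilinearComp (Γ y u) (.id ℝ E) + (G y).bilinearComp (.id ℝ E) (Γ y u) := by
    ext v w
    rw [h.deriv_metric y hy]; rfl
  have e2 : fderiv ℝ (fun z ↦ gramDet (G z)) y u
      = 2 * LinearMap.trace ℝ E (Γ y u).toLinearMap * gramDet (G y) := by
    rw [fderiv_fun_comp y dg dG, ContinuousLinearMap.comp_apply, e1, fderiv_gramDet]
  have e3 : fderiv ℝ (fun z ↦ density (G z)) y = _ := fderiv_sqrt (dg.comp y dG) pos.ne'
  rw [e3, smul_apply, smul_eq_mul]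
  rw [e2, density]
  have hs := Real.mul_self_sqrt pos.le
  have hs0 := (Real.sqrt_pos.2 pos).ne'
  field_simp
  linear_combination (-LinearMap.trace ℝ E (Γ y u).toLinearMap) * hs

/-- The divergence in coordinates. -/
theorem trace_fderiv_density_smul {y : E} (hy : y ∈ U) {r : E → ℝ} {W : E → E}
    (hr : DifferentiableAt ℝ r y) (hW : DifferentiableAt ℝ W y) :
    LinearMap.trace ℝ E (fderiv ℝ (fun z ↦ (density (G z) * r z) • W z) y).toLinearMap
      = (r y * LinearMap.trace ℝ E (covField Γ W y).toLinearMap + fderiv ℝ r y (W y))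
        * density (G y) := by
  have dd : DifferentiableAt ℝ (fun z ↦ density (G z)) y :=
    (h.contDiffOn_density.contDiffAt (h.mem_nhds hy)).differentiableAt (by simp)
  have tr1 : ∀ (L : E →L[ℝ] ℝ) (w : E),
      LinearMap.trace ℝ E (L.smulRight w : E →L[ℝ] E).toLinearMap = L w := fun L w ↦
    LinearMap.trace_smulRight L.toLinearMap w
  -- Symmetry of `Γ` turns the correction into the trace of `Γ y (W y)`, which is the logarithmic
  -- derivative of the density along `W`.
  have tr2 : LinearMap.trace ℝ E (covField Γ W y).toLinearMap
      = LinearMap.trace ℝ E (fderiv ℝ W y).toLinearMap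
        + LinearMap.trace ℝ E (Γ y (W y)).toLinearMap := by
    rw [← map_add]
    congr 1
    ext v
    change fderiv ℝ W y v + Γ y v (W y) = fderiv ℝ W y v + Γ y (W y) v
    rw [h.torsion_free y hy]
  rw [fderiv_fun_smul (dd.fun_mul hr) hW, fderiv_fun_mul dd hr]
  have e : ∀ (a : ℝ) (A B : E →L[ℝ] E), LinearMap.trace ℝ E (a • A + B).toLinearMap
      = a * LinearMap.trace ℝ E A.toLinearMap + LinearMap.trace ℝ E B.toLinearMap := fun a A B ↦ by
    change LinearMap.trace ℝ E (a • A.toLinearMap + B.toLinearMap) = _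
    rw [map_add, map_smul, smul_eq_mul]
  rw [e, tr1, tr2]
  simp only [add_apply, smul_apply, smul_eq_mul, h.fderiv_density hy]
  ring

end LocalLeviCivita

-- Integration by parts against the constant function `1`.
open MeasureTheory in
theorem integral_fderiv_eq_zero [MeasurableSpace E] [BorelSpace E] (μ : Measure E)
    [μ.IsAddHaarMeasure] {f : E → ℝ} (hf : ContDiff ℝ 1 f) (hc : HasCompactSupport f) (v : E) :
    ∫ x, fderiv ℝ f x v ∂μ = 0 := by
  have h1 : Continuous fun x ↦ fderiv ℝ f x v :=
    (hf.continuous_fderiv (by simp)).clm_apply continuous_const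
  have h2 : HasCompactSupport fun x ↦ fderiv ℝ f x v := hc.fderiv_apply ℝ v
  have := integral_mul_fderiv_eq_neg_fderiv_mul_of_integrable (μ := μ) (f := fun _ : E ↦ (1 : ℝ))
    (g := f) (v := v) (by simp) (by simpa using h1.integrable_of_hasCompactSupport h2)
    (by simpa using hf.continuous.integrable_of_hasCompactSupport hc) (by simp)
    (fun x _ ↦ hf.contDiffAt.differentiableAt (by simp))
  simpa using this

open MeasureTheory in
/-- The divergence theorem for a field with compact support in an open set. -/
theorem setIntegral_trace_fderiv_eq_zero [MeasurableSpace E] [BorelSpace E] (μ : Measure E)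
    [μ.IsAddHaarMeasure] {T K : Set E} (hT : IsOpen T) (hK : IsCompact K) (hKT : K ⊆ T) {F : E → E}
    (hF : ContDiffOn ℝ 1 F T) (h0 : ∀ y ∈ T, y ∉ K → F y = 0) :
    ∫ y in T, LinearMap.trace ℝ E (fderiv ℝ F y).toLinearMap ∂μ = 0 := by
  set F' := T.indicator F with hF'
  have hev : ∀ y ∈ T, F' =ᶠ[nhds y] F := fun y hy ↦ by
    filter_upwards [hT.mem_nhds hy] with z hz using Set.indicator_of_mem hz F
  have hz : ∀ y, y ∉ K → F' y = 0 := fun y hy ↦ by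
    by_cases hyT : y ∈ T
    · rw [hF', Set.indicator_of_mem hyT, h0 y hyT hy]
    · exact Set.indicator_of_notMem hyT F
  have hzev : ∀ y, y ∉ K → F' =ᶠ[nhds y] fun _ ↦ 0 := fun y hy ↦ by
    filter_upwards [hK.isClosed.isOpen_compl.mem_nhds hy] with z hz' using hz z hz'
  -- The open sets `T` and the complement of `K` cover `E`; the extension by zero is `F` on the
  -- first and vanishes on the second.
  have hC : ContDiff ℝ 1 F' := contDiff_iff_contDiffAt.2 fun y ↦ by
    by_cases hyT : y ∈ T
    · exact (hF.contDiffAt (hT.mem_nhds hyT)).congr_of_eventuallyEq (hev y hyT)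
    · exact contDiffAt_const.congr_of_eventuallyEq (hzev y fun h ↦ hyT (hKT h))
  have e1 : ∫ y in T, LinearMap.trace ℝ E (fderiv ℝ F y).toLinearMap ∂μ
      = ∫ y in T, LinearMap.trace ℝ E (fderiv ℝ F' y).toLinearMap ∂μ :=
    setIntegral_congr_fun hT.measurableSet fun y hy ↦ by
      simp only [(hev y hy).fderiv_eq]
  have e2 : ∫ y in T, LinearMap.trace ℝ E (fderiv ℝ F' y).toLinearMap ∂μ
      = ∫ y, LinearMap.trace ℝ E (fderiv ℝ F' y).toLinearMap ∂μ := by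
    refine setIntegral_eq_integral_of_forall_compl_eq_zero fun y hy ↦ ?_
    rw [(hzev y fun h ↦ hy (hKT h)).fderiv_eq]
    simp
  let L : Fin (Module.finrank ℝ E) → E →L[ℝ] ℝ := fun i ↦
    LinearMap.toContinuousLinearMap ((Module.finBasis ℝ E).coord i)
  have e3 : ∀ y, LinearMap.trace ℝ E (fderiv ℝ F' y).toLinearMap
      = ∑ i, fderiv ℝ (fun z ↦ L i (F' z)) y (Module.finBasis ℝ E i) := fun y ↦ by
    rw [trace_eq_sum_repr (Module.finBasis ℝ E)]
    refine Finset.sum_congr rfl fun i _ ↦ ?_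
    rw [fderiv_fun_comp y (L i).differentiableAt (hC.contDiffAt.differentiableAt (by simp)),
      ContinuousLinearMap.fderiv]
    rfl
  have hCi : ∀ i, ContDiff ℝ 1 fun z ↦ L i (F' z) := fun i ↦ (L i).contDiff.comp hC
  have hSi : ∀ i, HasCompactSupport fun z ↦ L i (F' z) := fun i ↦
    HasCompactSupport.intro hK fun y hy ↦ by rw [hz y hy, map_zero]
  rw [e1, e2]
  simp only [e3]
  rw [integral_finsetSum]
  · exact Finset.sum_eq_zero fun i _ ↦ integral_fderiv_eq_zero μ (hCi i) (hSi i) _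
  · intro i _
    exact (((hCi i).continuous_fderiv (by simp)).clm_apply
      continuous_const).integrable_of_hasCompactSupport ((hSi i).fderiv_apply ℝ _)

end Density

/-! ### Integration against the Riemannian density in a chart -/

section ChartIntegral

open MeasureTheory

variable {E : Type*} [NormedAddCommGroup E] [NormedSpace ℝ E] [FiniteDimensional ℝ E]
  {M : Type*} [TopologicalSpace M] [ChartedSpace E M] [IsManifold 𝓘(ℝ, E) ∞ M]

theorem metricIn_of_eq (g : Metric E M) {p q : M} {y : E} (hq : (chartAt E p).symm y = q) (u v : E) :
    metricIn g p y u v = g.inner q (frame p q u) (frame p q v) := by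
  subst hq; rfl

theorem frame_coordChange {p p' q : M} (hq : q ∈ (chartAt E p).source)
    (hq' : q ∈ (chartAt E p').source) (v : E) :
    frame p' q (tangentCoordChange 𝓘(ℝ, E) p p' q v) = frame p q v :=
  tangentCoordChange_comp (I := 𝓘(ℝ, E)) (by simp [hq, hq'])

theorem metricIn_coordChange (g : Metric E M) {p p' : M} {y : E} (hy : y ∈ (chartAt E p).target)
    (hy' : (chartAt E p).symm y ∈ (chartAt E p').source) :
    metricIn g p y = (metricIn g p' (chartAt E p' ((chartAt E p).symm y))).bilinearComp
      (tangentCoordChange 𝓘(ℝ, E) p p' ((chartAt E p).symm y))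
      (tangentCoordChange 𝓘(ℝ, E) p p' ((chartAt E p).symm y)) := by
  ext u v
  rw [ContinuousLinearMap.bilinearComp_apply, metricIn_of_eq g ((chartAt E p').left_inv hy'),
    metricIn_of_eq g rfl, frame_coordChange (symm_mem_source hy) hy',
    frame_coordChange (symm_mem_source hy) hy']

theorem hasFDerivAt_coordChange {p p' : M} {y : E} (hy : y ∈ (chartAt E p).target)
    (hy' : (chartAt E p).symm y ∈ (chartAt E p').source) :
    HasFDerivAt ((chartAt E p).symm.trans (chartAt E p'))
      (tangentCoordChange 𝓘(ℝ, E) p p' ((chartAt E p).symm y)) y := by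
  have h := hasFDerivWithinAt_tangentCoordChange (I := 𝓘(ℝ, E)) (x := p) (y := p')
    (z := (chartAt E p).symm y) (by simp [hy', symm_mem_source hy])
  simp only [mfld_simps, modelWithCornersSelf_coe, Set.range_id, hasFDerivWithinAt_univ] at h
  rwa [(chartAt E p).right_inv hy] at h

variable [MeasurableSpace E] [BorelSpace E] (μ : Measure E) [μ.IsAddHaarMeasure]

/-- The integral, in the chart at `p`, of a function with respect to the Riemannian density. -/
def chartIntegral (g : Metric E M) (p : M) (u : M → ℝ) : ℝ :=
  ∫ y in (chartAt E p).target, u ((chartAt E p).symm y) * density (metricIn g p y) ∂μ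

/-- The Jacobian determinant of the transition map is exactly the factor by which the two densities
differ, so functions living on the overlap have a chart-independent integral. -/
theorem chartIntegral_eq (g : Metric E M) {p p' : M} {u : M → ℝ}
    (hu : ∀ x, u x ≠ 0 → x ∈ (chartAt E p).source ∧ x ∈ (chartAt E p').source) :
    chartIntegral μ g p u = chartIntegral μ g p' u := by
  set e := (chartAt E p).symm.trans (chartAt E p') with he
  have hs : ∀ y, y ∈ e.source ↔ y ∈ (chartAt E p).target ∧
      (chartAt E p).symm y ∈ (chartAt E p').source := fun y ↦ by simp [he]
  have ht : ∀ y, y ∈ e.target ↔ y ∈ (chartAt E p').target ∧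
      (chartAt E p').symm y ∈ (chartAt E p).source := fun y ↦ by simp [he]
  have e1 : chartIntegral μ g p u
      = ∫ y in e.source, u ((chartAt E p).symm y) * density (metricIn g p y) ∂μ := by
    refine setIntegral_eq_of_subset_of_forall_sdiff_eq_zero (chartAt E p).open_target.measurableSet
      (fun y hy ↦ ((hs y).1 hy).1) fun y hy ↦ ?_
    have : u ((chartAt E p).symm y) = 0 := by
      by_contra hne
      exact hy.2 ((hs y).2 ⟨hy.1, (hu _ hne).2⟩)
    rw [this, zero_mul]
  have e2 : chartIntegral μ g p' u
      = ∫ y in e.target, u ((chartAt E p').symm y) * density (metricIn g p' y) ∂μ := by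
    refine setIntegral_eq_of_subset_of_forall_sdiff_eq_zero (chartAt E p').open_target.measurableSet
      (fun y hy ↦ ((ht y).1 hy).1) fun y hy ↦ ?_
    have : u ((chartAt E p').symm y) = 0 := by
      by_contra hne
      exact hy.2 ((ht y).2 ⟨hy.1, (hu _ hne).1⟩)
    rw [this, zero_mul]
  rw [e1, e2, integral_target_eq_integral_abs_det_fderiv_smul μ
    (f' := fun y ↦ tangentCoordChange 𝓘(ℝ, E) p p' ((chartAt E p).symm y))
    (fun y hy ↦ hasFDerivAt_coordChange ((hs y).1 hy).1 ((hs y).1 hy).2)]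
  refine setIntegral_congr_fun e.open_source.measurableSet fun y hy ↦ ?_
  obtain ⟨hy1, hy2⟩ := (hs y).1 hy
  have h1 : e y = chartAt E p' ((chartAt E p).symm y) := rfl
  simp only [smul_eq_mul]
  rw [metricIn_coordChange g hy1 hy2, density_comp, h1, (chartAt E p').left_inv hy2]
  ring

variable [CompactSpace M] [T2Space M]

theorem integrableOn_chart {g : Metric E M} {p : M}
    (hg : ContinuousOn (fun y ↦ density (metricIn g p y)) (chartAt E p).target) {u : M → ℝ}
    (hc : ContinuousOn (fun y ↦ u ((chartAt E p).symm y)) (chartAt E p).target) {K : Set M}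
    (hK : IsClosed K) (hKs : K ⊆ (chartAt E p).source) (hu : ∀ x, x ∉ K → u x = 0) :
    IntegrableOn (fun y ↦ u ((chartAt E p).symm y) * density (metricIn g p y))
      (chartAt E p).target μ := by
  have hcomp : IsCompact (chartAt E p '' K) :=
    hK.isCompact.image_of_continuousOn ((chartAt E p).continuousOn.mono hKs)
  have hsub : chartAt E p '' K ⊆ (chartAt E p).target := by
    rintro _ ⟨x, hx, rfl⟩
    exact (chartAt E p).map_source (hKs hx)
  refine (((hc.mul hg).mono hsub).integrableOn_compact hcomp).of_forall_sdiff_eq_zero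
    (chartAt E p).open_target.measurableSet fun y hy ↦ ?_
  have : (chartAt E p).symm y ∉ K := fun h ↦
    hy.2 ⟨_, h, (chartAt E p).right_inv hy.1⟩
  simp only [Pi.mul_apply]
  rw [hu _ this, zero_mul]

end ChartIntegral

/-! ### The divergence theorem on a compact manifold -/

section Divergence

open MeasureTheory

variable {E : Type*} [NormedAddCommGroup E] [NormedSpace ℝ E] [FiniteDimensional ℝ E]
  {M : Type*} [TopologicalSpace M] [ChartedSpace E M] [IsManifold 𝓘(ℝ, E) ∞ M]

/-- The two endomorphisms are conjugate through `frame`. -/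
theorem trace_connection {D : Connection E M} {p : M} {y : E} (hy : y ∈ (chartAt E p).target)
    {W : Π x : M, TangentSpace 𝓘(ℝ, E) x} (hW : DifferentiableAt ℝ (fieldIn p W) y) :
    LinearMap.trace ℝ (TangentSpace 𝓘(ℝ, E) ((chartAt E p).symm y))
      (D W ((chartAt E p).symm y)).toLinearMap
      = LinearMap.trace ℝ E (covField (christoffel D p) (fieldIn p W) y).toLinearMap := by
  set q := (chartAt E p).symm y
  let e : E ≃ₗ[ℝ] TangentSpace 𝓘(ℝ, E) q := LinearEquiv.ofLinearMap (frame p q).toLinearMap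
    (coframe p q).toLinearMap
    (LinearMap.ext fun w ↦ frame_coframe (symm_mem_source hy) w)
    (LinearMap.ext fun w ↦ coframe_frame (symm_mem_source hy) w)
  rw [← LinearMap.trace_conj' (covField (christoffel D p) (fieldIn p W) y).toLinearMap e]
  congr 1
  ext w
  have h := connection_frame D hy ((diffFieldAt_iff hy).2 hW) (coframe p q w)
  rw [frame_coframe (symm_mem_source hy)] at h
  exact h

variable [CompactSpace M] [T2Space M]

/-- On a compact manifold, a field whose divergence has a sign is divergence free. -/
theorem trace_eq_zero_of_nonneg {g : Metric E M} {D : Connection E M}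
    (hLC : ∀ p : M, LocalLeviCivita (chartAt E p).target (metricIn g p) (christoffel D p))
    {W : Π x : M, TangentSpace 𝓘(ℝ, E) x}
    (hW : ∀ p : M, ContDiffOn ℝ 1 (fieldIn p W) (chartAt E p).target)
    (hpos : ∀ x, 0 ≤ LinearMap.trace ℝ (TangentSpace 𝓘(ℝ, E) x) (D W x).toLinearMap) (x : M) :
    LinearMap.trace ℝ (TangentSpace 𝓘(ℝ, E) x) (D W x).toLinearMap = 0 := by
  let _ : MeasurableSpace E := borel E
  have : BorelSpace E := ⟨rfl⟩
  let μ : Measure E := Measure.addHaar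
  have hWd : ∀ (p : M), ∀ y ∈ (chartAt E p).target, DifferentiableAt ℝ (fieldIn p W) y :=
    fun p y hy ↦ ((hW p).contDiffAt ((chartAt E p).open_target.mem_nhds hy)).differentiableAt
      (by simp)
  obtain ⟨ρ, hρ⟩ := SmoothPartitionOfUnity.exists_isSubordinate_chartAt_source 𝓘(ℝ, E) M
  have hfin := ρ.locallyFinite.finite_nonempty_of_compact
  -- Compactness leaves finitely many nonzero functions in the partition of unity, which is indexed
  -- by the points of `M`, the function `ρ i` being supported in the chart at `i`.
  set s : Finset M := hfin.toFinset with hs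
  have hsum : ∀ x, ∑ i ∈ s, ρ i x = 1 := fun x ↦ by
    rw [← ρ.sum_eq_one (Set.mem_univ x), finsum_eq_sum_of_support_subset]
    intro i hi
    simp only [hs, Finset.mem_coe, Set.Finite.mem_toFinset, Set.mem_ofPred_eq]
    exact ⟨x, hi⟩
  set dv : M → ℝ := fun x ↦ LinearMap.trace ℝ (TangentSpace 𝓘(ℝ, E) x) (D W x).toLinearMap with hdv
  set d : M → M → ℝ := fun i x ↦ mvfderiv 𝓘(ℝ, E) (ρ i) x (W x) with hd
  have hρs : ∀ i p, ContDiffOn ℝ ∞ (fun y ↦ ρ i ((chartAt E p).symm y)) (chartAt E p).target :=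
    fun i p y hy ↦ ((contMDiffAt_comp_chart_symm_iff hy).1
      (ρ i).contMDiff.contMDiffAt).contDiffWithinAt
  have hρd : ∀ i p, ∀ y ∈ (chartAt E p).target,
      DifferentiableAt ℝ (fun y ↦ ρ i ((chartAt E p).symm y)) y := fun i p y hy ↦
    ((hρs i p).contDiffAt ((chartAt E p).open_target.mem_nhds hy)).differentiableAt (by simp)
  have hdin : ∀ i p, ∀ y ∈ (chartAt E p).target, d i ((chartAt E p).symm y)
      = fderiv ℝ (fun y ↦ ρ i ((chartAt E p).symm y)) y (fieldIn p W y) := by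
    intro i p y hy
    simp only [hd]
    rw [← frame_fieldIn W hy, mvfderiv_frame hy
      ((ρ i).contMDiff.contMDiffAt.mdifferentiableAt (by simp))]
    rfl
  have hdvin : ∀ p, ∀ y ∈ (chartAt E p).target, dv ((chartAt E p).symm y)
      = LinearMap.trace ℝ E (covField (christoffel D p) (fieldIn p W) y).toLinearMap :=
    fun p y hy ↦ trace_connection hy (hWd p y hy)
  have cρ : ∀ i p, ContinuousOn (fun y ↦ ρ i ((chartAt E p).symm y)) (chartAt E p).target :=
    fun i p ↦ (hρs i p).continuousOn
  have cd : ∀ i p, ContinuousOn (fun y ↦ d i ((chartAt E p).symm y)) (chartAt E p).target := by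
    intro i p
    refine ContinuousOn.congr ?_ (hdin i p)
    exact (((hρs i p).fderiv_of_isOpen (m := ∞) (chartAt E p).open_target le_rfl).continuousOn).clm_apply
      (hW p).continuousOn
  have cdv : ∀ p, ContinuousOn (fun y ↦ dv ((chartAt E p).symm y)) (chartAt E p).target := by
    intro p
    refine ContinuousOn.congr ?_ (hdvin p)
    have c1 : ContinuousOn (covField (christoffel D p) (fieldIn p W)) (chartAt E p).target := by
      have h1 : ContinuousOn (fderiv ℝ (fieldIn p W)) (chartAt E p).target :=
        (hW p).continuousOn_fderiv_of_isOpen (chartAt E p).open_target le_rfl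
      have h2 : ContinuousOn (fun y ↦ (christoffel D p y).flip) (chartAt E p).target :=
        (ContinuousLinearMap.flipₗᵢ ℝ E E E).continuous.comp_continuousOn
          (hLC p).smooth_symbols.continuousOn
      exact h1.add (h2.clm_apply (hW p).continuousOn)
    let L : (E →L[ℝ] E) →L[ℝ] ℝ := LinearMap.toContinuousLinearMap
      ((LinearMap.trace ℝ E) ∘ₗ (ContinuousLinearMap.coeLM ℝ : (E →L[ℝ] E) →ₗ[ℝ] (E →ₗ[ℝ] E)))
    exact L.continuous.comp_continuousOn c1
  have cσ : ∀ p, ContinuousOn (fun y ↦ density (metricIn g p y)) (chartAt E p).target :=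
    fun p ↦ (hLC p).contDiffOn_density.continuousOn
  have hρ0 : ∀ i x, x ∉ tsupport (ρ i) → ρ i x = 0 := fun i x hx ↦
    image_eq_zero_of_notMem_tsupport hx
  have hd0 : ∀ i x, x ∉ tsupport (ρ i) → d i x = 0 := fun i x hx ↦ by
    have : (ρ i : M → ℝ) =ᶠ[nhds x] fun _ ↦ (0 : ℝ) := by
      filter_upwards [(isClosed_tsupport (ρ i)).isOpen_compl.mem_nhds hx] with z hz using hρ0 i z hz
    simp only [hd]
    rw [mvfderiv, this.mfderiv_eq, mfderiv_const]
    rfl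
  have hK : ∀ i, IsClosed (tsupport (ρ i)) := fun i ↦ isClosed_tsupport _
  -- the divergence theorem in each chart
  have local_zero : ∀ i, chartIntegral μ g i (fun x ↦ ρ i x * dv x)
      + chartIntegral μ g i (d i) = 0 := by
    intro i
    have i1 := integrableOn_chart μ (u := fun x ↦ ρ i x * dv x) (cσ i) ((cρ i i).mul (cdv i)) (hK i)
      (hρ i) (fun x hx ↦ by rw [hρ0 i x hx, zero_mul])
    have i2 := integrableOn_chart μ (u := d i) (cσ i) (cd i i) (hK i) (hρ i) (hd0 i)
    rw [chartIntegral, chartIntegral, ← integral_add i1 i2]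
    have hcomp : IsCompact (chartAt E i '' tsupport (ρ i)) :=
      (hK i).isCompact.image_of_continuousOn ((chartAt E i).continuousOn.mono (hρ i))
    have hsub : chartAt E i '' tsupport (ρ i) ⊆ (chartAt E i).target := by
      rintro _ ⟨x, hx, rfl⟩
      exact (chartAt E i).map_source (hρ i hx)
    rw [← setIntegral_trace_fderiv_eq_zero μ (chartAt E i).open_target hcomp hsub
      (F := fun y ↦ (density (metricIn g i y) * ρ i ((chartAt E i).symm y)) • fieldIn i W y)
      ((((hLC i).contDiffOn_density.mul (hρs i i)).of_le (WithTop.coe_le_coe.2 le_top)).smul (hW i))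
      (fun y hy hy' ↦ by
        rw [hρ0 i _ fun h ↦ hy' ⟨_, h, (chartAt E i).right_inv hy⟩, mul_zero, zero_smul])]
    refine setIntegral_congr_fun (chartAt E i).open_target.measurableSet fun y hy ↦ ?_
    rw [(hLC i).trace_fderiv_density_smul hy (hρd i i y hy) (hWd i y hy), hdin i i y hy,
      hdvin i y hy]
    ring
  have hdsum : ∀ x, ∑ i ∈ s, d i x = 0 := by
    intro x
    have hx := mem_chart_target E x
    have hxx : (chartAt E x).symm (chartAt E x x) = x :=
      (chartAt E x).left_inv (mem_chart_source E x)
    have e : ∀ i, d i x = fderiv ℝ (fun y ↦ ρ i ((chartAt E x).symm y)) (chartAt E x x)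
        (fieldIn x W (chartAt E x x)) := fun i ↦ by
      rw [← hdin i x _ hx, hxx]
    simp only [e]
    rw [← sum_apply, ← fderiv_fun_sum fun i _ ↦ hρd i x _ hx]
    simp [hsum]
  -- Each `d i` is split as the sum of `ρ j * d i`, which lives in the charts at `i` and at `j` and
  -- may be integrated in the latter. Summing over `i` first then gives zero, because the `d i` add
  -- up to the derivative of the constant `1`.
  have hglob : ∑ i ∈ s, chartIntegral μ g i (d i) = 0 := by
    have i3 : ∀ i j, IntegrableOn (fun y ↦ ρ j ((chartAt E j).symm y) * d i ((chartAt E j).symm y)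
        * density (metricIn g j y)) (chartAt E j).target μ := fun i j ↦
      integrableOn_chart μ (u := fun x ↦ ρ j x * d i x) (cσ j) ((cρ j j).mul (cd i j)) (hK j)
        (hρ j) (fun x hx ↦ by rw [hρ0 j x hx, zero_mul])
    have i4 : ∀ i j, IntegrableOn (fun y ↦ ρ j ((chartAt E i).symm y) * d i ((chartAt E i).symm y)
        * density (metricIn g i y)) (chartAt E i).target μ := fun i j ↦
      integrableOn_chart μ (u := fun x ↦ ρ j x * d i x) (cσ i) ((cρ j i).mul (cd i i)) (hK i)
        (hρ i) (fun x hx ↦ by rw [hd0 i x hx, mul_zero])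
    have e1 : ∀ i, chartIntegral μ g i (d i)
        = ∑ j ∈ s, chartIntegral μ g j (fun x ↦ ρ j x * d i x) := by
      intro i
      have e2 : ∀ j, chartIntegral μ g j (fun x ↦ ρ j x * d i x)
          = chartIntegral μ g i (fun x ↦ ρ j x * d i x) := fun j ↦ by
        refine chartIntegral_eq μ g fun x hx ↦ ⟨hρ j ?_, hρ i ?_⟩
        · by_contra h; exact hx (by rw [hρ0 j x h, zero_mul])
        · by_contra h; exact hx (by rw [hd0 i x h, mul_zero])
      rw [Finset.sum_congr rfl fun j _ ↦ e2 j]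
      simp only [chartIntegral]
      rw [← integral_finsetSum _ fun j _ ↦ i4 i j]
      refine integral_congr_ae (Filter.Eventually.of_forall fun y ↦ ?_)
      simp only
      rw [← Finset.sum_mul, ← Finset.sum_mul, hsum, one_mul]
    simp only [e1]
    rw [Finset.sum_comm]
    refine Finset.sum_eq_zero fun j _ ↦ ?_
    simp only [chartIntegral]
    rw [← integral_finsetSum _ fun i _ ↦ i3 i j]
    rw [← integral_zero E ℝ (μ := μ.restrict (chartAt E j).target)]
    refine integral_congr_ae (Filter.Eventually.of_forall fun y ↦ ?_)
    simp only
    rw [← Finset.sum_mul, ← Finset.mul_sum, hdsum, mul_zero, zero_mul]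
  have htot : ∑ i ∈ s, chartIntegral μ g i (fun x ↦ ρ i x * dv x) = 0 := by
    have := Finset.sum_congr (s₁ := s) rfl fun i (_ : i ∈ s) ↦ local_zero i
    rw [Finset.sum_add_distrib, hglob, Finset.sum_const_zero, add_zero] at this
    exact this
  have hnn : ∀ i, ∀ y ∈ (chartAt E i).target, 0 ≤ ρ i ((chartAt E i).symm y)
      * dv ((chartAt E i).symm y) * density (metricIn g i y) := fun i y hy ↦
    mul_nonneg (mul_nonneg (ρ.nonneg i _) (hpos _)) ((hLC i).density_pos hy).le
  have hnonneg : ∀ i ∈ s, 0 ≤ chartIntegral μ g i (fun x ↦ ρ i x * dv x) := fun i _ ↦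
    setIntegral_nonneg (chartAt E i).open_target.measurableSet (hnn i)
  have hzero := (Finset.sum_eq_zero_iff_of_nonneg hnonneg).1 htot
  obtain ⟨i, his, hix⟩ : ∃ i ∈ s, ρ i x ≠ 0 := by
    by_contra! hcon
    have := hsum x
    rw [Finset.sum_eq_zero hcon] at this
    exact zero_ne_one this
  have hxs : x ∈ (chartAt E i).source := hρ i (subset_tsupport _ hix)
  have hxt := (chartAt E i).map_source hxs
  have i1 := integrableOn_chart μ (u := fun x ↦ ρ i x * dv x) (cσ i) ((cρ i i).mul (cdv i)) (hK i)
      (hρ i) (fun x hx ↦ by rw [hρ0 i x hx, zero_mul])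
  have hae := (setIntegral_eq_zero_iff_of_nonneg_ae
    (ae_restrict_of_forall_mem (chartAt E i).open_target.measurableSet (hnn i)) i1).1 (hzero i his)
  -- A nonnegative integrand with zero integral vanishes almost everywhere, and by continuity
  -- everywhere on the open chart target.
  have heq := Measure.eqOn_open_of_ae_eq hae (chartAt E i).open_target
    (((cρ i i).mul (cdv i)).mul (cσ i)) continuousOn_const hxt
  simp only [Pi.zero_apply, (chartAt E i).left_inv hxs, mul_eq_zero] at heq
  rcases heq with (h | h) | h
  · exact absurd h hix
  · exact h
  · exact absurd h ((hLC i).density_pos hxt).ne'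

end Divergence

/-! ### Uniqueness of Weyl connections and smoothness of Levi-Civita connections -/

section WeylUniqueness

variable {E : Type*} [NormedAddCommGroup E] [NormedSpace ℝ E] [FiniteDimensional ℝ E]

/-- A trilinear form which is symmetric in two arguments and skew in two others vanishes. -/
theorem eq_zero_of_symm_of_skew {S : E → E → E → ℝ} (h1 : ∀ u v w, S u v w = S v u w)
    (h2 : ∀ u v w, S u v w = - S u w v) (u v w : E) : S u v w = 0 := by
  have a := h1 u v w
  have b := h2 v u w
  have c := h1 v w u
  have d := h2 w v u
  have e := h1 w u v
  have f := h2 u w v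
  linarith

theorem eq_of_forall_inner {B : E →L[ℝ] E →L[ℝ] ℝ} (hp : ∀ u, u ≠ 0 → 0 < B u u) {a b : E}
    (h : ∀ w, B a w = B b w) : a = b := by
  by_contra hne
  have h1 := hp _ (sub_ne_zero.2 hne)
  rw [map_sub B, sub_apply, h, sub_self] at h1
  exact lt_irrefl _ h1

variable {U : Set E} {G : E → E →L[ℝ] E →L[ℝ] ℝ} {Γ Γ' : E → E →L[ℝ] E →L[ℝ] E} {Ξ : E → E}

/-- A Weyl connection is determined by the Levi-Civita connection and its 1-form. -/
theorem eq_weylSymbols {y : E} (hs : ∀ u v, G y u v = G y v u) (hp : ∀ u, u ≠ 0 → 0 < G y u u)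
    (hΓ : ∀ u v, Γ y u v = Γ y v u) (hΓ' : ∀ u v, Γ' y u v = Γ' y v u)
    (hG : ∀ u v w, fderiv ℝ G y u v w = G y (Γ y u v) w + G y v (Γ y u w))
    (hG' : ∀ u v w, fderiv ℝ G y u v w = G y (Γ' y u v) w + G y v (Γ' y u w)
      + G y (Ξ y) u * G y v w) (u v : E) :
    Γ' y u v = weylSymbols G Γ Ξ y u v := by
  refine eq_of_forall_inner hp fun w ↦ sub_eq_zero.1 ?_
  -- The difference of two connections, lowered by the metric, is symmetric in `u, v` by
  -- torsion-freeness and skew in `v, w` because both have the same effect on `G`.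
  refine eq_zero_of_symm_of_skew (S := fun u v w ↦ G y (Γ' y u v) w
    - G y (weylSymbols G Γ Ξ y u v) w) (fun u v w ↦ ?_) (fun u v w ↦ ?_) u v w
  · simp only [weylSymbols, hΓ v u, hΓ' v u, hs v u, map_add, map_sub, map_smul, add_apply,
      sub_apply, smul_apply, smul_eq_mul]
    ring
  · have e := (hG u v w).symm.trans (hG' u v w)
    simp only [weylSymbols, map_add, map_sub, map_smul, add_apply, sub_apply, smul_apply,
      smul_eq_mul]
    rw [hs (Γ' y u w), hs (Γ y u w), hs w v, hs u w, hs u v] at *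
    linarith

/-- Smoothness is not part of `IsLeviCivita`. It is recovered by solving `eq_weylSymbols` for `Γ` in
terms of a smooth Weyl connection and its 1-form. -/
theorem localLeviCivita_of_weyl (hU : IsOpen U) (sG : ContDiffOn ℝ ∞ G U)
    (sΓ' : ContDiffOn ℝ ∞ Γ' U) (sΞ : ContDiffOn ℝ ∞ Ξ U) (hs : ∀ y ∈ U, ∀ u v, G y u v = G y v u)
    (hp : ∀ y ∈ U, ∀ u, u ≠ 0 → 0 < G y u u)
    (hΓ : ∀ y ∈ U, ∀ u v, Γ y u v = Γ y v u) (hΓ' : ∀ y ∈ U, ∀ u v, Γ' y u v = Γ' y v u)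
    (hG : ∀ y ∈ U, ∀ u v w, fderiv ℝ G y u v w = G y (Γ y u v) w + G y v (Γ y u w))
    (hG' : ∀ y ∈ U, ∀ u v w, fderiv ℝ G y u v w = G y (Γ' y u v) w + G y v (Γ' y u w)
      + G y (Ξ y) u * G y v w) : LocalLeviCivita U G Γ where
  isOpen := hU
  smooth_metric := sG
  metric_symm := hs
  metric_pos := hp
  torsion_free := hΓ
  deriv_metric := hG
  smooth_symbols := by
    rw [contDiffOn_clm_apply]; intro u
    rw [contDiffOn_clm_apply]; intro v
    have c : ∀ a : E, ContDiffOn ℝ ∞ (fun _ : E ↦ a) U := fun a ↦ contDiffOn_const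
    have s1 : ContDiffOn ℝ ∞ (fun y ↦ Γ' y u v) U := (sΓ'.clm_apply (c u)).clm_apply (c v)
    have s2 : ∀ a, ContDiffOn ℝ ∞ (fun y ↦ 1 / 2 * G y (Ξ y) a) U := fun a ↦
      contDiffOn_const.mul ((sG.clm_apply sΞ).clm_apply (c a))
    have s3 : ContDiffOn ℝ ∞ (fun y ↦ 1 / 2 * G y u v) U :=
      contDiffOn_const.mul ((sG.clm_apply (c u)).clm_apply (c v))
    refine (((s1.add ((s2 u).smul (c v))).add ((s2 v).smul (c u))).sub (s3.smul sΞ)).congr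
      fun y hy ↦ ?_
    change Γ y u v = Γ' y u v + (1 / 2 * G y (Ξ y) u) • v + (1 / 2 * G y (Ξ y) v) • u
      - (1 / 2 * G y u v) • Ξ y
    rw [eq_weylSymbols (hs y hy) (hp y hy) (hΓ y hy) (hΓ' y hy) (hG y hy) (hG' y hy), weylSymbols]
    module

end WeylUniqueness

/-! ### Symmetric and skew parts of a covariant derivative -/

section LieDerivative

variable {E : Type*} [NormedAddCommGroup E] [NormedSpace ℝ E] [FiniteDimensional ℝ E]

namespace LocalLeviCivita

variable {U : Set E} {G : E → E →L[ℝ] E →L[ℝ] ℝ} {Γ : E → E →L[ℝ] E →L[ℝ] E} {Ξ : E → E}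
  (h : LocalLeviCivita U G Γ) {y : E} (hy : y ∈ U)

include h hy

/-- The Lie derivative of the metric. -/
theorem lie_metric (u v : E) : G y (covField Γ Ξ y u) v + G y (covField Γ Ξ y v) u
    = fderiv ℝ G y (Ξ y) u v + G y (fderiv ℝ Ξ y u) v + G y u (fderiv ℝ Ξ y v) := by
  rw [h.deriv_metric y hy, covField_apply, covField_apply, h.metric_symm y hy _ u,
    h.torsion_free y hy (Ξ y) u, h.torsion_free y hy (Ξ y) v]
  simp only [map_add, add_apply]
  ring

/-- The exterior derivative of the 1-form dual to a vector field. -/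
theorem curl (hΞ : DifferentiableAt ℝ Ξ y) (u v : E) :
    G y (covField Γ Ξ y u) v - G y (covField Γ Ξ y v) u
    = fderiv ℝ (fun z ↦ G z (Ξ z) v) y u - fderiv ℝ (fun z ↦ G z (Ξ z) u) y v := by
  have c1 : ∀ a : E, DifferentiableAt ℝ (fun _ : E ↦ a) y := fun a ↦ differentiableAt_const a
  rw [h.fderiv_inner hy hΞ (c1 v), h.fderiv_inner hy hΞ (c1 u), h.torsion_free y hy v u]
  simp [covField_apply]

end LocalLeviCivita

end LieDerivative

/-! ### The complex structure in a chart -/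

section ComplexCharts

variable {E : Type*} [NormedAddCommGroup E] [NormedSpace ℂ E]
  {M : Type*} [TopologicalSpace M] [ChartedSpace E M] [IsManifold 𝓘(ℂ, E) ω M]

variable (E) in
/-- Multiplication by `i` on the model space. -/
def modelJ : E →L[ℝ] E := Complex.I • ContinuousLinearMap.id ℝ E

theorem modelJ_apply (v : E) : modelJ E v = Complex.I • v := rfl

theorem modelJ_sq (v : E) : modelJ E (modelJ E v) = - v := by
  simp [modelJ_apply, smul_smul]

/-- The real derivative of a holomorphic transition map is its complex derivative with scalars
restricted. Thus `J` is the constant `modelJ E` in every chart. -/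
theorem coordChange_modelJ {p p' q : M} (hq : q ∈ (chartAt E p).source)
    (hq' : q ∈ (chartAt E p').source) (v : E) :
    tangentCoordChange 𝓘(ℝ, E) p p' q (modelJ E v) = modelJ E (tangentCoordChange 𝓘(ℝ, E) p p' q v) := by
  have : IsManifold 𝓘(ℂ, E) 1 M := IsManifold.of_le (n := ω) le_top
  have h := hasFDerivWithinAt_tangentCoordChange (I := 𝓘(ℂ, E)) (x := p) (y := p')
    (z := q) (by simp [hq, hq'])
  have h' := hasFDerivWithinAt_tangentCoordChange (I := 𝓘(ℝ, E)) (x := p) (y := p')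
    (z := q) (by simp [hq, hq'])
  simp only [mfld_simps, modelWithCornersSelf_coe, Set.range_id, hasFDerivWithinAt_univ] at h h'
  have e := h'.unique (h.restrictScalars ℝ)
  rw [e]
  simp [modelJ_apply]

theorem frame_modelJ {p q : M} (hq : q ∈ (chartAt E p).source) (v : E) :
    frame p q (modelJ E v) = J q (frame p q v) :=
  coordChange_modelJ hq (mem_chart_source E q) v

theorem coframe_J {p q : M} (hq : q ∈ (chartAt E p).source) (v : TangentSpace 𝓘(ℝ, E) q) :
    coframe p q (J q v) = modelJ E (coframe p q v) :=
  coordChange_modelJ (mem_chart_source E q) hq v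

theorem fieldIn_J {p : M} {y : E} (hy : y ∈ (chartAt E p).target)
    (X : Π x : M, TangentSpace 𝓘(ℝ, E) x) :
    fieldIn p (fun q ↦ J q (X q)) y = modelJ E (fieldIn p X y) :=
  coframe_J (symm_mem_source hy) _

theorem fieldIn_J_eventuallyEq {p : M} {y : E} (hy : y ∈ (chartAt E p).target)
    (X : Π x : M, TangentSpace 𝓘(ℝ, E) x) :
    fieldIn p (fun q ↦ J q (X q)) =ᶠ[nhds y] fun z ↦ modelJ E (fieldIn p X z) := by
  filter_upwards [(chartAt E p).open_target.mem_nhds hy] with z hz using fieldIn_J hz X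

theorem diffFieldAt_J {x : M} {X : Π x : M, TangentSpace 𝓘(ℝ, E) x} (hX : DiffFieldAt X x) :
    DiffFieldAt (fun q ↦ J q (X q)) x := by
  have hx := mem_chart_target E x
  have hxx : (chartAt E x).symm (chartAt E x x) = x := (chartAt E x).left_inv (mem_chart_source E x)
  rw [← hxx] at hX ⊢
  rw [diffFieldAt_iff hx] at hX ⊢
  exact ((modelJ E).differentiableAt.comp _ hX).congr_of_eventuallyEq (fieldIn_J_eventuallyEq hx X)

theorem metricIn_modelJ {g : Metric E M} (hg : IsHermitian g) {p : M} {y : E}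
    (hy : y ∈ (chartAt E p).target) : IsOrthogonalComplex (metricIn g p y) (modelJ E) where
  sq := modelJ_sq
  inner u v := by
    rw [metricIn_apply, metricIn_apply, frame_modelJ (symm_mem_source hy),
      frame_modelJ (symm_mem_source hy), hg]

theorem christoffel_modelJ [FiniteDimensional ℝ E] {D : Connection E M}
    (hD : ∀ (x : M) (v : TangentSpace 𝓘(ℝ, E) x) (X : Π x : M, TangentSpace 𝓘(ℝ, E) x),
      DiffFieldAt X x → D (fun y ↦ J y (X y)) x v = J x (D X x v)) {p : M} {y : E}
    (hy : y ∈ (chartAt E p).target) (u v : E) :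
    christoffel D p y u (modelJ E v) = modelJ E (christoffel D p y u v) := by
  have h := hD _ (frame p _ u) (constField p v) (diffFieldAt_constField v hy)
  have ev : fieldIn p (fun q ↦ J q (constField p v q)) =ᶠ[nhds y] fun _ ↦ modelJ E v := by
    filter_upwards [fieldIn_J_eventuallyEq hy (constField p v), fieldIn_constField_eventually v hy]
      with z h1 h2
    rw [h1, h2]
  rw [connection_constField D hy, connection_frame D hy
    (diffFieldAt_J (diffFieldAt_constField v hy)), ev.fderiv_eq, ev.eq_of_nhds,
    ← frame_modelJ (symm_mem_source hy)] at h
  have h2 := frame_injective (symm_mem_source hy) h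
  simpa using h2

end ComplexCharts

/-! ### Einstein–Weyl structures: the dual field is Killing -/

section Killing

variable {E : Type*} [NormedAddCommGroup E] [NormedSpace ℝ E] [FiniteDimensional ℝ E]
  {M : Type*} [TopologicalSpace M] [ChartedSpace E M] [IsManifold 𝓘(ℝ, E) ∞ M]

theorem forall_of_chart {P : M → Prop}
    (h : ∀ p : M, ∀ y ∈ (chartAt E p).target, P ((chartAt E p).symm y)) (x : M) : P x := by
  have := h x _ (mem_chart_target E x)
  rwa [(chartAt E x).left_inv (mem_chart_source E x)] at this

theorem contDiffOn_fieldIn_sharp (g : Metric E M) {θ : Π x : M, TangentSpace 𝓘(ℝ, E) x →L[ℝ] ℝ}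
    (hθ : IsSmoothOneForm θ) (p : M) :
    ContDiffOn ℝ ∞ (fieldIn p (sharp g θ)) (chartAt E p).target := fun y hy ↦
  (smoothField_iff.1 (smoothField_sharp g hθ) p y hy).contDiffWithinAt

theorem IsLeviCivita.fderiv_metricIn {g : Metric E M} {D : Connection E M} (hD : IsLeviCivita g D)
    {p : M} {y : E} (hy : y ∈ (chartAt E p).target) (u v w : E) :
    fderiv ℝ (metricIn g p) y u v w = metricIn g p y (christoffel D p y u v) w
      + metricIn g p y v (christoffel D p y u w) := by
  rw [EinsteinWeyl.fderiv_metricIn hD.deriv_metric hy]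
  simp [formIn]

/-- The covariant derivative of a field, read in a chart. -/
theorem connection_covField (D : Connection E M) {p : M} {y : E} (hy : y ∈ (chartAt E p).target)
    {X : Π x : M, TangentSpace 𝓘(ℝ, E) x} (hX : DifferentiableAt ℝ (fieldIn p X) y) (u : E) :
    D X ((chartAt E p).symm y) (frame p _ u)
      = frame p _ (covField (christoffel D p) (fieldIn p X) y u) :=
  connection_frame D hy ((diffFieldAt_iff hy).2 hX) u

variable [T2Space M] {g : Metric E M} {D D₀ : Connection E M}
  {θ : Π x : M, TangentSpace 𝓘(ℝ, E) x →L[ℝ] ℝ}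

theorem IsEinsteinWeyl.fderiv_metricIn (hEW : IsEinsteinWeyl g D θ) {p : M} {y : E}
    (hy : y ∈ (chartAt E p).target) (u v w : E) :
    fderiv ℝ (metricIn g p) y u v w = metricIn g p y (christoffel D p y u v) w
      + metricIn g p y v (christoffel D p y u w)
      + metricIn g p y (fieldIn p (sharp g θ) y) u * metricIn g p y v w := by
  rw [EinsteinWeyl.fderiv_metricIn hEW.deriv_metric hy, inner_sharp_in g θ hy]

theorem IsEinsteinWeyl.localLeviCivita (hEW : IsEinsteinWeyl g D θ) (hD₀ : IsLeviCivita g D₀)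
    (p : M) : LocalLeviCivita (chartAt E p).target (metricIn g p) (christoffel D₀ p) :=
  localLeviCivita_of_weyl (Γ' := christoffel D p) (Ξ := fieldIn p (sharp g θ))
    (chartAt E p).open_target (contDiffOn_metricIn g p) (contDiffOn_christoffel hEW.smooth p)
    (contDiffOn_fieldIn_sharp g hEW.smooth_form p) (fun y _ ↦ metricIn_symm g p y)
    (fun _ hy _ hu ↦ metricIn_pos g hy hu)
    (fun _ hy ↦ christoffel_symm hD₀.torsion_free hy)
    (fun _ hy ↦ christoffel_symm hEW.torsion_free hy)
    (fun _ hy ↦ hD₀.fderiv_metricIn hy) (fun _ hy ↦ hEW.fderiv_metricIn hy)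

theorem IsEinsteinWeyl.christoffel_eq (hEW : IsEinsteinWeyl g D θ) (hD₀ : IsLeviCivita g D₀)
    (p : M) {y : E} (hy : y ∈ (chartAt E p).target) (u v : E) : christoffel D p y u v
      = weylSymbols (metricIn g p) (christoffel D₀ p) (fieldIn p (sharp g θ)) y u v :=
  eq_weylSymbols (metricIn_symm g p y) (fun _ hu ↦ metricIn_pos g hy hu)
    (christoffel_symm hD₀.torsion_free hy) (christoffel_symm hEW.torsion_free hy)
    (hD₀.fderiv_metricIn hy) (hEW.fderiv_metricIn hy) u v

/-- On a compact Einstein-Weyl manifold with a Gauduchon metric, the field dual to the 1-form is a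
Killing field. -/
theorem IsEinsteinWeyl.covField_skew [CompactSpace M] (hEW : IsEinsteinWeyl g D θ)
    (hD₀ : IsLeviCivita g D₀) (hn : 2 < Module.finrank ℝ E)
    (hδ : ∀ x, codifferential g D₀ θ x = 0) {p : M} {y : E} (hy : y ∈ (chartAt E p).target)
    (u v : E) :
    metricIn g p y (covField (christoffel D₀ p) (fieldIn p (sharp g θ)) y u) v
      + metricIn g p y (covField (christoffel D₀ p) (fieldIn p (sharp g θ)) y v) u = 0 := by
  obtain ⟨Λ, hΛ, hric⟩ := hEW.ricci_eq
  set ξ := sharp g θ with hξ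
  have hLC := hEW.localLeviCivita hD₀
  have sΞ : ∀ p, ContDiffOn ℝ ∞ (fieldIn p ξ) (chartAt E p).target :=
    contDiffOn_fieldIn_sharp g hEW.smooth_form
  have dΞ : ∀ p, ∀ y ∈ (chartAt E p).target, DifferentiableAt ℝ (fieldIn p ξ) y := fun p y hy ↦
    ((sΞ p).contDiffAt ((chartAt E p).open_target.mem_nhds hy)).differentiableAt (by simp)
  have sΛ : ∀ p : M, ContDiffOn ℝ ∞ (Λ ∘ (chartAt E p).symm) (chartAt E p).target := fun p y hy ↦
    ((contMDiffAt_comp_chart_symm_iff hy).1 hΛ.contMDiffAt).contDiffWithinAt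
  have sT : ∀ p, ContDiffOn ℝ ∞ (covField (christoffel D₀ p) (fieldIn p ξ)) (chartAt E p).target :=
    fun p ↦ contDiffOn_covField (chartAt E p).open_target (hLC p).smooth_symbols (sΞ p)
  have hdiv : ∀ p, ∀ y ∈ (chartAt E p).target,
      LinearMap.trace ℝ E (covField (christoffel D₀ p) (fieldIn p ξ) y).toLinearMap = 0 := by
    intro p y hy
    rw [← trace_connection hy (dΞ p y hy)]
    have := hδ ((chartAt E p).symm y)
    rwa [codifferential, neg_eq_zero] at this
  have hricD : ∀ p, ∀ y ∈ (chartAt E p).target, ∀ v w, ric (christoffel D p) y v w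
      + ric (christoffel D p) y w v = (Λ ∘ (chartAt E p).symm) y * metricIn g p y v w := by
    intro p y hy v w
    rw [← ricci_frame hEW.smooth hy, ← ricci_frame hEW.smooth hy, hric]
    rfl
  let L : M → ℝ := fun x ↦ 1 / 2 * Λ x
    + ((Module.finrank ℝ E : ℝ) - 2) / 4 * g.inner x (ξ x) (ξ x)
  -- The dual of this 1-form is the field of `trace_covField_of_einsteinWeyl`, written without
  -- charts so that the global divergence theorem applies to it.
  let α : Π x : M, TangentSpace 𝓘(ℝ, E) x →L[ℝ] ℝ := fun x ↦
    (1 / 2 : ℝ) • (g.inner x (D₀ ξ x (ξ x)) + (g.inner x (ξ x)).comp (D₀ ξ x)) + L x • θ x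
  have hα : ∀ p, ∀ y ∈ (chartAt E p).target, ∀ u, formIn p α y u =
      1 / 2 * (metricIn g p y (covField (christoffel D₀ p) (fieldIn p ξ) y (fieldIn p ξ y)) u
      + metricIn g p y (covField (christoffel D₀ p) (fieldIn p ξ) y u) (fieldIn p ξ y))
      + LocalLeviCivita.einsteinFactor (metricIn g p) (fieldIn p ξ) (Λ ∘ (chartAt E p).symm) y
        * metricIn g p y (fieldIn p ξ y) u := by
    intro p y hy u
    rw [inner_sharp_in g θ hy]
    have e1 : LocalLeviCivita.einsteinFactor (metricIn g p) (fieldIn p ξ)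
        (Λ ∘ (chartAt E p).symm) y = L ((chartAt E p).symm y) := by
      simp only [LocalLeviCivita.einsteinFactor, L]
      rw [inner_eq_metricIn g hy ξ ξ]
      rfl
    have e2 : formIn p α y u = 1 / 2 * (g.inner ((chartAt E p).symm y)
        (D₀ ξ _ (ξ _)) (frame p _ u) + g.inner ((chartAt E p).symm y) (ξ _) (D₀ ξ _ (frame p _ u)))
        + L ((chartAt E p).symm y) * formIn p θ y u := rfl
    rw [e2, e1, ← frame_fieldIn ξ hy, connection_covField D₀ hy (dΞ p y hy),
      connection_covField D₀ hy (dΞ p y hy), ← metricIn_apply, ← metricIn_apply,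
      metricIn_symm g p y (fieldIn p ξ y)]
  have hαW : ∀ p, ∀ y ∈ (chartAt E p).target, ∀ u,
      metricIn g p y (fieldIn p (sharp g α) y) u = _ := fun p y hy u ↦
    (inner_sharp_in g α hy u).trans (hα p y hy u)
  have sα : ∀ p, ContDiffOn ℝ ∞ (formIn p α) (chartAt E p).target := by
    intro p
    rw [contDiffOn_clm_apply]; intro u
    have sG := contDiffOn_metricIn g p
    have c : ContDiffOn ℝ ∞ (fun _ : E ↦ u) (chartAt E p).target := contDiffOn_const
    refine ContDiffOn.congr ?_ fun y hy ↦ hα p y hy u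
    refine (contDiffOn_const.mul (((sG.clm_apply ((sT p).clm_apply (sΞ p))).clm_apply c).add
      ((sG.clm_apply ((sT p).clm_apply c)).clm_apply (sΞ p)))).add (ContDiffOn.mul ?_
        ((sG.clm_apply (sΞ p)).clm_apply c))
    exact (contDiffOn_const.mul (sΛ p)).add
      (contDiffOn_const.mul ((sG.clm_apply (sΞ p)).clm_apply (sΞ p)))
  have sW : ∀ p, ContDiffOn ℝ 1 (fieldIn p (sharp g α)) (chartAt E p).target := fun p y hy ↦
    (contDiffAt_sharp g hy (k := 1) (((sα p).contDiffAt
      ((chartAt E p).open_target.mem_nhds hy)).of_le (WithTop.coe_le_coe.2 le_top))).contDiffWithinAt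
  have dW : ∀ p, ∀ y ∈ (chartAt E p).target, DifferentiableAt ℝ (fieldIn p (sharp g α)) y :=
    fun p y hy ↦ ((sW p).contDiffAt ((chartAt E p).open_target.mem_nhds hy)).differentiableAt
      (by simp)
  have key : ∀ p, ∀ y ∈ (chartAt E p).target,
      ∀ e : Module.Basis (Fin (Module.finrank ℝ E)) ℝ E, IsOrthonormal (metricIn g p y) e →
      LinearMap.trace ℝ (TangentSpace 𝓘(ℝ, E) ((chartAt E p).symm y))
        (D₀ (sharp g α) ((chartAt E p).symm y)).toLinearMap = _ := fun p y hy e he ↦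
    (trace_connection hy (dW p y hy)).trans
      ((hLC p).trace_covField_of_einsteinWeyl (sΞ p) (contDiffOn_christoffel hEW.smooth p)
        (fun z hz ↦ hEW.christoffel_eq hD₀ p hz) ((sΛ p).differentiableOn (by simp)) (hdiv p)
        (hricD p) hy hn (dW p y hy) (hαW p) he)
  have hpos : ∀ x, 0 ≤ LinearMap.trace ℝ (TangentSpace 𝓘(ℝ, E) x) (D₀ (sharp g α) x).toLinearMap :=
    forall_of_chart fun p y hy ↦ by
      obtain ⟨e, he⟩ := (hLC p).exists_basis hy
      rw [key p y hy e he]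
      exact mul_nonneg (by norm_num) (Finset.sum_nonneg fun i _ ↦ Finset.sum_nonneg fun j _ ↦
        sq_nonneg _)
  obtain ⟨e, he⟩ := (hLC p).exists_basis hy
  have h0 := (key p y hy e he).symm.trans (trace_eq_zero_of_nonneg hLC sW hpos _)
  have h1 := (mul_eq_zero.1 h0).resolve_left (by norm_num)
  rw [Finset.sum_eq_zero_iff_of_nonneg fun i _ ↦ Finset.sum_nonneg fun j _ ↦ sq_nonneg _] at h1
  have h2 : ∀ i j, metricIn g p y (covField (christoffel D₀ p) (fieldIn p ξ) y (e i)) (e j)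
      + metricIn g p y (covField (christoffel D₀ p) (fieldIn p ξ) y (e j)) (e i) = 0 := fun i j ↦ by
    have h3 := h1 i (Finset.mem_univ i)
    rw [Finset.sum_eq_zero_iff_of_nonneg fun j _ ↦ sq_nonneg _] at h3
    exact pow_eq_zero_iff (two_ne_zero) |>.1 (h3 j (Finset.mem_univ j))
  set T := covField (christoffel D₀ p) (fieldIn p ξ) y
  have h4 : (metricIn g p y).comp T + ((metricIn g p y).comp T).flip = 0 := by
    refine ContinuousLinearMap.coe_injective (e.ext fun i ↦ ?_)
    refine ContinuousLinearMap.coe_injective (e.ext fun j ↦ ?_)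
    exact h2 i j
  exact congrArg (fun B : E →L[ℝ] E →L[ℝ] ℝ ↦ B u v) h4

end Killing

/-! ### Conformal change of the metric -/

section Conformal

variable {E : Type*} [NormedAddCommGroup E] [NormedSpace ℝ E] [FiniteDimensional ℝ E]
  {M : Type*} [TopologicalSpace M] [ChartedSpace E M] [IsManifold 𝓘(ℝ, E) ∞ M]
  {g g₁ : Metric E M} {f : M → ℝ}

/-- Positivity of `g₁` on a nonzero vector excludes zeros of `f`, so one may divide by `f`. -/
theorem ne_zero_of_conformal [Nontrivial E]
    (hg₁ : ∀ (x : M) (u v : TangentSpace 𝓘(ℝ, E) x), g₁.inner x u v = f x ^ 2 * g.inner x u v)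
    (x : M) : f x ≠ 0 := by
  obtain ⟨v, hv⟩ := exists_ne (0 : E)
  intro h
  have h1 := (g₁.pos x v hv).trans_eq (hg₁ x v v)
  rw [h] at h1
  simp at h1

theorem contDiffOn_comp_chart_symm (hf : ContMDiff 𝓘(ℝ, E) 𝓘(ℝ, ℝ) ∞ f) (p : M) :
    ContDiffOn ℝ ∞ (f ∘ (chartAt E p).symm) (chartAt E p).target := fun _ hy ↦
  ((contMDiffAt_comp_chart_symm_iff hy).1 hf.contMDiffAt).contDiffWithinAt

theorem metricIn_conformal
    (hg₁ : ∀ (x : M) (u v : TangentSpace 𝓘(ℝ, E) x), g₁.inner x u v = f x ^ 2 * g.inner x u v)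
    (p : M) (y u v : E) :
    metricIn g₁ p y u v = (f ∘ (chartAt E p).symm) y ^ 2 * metricIn g p y u v := by
  rw [metricIn_apply, hg₁]; rfl

theorem fderiv_metricIn_conformal (hf : ContMDiff 𝓘(ℝ, E) 𝓘(ℝ, ℝ) ∞ f)
    (hg₁ : ∀ (x : M) (u v : TangentSpace 𝓘(ℝ, E) x), g₁.inner x u v = f x ^ 2 * g.inner x u v)
    {p : M} {y : E} (hy : y ∈ (chartAt E p).target) (u v w : E) :
    fderiv ℝ (metricIn g₁ p) y u v w
      = 2 * (f ∘ (chartAt E p).symm) y * fderiv ℝ (f ∘ (chartAt E p).symm) y u * metricIn g p y v w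
        + (f ∘ (chartAt E p).symm) y ^ 2 * fderiv ℝ (metricIn g p) y u v w := by
  have df : DifferentiableAt ℝ (f ∘ (chartAt E p).symm) y :=
    ((contDiffOn_comp_chart_symm hf p).contDiffAt
      ((chartAt E p).open_target.mem_nhds hy)).differentiableAt (by simp)
  have dG := (contDiffAt_metricIn g hy).differentiableAt (by simp)
  have dG₁ := (contDiffAt_metricIn g₁ hy).differentiableAt (by simp)
  have c1 : ∀ a : E, DifferentiableAt ℝ (fun _ : E ↦ a) y := fun a ↦ differentiableAt_const a
  rw [← fderiv_apply_const₂ dG₁, ← fderiv_apply_const₂ dG]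
  simp only [metricIn_conformal hg₁]
  rw [fderiv_fun_mul (df.fun_pow 2) ((dG.clm_apply (c1 v)).clm_apply (c1 w)), fderiv_fun_pow 2 df]
  simp only [add_apply, smul_apply, smul_eq_mul]
  norm_num
  ring

variable [T2Space M] {D D₁ : Connection E M} {θ : Π x : M, TangentSpace 𝓘(ℝ, E) x →L[ℝ] ℝ}

/-- The same connection `D` is Weyl for `g₁`, with 1-form `θ + 2 df / f`, so
`localLeviCivita_of_weyl` applies again and gives smoothness of `D₁`. -/
theorem IsEinsteinWeyl.localLeviCivita_conformal (hEW : IsEinsteinWeyl g D θ)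
    (hf : ContMDiff 𝓘(ℝ, E) 𝓘(ℝ, ℝ) ∞ f) (hf0 : ∀ x, f x ≠ 0)
    (hg₁ : ∀ (x : M) (u v : TangentSpace 𝓘(ℝ, E) x), g₁.inner x u v = f x ^ 2 * g.inner x u v)
    (hD₁ : IsLeviCivita g₁ D₁) (p : M) :
    LocalLeviCivita (chartAt E p).target (metricIn g₁ p) (christoffel D₁ p) := by
  let θ₁ : Π x : M, TangentSpace 𝓘(ℝ, E) x →L[ℝ] ℝ := fun x ↦
    θ x + (2 / f x) • mvfderiv 𝓘(ℝ, E) f x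
  have hin : ∀ y ∈ (chartAt E p).target, ∀ u, formIn p θ₁ y u = formIn p θ y u
      + 2 / (f ∘ (chartAt E p).symm) y * fderiv ℝ (f ∘ (chartAt E p).symm) y u := by
    intro y hy u
    rw [← mvfderiv_frame hy (hf.contMDiffAt.mdifferentiableAt (by simp))]
    rfl
  have sf := contDiffOn_comp_chart_symm hf p
  have sθ₁ : ContDiffOn ℝ ∞ (formIn p θ₁) (chartAt E p).target := by
    rw [contDiffOn_clm_apply]; intro u
    refine ContDiffOn.congr ?_ fun y hy ↦ hin y hy u
    exact ((contDiffOn_formIn hEW.smooth_form p).clm_apply contDiffOn_const).add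
      ((contDiffOn_const.div sf fun y _ ↦ hf0 _).mul
        ((sf.fderiv_of_isOpen (chartAt E p).open_target le_rfl).clm_apply contDiffOn_const))
  refine localLeviCivita_of_weyl (Γ' := christoffel D p) (Ξ := fieldIn p (sharp g₁ θ₁))
    (chartAt E p).open_target (contDiffOn_metricIn g₁ p) (contDiffOn_christoffel hEW.smooth p)
    (fun y hy ↦ (contDiffAt_sharp g₁ hy (k := ⊤) (sθ₁.contDiffAt
      ((chartAt E p).open_target.mem_nhds hy))).contDiffWithinAt)
    (fun y _ ↦ metricIn_symm g₁ p y)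
    (fun _ hy _ hu ↦ metricIn_pos g₁ hy hu)
    (fun _ hy ↦ christoffel_symm hD₁.torsion_free hy)
    (fun _ hy ↦ christoffel_symm hEW.torsion_free hy)
    (fun _ hy ↦ hD₁.fderiv_metricIn hy) (fun y hy u v w ↦ ?_)
  rw [inner_sharp_in g₁ θ₁ hy, hin y hy, fderiv_metricIn_conformal hf hg₁ hy,
    hEW.fderiv_metricIn hy, inner_sharp_in g θ hy]
  simp only [metricIn_conformal hg₁]
  have : (f ∘ (chartAt E p).symm) y ≠ 0 := hf0 _
  field_simp
  ring

end Conformal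

/-! ### Conformal fields on compact Kähler manifolds -/

section Kaehler

variable {E : Type*} [NormedAddCommGroup E] [NormedSpace ℂ E] [FiniteDimensional ℂ E]
  {M : Type*} [TopologicalSpace M] [T2Space M] [CompactSpace M] [ChartedSpace E M]
  [IsManifold 𝓘(ℂ, E) ω M]
  {g₁ : Metric E M} {D₁ : Connection E M} {ξ : Π x : M, TangentSpace 𝓘(ℝ, E) x} {l : M → ℝ}

/-- A conformal field on a compact Kähler manifold of complex dimension at least two is a
holomorphic Killing field. -/
theorem covField_of_conformal (hdim : 2 ≤ Module.finrank ℂ E) (hH : IsHermitian g₁)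
    (hJ : ∀ (x : M) (v : TangentSpace 𝓘(ℝ, E) x) (X : Π x : M, TangentSpace 𝓘(ℝ, E) x),
      DiffFieldAt X x → D₁ (fun y ↦ J y (X y)) x v = J x (D₁ X x v))
    (hLC : ∀ p : M, LocalLeviCivita (chartAt E p).target (metricIn g₁ p) (christoffel D₁ p))
    (sΞ : ∀ p : M, ContDiffOn ℝ ∞ (fieldIn p ξ) (chartAt E p).target)
    (sl : ∀ p : M, ContDiffOn ℝ ∞ (l ∘ (chartAt E p).symm) (chartAt E p).target)
    (hconf : ∀ p : M, ∀ y ∈ (chartAt E p).target, ∀ u v,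
      metricIn g₁ p y (covField (christoffel D₁ p) (fieldIn p ξ) y u) v
        + metricIn g₁ p y (covField (christoffel D₁ p) (fieldIn p ξ) y v) u
        = 2 * (l ∘ (chartAt E p).symm) y * metricIn g₁ p y u v) {p : M} {y : E}
    (hy : y ∈ (chartAt E p).target) :
    l ((chartAt E p).symm y) = 0 ∧
      ∀ u, covField (christoffel D₁ p) (fieldIn p ξ) y (modelJ E u)
        = modelJ E (covField (christoffel D₁ p) (fieldIn p ξ) y u) := by
  have hn : (4 : ℝ) ≤ Module.finrank ℝ E := by
    rw [finrank_real_of_complex]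
    exact_mod_cast (by omega : 4 ≤ 2 * Module.finrank ℂ E)
  have dΞ : ∀ p, ∀ y ∈ (chartAt E p).target, DifferentiableAt ℝ (fieldIn p ξ) y := fun p y hy ↦
    ((sΞ p).contDiffAt ((chartAt E p).open_target.mem_nhds hy)).differentiableAt (by simp)
  have sT : ∀ p, ContDiffOn ℝ ∞ (covField (christoffel D₁ p) (fieldIn p ξ)) (chartAt E p).target :=
    fun p ↦ contDiffOn_covField (chartAt E p).open_target (hLC p).smooth_symbols (sΞ p)
  let W : Π x : M, TangentSpace 𝓘(ℝ, E) x := fun x ↦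
    (((Module.finrank ℝ E : ℝ) - 2) * l x) • ξ x - (D₁ ξ x (ξ x) + J x (D₁ ξ x (J x (ξ x))))
  have hW : ∀ p, ∀ y ∈ (chartAt E p).target, fieldIn p W y
      = (((Module.finrank ℝ E : ℝ) - 2) * (l ∘ (chartAt E p).symm) y) • fieldIn p ξ y
        - (covField (christoffel D₁ p) (fieldIn p ξ) y (fieldIn p ξ y)
          + modelJ E (covField (christoffel D₁ p) (fieldIn p ξ) y (modelJ E (fieldIn p ξ y)))) := by
    intro p y hy
    have hs := symm_mem_source hy
    refine frame_injective hs ?_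
    rw [frame_fieldIn W hy]
    simp only [W]
    rw [← frame_fieldIn ξ hy, ← frame_modelJ hs, connection_covField D₁ hy (dΞ p y hy),
      connection_covField D₁ hy (dΞ p y hy), ← frame_modelJ hs, map_sub, map_add, map_smul]
    rfl
  have sW : ∀ p, ContDiffOn ℝ 1 (fieldIn p W) (chartAt E p).target := by
    intro p
    refine ContDiffOn.congr ?_ (hW p)
    refine ContDiffOn.of_le (n := ∞) ?_ (WithTop.coe_le_coe.2 le_top)
    exact ((contDiffOn_const.mul (sl p)).smul (sΞ p)).sub (((sT p).clm_apply (sΞ p)).add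
      ((modelJ E).contDiff.comp_contDiffOn ((sT p).clm_apply
        ((modelJ E).contDiff.comp_contDiffOn (sΞ p)))))
  have dW : ∀ p, ∀ y ∈ (chartAt E p).target, DifferentiableAt ℝ (fieldIn p W) y :=
    fun p y hy ↦ ((sW p).contDiffAt ((chartAt E p).open_target.mem_nhds hy)).differentiableAt
      (by simp)
  have key : ∀ p, ∀ y ∈ (chartAt E p).target,
      ∀ e : Module.Basis (Fin (Module.finrank ℝ E)) ℝ E, IsOrthonormal (metricIn g₁ p y) e →
      LinearMap.trace ℝ (TangentSpace 𝓘(ℝ, E) ((chartAt E p).symm y))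
        (D₁ W ((chartAt E p).symm y)).toLinearMap = _ := fun p y hy e he ↦
    (trace_connection hy (dW p y hy)).trans
      ((hLC p).trace_covField_of_conformal (fun z hz ↦ metricIn_modelJ hH hz)
        (fun z hz ↦ christoffel_modelJ hJ hz) (sΞ p) ((sl p).differentiableOn (by simp))
        (hconf p) hy (hW p) he)
  have nonneg : ∀ p, ∀ y ∈ (chartAt E p).target, ∀ u, 0 ≤ metricIn g₁ p y u u := by
    intro p y hy u
    rcases eq_or_ne u 0 with rfl | hu
    · simp
    · exact (metricIn_pos g₁ hy hu).le
  -- The dimension hypothesis is needed here: in complex dimension one this coefficient is zero and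
  -- `l` is not controlled.
  have nn : 0 < (Module.finrank ℝ E : ℝ) * ((Module.finrank ℝ E : ℝ) - 2) :=
    mul_pos (by linarith) (by linarith)
  have hpos : ∀ x, 0 ≤ LinearMap.trace ℝ (TangentSpace 𝓘(ℝ, E) x) (D₁ W x).toLinearMap :=
    forall_of_chart fun p y hy ↦ by
      obtain ⟨e, he⟩ := (hLC p).exists_basis hy
      rw [key p y hy e he]
      exact add_nonneg (mul_nonneg nn.le (sq_nonneg _)) (mul_nonneg (by norm_num)
        (Finset.sum_nonneg fun i _ ↦ nonneg p y hy _))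
  obtain ⟨e, he⟩ := (hLC p).exists_basis hy
  have h0 := (key p y hy e he).symm.trans (trace_eq_zero_of_nonneg hLC sW hpos _)
  set T := covField (christoffel D₁ p) (fieldIn p ξ) y
  have hsum : 0 ≤ ∑ i, metricIn g₁ p y (T (e i) + modelJ E (T (modelJ E (e i))))
      (T (e i) + modelJ E (T (modelJ E (e i)))) := Finset.sum_nonneg fun i _ ↦ nonneg p y hy _
  have hsq := mul_nonneg nn.le (sq_nonneg ((l ∘ (chartAt E p).symm) y))
  have hl0 := (mul_eq_zero.1 (by linarith : (Module.finrank ℝ E : ℝ)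
    * ((Module.finrank ℝ E : ℝ) - 2) * (l ∘ (chartAt E p).symm) y ^ 2 = 0)).resolve_left nn.ne'
  refine ⟨pow_eq_zero_iff two_ne_zero |>.1 hl0, ?_⟩
  have hs0 : ∑ i, metricIn g₁ p y (T (e i) + modelJ E (T (modelJ E (e i))))
      (T (e i) + modelJ E (T (modelJ E (e i)))) = 0 := by linarith
  rw [Finset.sum_eq_zero_iff_of_nonneg fun i _ ↦ nonneg p y hy _] at hs0
  have hP : T + (modelJ E).comp (T.comp (modelJ E)) = 0 := by
    refine ContinuousLinearMap.coe_injective (e.ext fun i ↦ ?_)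
    change T (e i) + modelJ E (T (modelJ E (e i))) = 0
    by_contra hne
    exact (metricIn_pos g₁ hy hne).ne' (hs0 i (Finset.mem_univ i))
  intro u
  -- Applying `J` to `T + JTJ = 0` gives `JT = TJ`.
  have h1 := congrArg (fun A : E →L[ℝ] E ↦ modelJ E (A u)) hP
  simp only [add_apply, ContinuousLinearMap.comp_apply, zero_apply, map_add, map_zero,
    modelJ_sq] at h1
  exact (add_neg_eq_zero.1 h1).symm

end Kaehler

/-! ### Holomorphy, the Killing property and collinearity -/

section Conclusion

theorem isKilling_of_local {E : Type*} [NormedAddCommGroup E] [NormedSpace ℝ E]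
    [FiniteDimensional ℝ E] {M : Type*} [TopologicalSpace M] [ChartedSpace E M]
    [IsManifold 𝓘(ℝ, E) ∞ M] {g : Metric E M} {ξ : Π x : M, TangentSpace 𝓘(ℝ, E) x}
    (sξ : SmoothField ξ)
    (h : ∀ p : M, ∀ y ∈ (chartAt E p).target, ∀ u v,
      fderiv ℝ (metricIn g p) y (fieldIn p ξ y) u v
        + metricIn g p y (fderiv ℝ (fieldIn p ξ) y u) v
        + metricIn g p y u (fderiv ℝ (fieldIn p ξ) y v) = 0) : IsKilling g ξ := by
  have : CompleteSpace E := FiniteDimensional.complete ℝ E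
  refine ⟨sξ, forall_of_chart (E := E) fun p y hy X Y hX hY ↦ ?_⟩
  have dX := (diffFieldAt_iff hy).1 hX
  have dY := (diffFieldAt_iff hy).1 hY
  have hξ : DiffFieldAt ξ ((chartAt E p).symm y) :=
    sξ.contMDiffAt.mdifferentiableAt (by simp)
  have dG := (contDiffAt_metricIn g hy).differentiableAt (by simp)
  have ev : (fun q ↦ g.inner q (X q) (Y q)) ∘ (chartAt E p).symm =ᶠ[nhds y]
      fun z ↦ metricIn g p z (fieldIn p X z) (fieldIn p Y z) := by
    filter_upwards [(chartAt E p).open_target.mem_nhds hy] with z hz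
    exact inner_eq_metricIn g hz X Y
  have hd : MDifferentiableAt 𝓘(ℝ, E) 𝓘(ℝ, ℝ) (fun q ↦ g.inner q (X q) (Y q))
      ((chartAt E p).symm y) := by
    rw [mdifferentiableAt_comp_chart_symm_iff hy]
    exact ((dG.clm_apply dX).clm_apply dY).congr_of_eventuallyEq ev
  have e1 := mvfderiv_frame hy hd (fieldIn p ξ y)
  rw [frame_fieldIn ξ hy, ev.fderiv_eq, fderiv_apply₂ dG dX dY] at e1
  rw [e1, mlieBracket_frame hy hξ hX, mlieBracket_frame hy hξ hY, ← frame_fieldIn X hy,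
    ← frame_fieldIn Y hy, ← metricIn_apply, ← metricIn_apply]
  have := h p y hy (fieldIn p X y) (fieldIn p Y y)
  simp only [map_sub, sub_apply]
  linarith

variable {E : Type*} [NormedAddCommGroup E] [NormedSpace ℂ E] [FiniteDimensional ℂ E]
  {M : Type*} [TopologicalSpace M] [ChartedSpace E M] [IsManifold 𝓘(ℂ, E) ω M]

theorem isHolomorphicField_of_local {ξ : Π x : M, TangentSpace 𝓘(ℝ, E) x} (sξ : SmoothField ξ)
    (h : ∀ p : M, ∀ y ∈ (chartAt E p).target, ∀ u, fderiv ℝ (fieldIn p ξ) y (modelJ E u)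
      = modelJ E (fderiv ℝ (fieldIn p ξ) y u)) : IsHolomorphicField ξ := by
  have : CompleteSpace E := FiniteDimensional.complete ℝ E
  refine ⟨sξ, forall_of_chart (E := E) fun p y hy X hX ↦ ?_⟩
  have dX := (diffFieldAt_iff hy).1 hX
  have hξ : DiffFieldAt ξ ((chartAt E p).symm y) :=
    sξ.contMDiffAt.mdifferentiableAt (by simp)
  have ev := fieldIn_J_eventuallyEq hy X
  rw [mlieBracket_frame hy hξ (diffFieldAt_J hX), mlieBracket_frame hy hξ hX, ev.fderiv_eq,
    ev.eq_of_nhds, ← frame_modelJ (symm_mem_source hy), h p y hy,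
    fderiv_fun_comp y (modelJ E).differentiableAt dX, map_sub (modelJ E)]
  simp

/-- The hypothesis `h` is `J`-invariance of `β ∧ B a`. Evaluated on `a` and `v`, it loses the terms
with `β a` and with `B a (J a)`, the latter being zero because `J` is skew. -/
theorem collinear_of_invariant {B : E →L[ℝ] E →L[ℝ] ℝ} {J : E →L[ℝ] E} {β : E →L[ℝ] ℝ} {a : E}
    (hs : ∀ u v, B u v = B v u) (hJ : IsOrthogonalComplex B J) (hβ : β a = 0)
    (h : ∀ u v, β (J u) * B a (J v) - β (J v) * B a (J u) = β u * B a v - β v * B a u) (v : E) :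
    β v * B a a = β (J a) * B (J a) v := by
  have h1 := h a v
  have h2 := hJ.skew a a
  rw [hs (J a) a] at h2
  have h3 : B a (J a) = 0 := by linarith
  rw [h3, hβ] at h1
  rw [hJ.skew]
  linarith

variable [T2Space M] [CompactSpace M] {g g₁ : Metric E M} {D D₀ D₁ : Connection E M}
  {θ : Π x : M, TangentSpace 𝓘(ℝ, E) x →L[ℝ] ℝ} {f : M → ℝ}

/-- A Killing field of `g` satisfies `L_ξ (f² g) = 2 (ξ(f) / f) f² g`, so `covField_of_conformal`
applies with `l = ξ(f) / f`; the vanishing of `l` is the first conclusion. -/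
theorem IsEinsteinWeyl.covField_kaehler (hdim : 2 ≤ Module.finrank ℂ E)
    (hEW : IsEinsteinWeyl g D θ) (hD₀ : IsLeviCivita g D₀)
    (hδ : ∀ x, codifferential g D₀ θ x = 0) (hf : ContMDiff 𝓘(ℝ, E) 𝓘(ℝ, ℝ) ∞ f)
    (hf0 : ∀ x, f x ≠ 0)
    (hg₁ : ∀ (x : M) (u v : TangentSpace 𝓘(ℝ, E) x), g₁.inner x u v = f x ^ 2 * g.inner x u v)
    (hH : IsHermitian g₁) (hD₁ : IsLeviCivita g₁ D₁)
    (hJ : ∀ (x : M) (v : TangentSpace 𝓘(ℝ, E) x) (X : Π x : M, TangentSpace 𝓘(ℝ, E) x),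
      DiffFieldAt X x → D₁ (fun y ↦ J y (X y)) x v = J x (D₁ X x v))
    {p : M} {y : E} (hy : y ∈ (chartAt E p).target) :
    fderiv ℝ (f ∘ (chartAt E p).symm) y (fieldIn p (sharp g θ) y) = 0 ∧
    (∀ u, covField (christoffel D₁ p) (fieldIn p (sharp g θ)) y (modelJ E u)
      = modelJ E (covField (christoffel D₁ p) (fieldIn p (sharp g θ)) y u)) ∧
    ∀ u v, metricIn g₁ p y (covField (christoffel D₁ p) (fieldIn p (sharp g θ)) y u) v
      + metricIn g₁ p y (covField (christoffel D₁ p) (fieldIn p (sharp g θ)) y v) u = 0 := by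
  have hn : 2 < Module.finrank ℝ E := by
    rw [finrank_real_of_complex]; omega
  have hLC₀ := hEW.localLeviCivita hD₀
  have hLC₁ := hEW.localLeviCivita_conformal hf hf0 hg₁ hD₁
  set ξ := sharp g θ with hξ
  have sΞ : ∀ p, ContDiffOn ℝ ∞ (fieldIn p ξ) (chartAt E p).target :=
    contDiffOn_fieldIn_sharp g hEW.smooth_form
  let l : M → ℝ := fun x ↦ mvfderiv 𝓘(ℝ, E) f x (ξ x) / f x
  have hl : ∀ p, ∀ y ∈ (chartAt E p).target, (l ∘ (chartAt E p).symm) y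
      = fderiv ℝ (f ∘ (chartAt E p).symm) y (fieldIn p ξ y) / (f ∘ (chartAt E p).symm) y := by
    intro p y hy
    rw [← mvfderiv_frame hy (hf.contMDiffAt.mdifferentiableAt (by simp)), frame_fieldIn ξ hy]
    rfl
  have sf := contDiffOn_comp_chart_symm hf
  have sl : ∀ p : M, ContDiffOn ℝ ∞ (l ∘ (chartAt E p).symm) (chartAt E p).target := fun p ↦
    ((((sf p).fderiv_of_isOpen (chartAt E p).open_target le_rfl).clm_apply (sΞ p)).div (sf p)
      fun y _ ↦ hf0 _).congr (hl p)
  have hconf : ∀ p : M, ∀ y ∈ (chartAt E p).target, ∀ u v,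
      metricIn g₁ p y (covField (christoffel D₁ p) (fieldIn p ξ) y u) v
        + metricIn g₁ p y (covField (christoffel D₁ p) (fieldIn p ξ) y v) u
        = 2 * (l ∘ (chartAt E p).symm) y * metricIn g₁ p y u v := by
    intro p y hy u v
    have h0 := hEW.covField_skew hD₀ hn hδ hy u v
    rw [(hLC₀ p).lie_metric hy] at h0
    rw [(hLC₁ p).lie_metric hy, fderiv_metricIn_conformal hf hg₁ hy, hl p y hy]
    simp only [metricIn_conformal hg₁]
    have hfy : (f ∘ (chartAt E p).symm) y ≠ 0 := hf0 _
    have e : 2 * (fderiv ℝ (f ∘ (chartAt E p).symm) y (fieldIn p ξ y) / (f ∘ (chartAt E p).symm) y)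
        * ((f ∘ (chartAt E p).symm) y ^ 2 * metricIn g p y u v)
        = 2 * (f ∘ (chartAt E p).symm) y * fderiv ℝ (f ∘ (chartAt E p).symm) y (fieldIn p ξ y)
          * metricIn g p y u v := by
      field_simp
    rw [e]
    linear_combination (f ∘ (chartAt E p).symm) y ^ 2 * h0
  obtain ⟨h1, h2⟩ := covField_of_conformal hdim hH hJ hLC₁ sΞ sl hconf hy
  have h1' : (l ∘ (chartAt E p).symm) y = 0 := h1
  refine ⟨?_, h2, fun u v ↦ by rw [hconf p y hy, h1']; ring⟩
  rw [hl p y hy, div_eq_zero_iff] at h1'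
  exact h1'.resolve_right (hf0 _)

theorem IsEinsteinWeyl.holomorphic_killing_collinear (hdim : 2 ≤ Module.finrank ℂ E)
    (hg : IsHermitian g) (hEW : IsEinsteinWeyl g D θ) (hD₀ : IsLeviCivita g D₀)
    (hδ : ∀ x, codifferential g D₀ θ x = 0) (hf : ContMDiff 𝓘(ℝ, E) 𝓘(ℝ, ℝ) ∞ f)
    (hg₁ : ∀ (x : M) (u v : TangentSpace 𝓘(ℝ, E) x), g₁.inner x u v = f x ^ 2 * g.inner x u v)
    (hH : IsHermitian g₁) (hD₁ : IsLeviCivita g₁ D₁)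
    (hJ : ∀ (x : M) (v : TangentSpace 𝓘(ℝ, E) x) (X : Π x : M, TangentSpace 𝓘(ℝ, E) x),
      DiffFieldAt X x → D₁ (fun y ↦ J y (X y)) x v = J x (D₁ X x v))
    (hric : ∀ (x : M) (u v : TangentSpace 𝓘(ℝ, E) x), ricci D x (J x u) (J x v) = ricci D x u v) :
    IsHolomorphicField (sharp g θ) ∧ IsKilling g₁ (sharp g θ) ∧
    ∀ x : M, sharp g θ x ≠ 0 → ∃ c : ℝ, gradient g f x = c • J x (sharp g θ x) := by
  have hn : 2 < Module.finrank ℝ E := by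
    rw [finrank_real_of_complex]; omega
  have : Nontrivial E := Module.nontrivial_of_finrank_pos (R := ℂ) (by omega)
  have hf0 := ne_zero_of_conformal hg₁
  have hLC₀ := hEW.localLeviCivita hD₀
  have hLC₁ := hEW.localLeviCivita_conformal hf hf0 hg₁ hD₁
  have key : ∀ p : M, ∀ y ∈ (chartAt E p).target, _ := fun p y hy ↦
    hEW.covField_kaehler hdim hD₀ hδ hf hf0 hg₁ hH hD₁ hJ hy
  have sξ := smoothField_sharp g hEW.smooth_form
  refine ⟨isHolomorphicField_of_local sξ fun p y hy u ↦ ?_,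
    isKilling_of_local sξ fun p y hy u v ↦ ?_, forall_of_chart (E := E) fun p y hy hne ↦ ?_⟩
  -- The symbols of `D₁` are symmetric and commute with `J`, so their terms cancel and the ordinary
  -- derivative of `ξ` in the chart is complex linear.
  · have h1 := (key p y hy).2.1 u
    have t := (hLC₁ p).torsion_free y hy
    rw [covField_apply, covField_apply, t, christoffel_modelJ hJ hy, map_add, t _ u] at h1
    exact add_right_cancel h1
  · rw [← (hLC₁ p).lie_metric hy]
    exact (key p y hy).2.2 u v
  · set ξ := sharp g θ with hξ
    set G := metricIn g p with hG
    set H := metricIn g₁ p with hHdef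
    set fl := f ∘ (chartAt E p).symm with hfl
    set T₀ := covField (christoffel D₀ p) (fieldIn p ξ) y with hT₀
    set T₁ := covField (christoffel D₁ p) (fieldIn p ξ) y with hT₁
    obtain ⟨df0, T₁J, -⟩ := key p y hy
    have sΞ : ContDiffOn ℝ ∞ (fieldIn p ξ) (chartAt E p).target :=
      contDiffOn_fieldIn_sharp g hEW.smooth_form p
    have dΞ : DifferentiableAt ℝ (fieldIn p ξ) y :=
      (sΞ.contDiffAt ((chartAt E p).open_target.mem_nhds hy)).differentiableAt (by simp)
    have dfl : DifferentiableAt ℝ fl y :=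
      ((contDiffOn_comp_chart_symm hf p).contDiffAt
        ((chartAt E p).open_target.mem_nhds hy)).differentiableAt (by simp)
    have dG : DifferentiableAt ℝ G y := (hLC₀ p).differentiableAt_metric hy
    have hs := symm_mem_source hy
    have JG := metricIn_modelJ hg hy
    have JH := metricIn_modelJ hH hy
    have sG := metricIn_symm g p y
    have n0 : (Module.finrank ℝ E : ℝ) ≠ 0 := by
      have : Module.finrank ℝ E ≠ 0 := by omega
      exact_mod_cast this
    -- the exterior derivative of the 1-form is `J`-invariant
    have rinv : ∀ u v, ric (christoffel D p) y (modelJ E u) (modelJ E v)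
        = ric (christoffel D p) y u v := fun u v ↦ by
      rw [← ricci_frame hEW.smooth hy, ← ricci_frame hEW.smooth hy, frame_modelJ hs,
        frame_modelJ hs, hric]
    -- In `ric_weyl` only the term with factor `n / 2` is not symmetric; its skew part is `n / 2`
    -- times `dθ`.
    have rskew : ∀ u v, ric (christoffel D p) y u v - ric (christoffel D p) y v u
        = (Module.finrank ℝ E : ℝ) / 2 * (G y (T₀ u) v - G y (T₀ v) u) := fun u v ↦ by
      have w := (hLC₀ p).ric_weyl sΞ (contDiffOn_christoffel hEW.smooth p)
        (fun z hz ↦ hEW.christoffel_eq hD₀ p hz) hy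
      rw [w, w, (hLC₀ p).ric_symm hy v u, sG v u]
      ring
    have T₀inv : ∀ u v, G y (T₀ (modelJ E u)) (modelJ E v) - G y (T₀ (modelJ E v)) (modelJ E u)
        = G y (T₀ u) v - G y (T₀ v) u := fun u v ↦ by
      have e1 := rskew (modelJ E u) (modelJ E v)
      rw [rinv, rinv, rskew] at e1
      exact (mul_left_cancel₀ (div_ne_zero n0 two_ne_zero) e1).symm
    have T₁inv : ∀ u v, H y (T₁ (modelJ E u)) (modelJ E v) - H y (T₁ (modelJ E v)) (modelJ E u)
        = H y (T₁ u) v - H y (T₁ v) u := fun u v ↦ by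
      rw [T₁J, T₁J, JH.inner, JH.inner]
    -- The `g₁`-dual of `ξ` is `f² θ`, and this is the formula `d(f² θ) = 2 f df ∧ θ + f² dθ`.
    have rel : ∀ u v, H y (T₁ u) v - H y (T₁ v) u
        = 2 * fl y * (fderiv ℝ fl y u * G y (fieldIn p ξ y) v
            - fderiv ℝ fl y v * G y (fieldIn p ξ y) u)
          + fl y ^ 2 * (G y (T₀ u) v - G y (T₀ v) u) := fun u v ↦ by
      have d : ∀ a, DifferentiableAt ℝ (fun z ↦ G z (fieldIn p ξ z) a) y := fun a ↦
        (dG.clm_apply dΞ).clm_apply (differentiableAt_const a)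
      have e : ∀ a b, fderiv ℝ (fun z ↦ H z (fieldIn p ξ z) a) y b
          = 2 * fl y * fderiv ℝ fl y b * G y (fieldIn p ξ y) a
            + fl y ^ 2 * fderiv ℝ (fun z ↦ G z (fieldIn p ξ z) a) y b := fun a b ↦ by
        have e' : (fun z ↦ H z (fieldIn p ξ z) a) = fun z ↦ fl z ^ 2 * G z (fieldIn p ξ z) a :=
          funext fun z ↦ metricIn_conformal hg₁ p z _ a
        rw [e', fderiv_fun_mul (dfl.fun_pow 2) (d a), fderiv_fun_pow 2 dfl]
        simp only [add_apply, smul_apply, smul_eq_mul]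
        norm_num
        ring
      rw [(hLC₁ p).curl hy dΞ, (hLC₀ p).curl hy dΞ, e, e]
      ring
    have fy : fl y ≠ 0 := hf0 _
    -- Two of the three 2-forms in `rel` are `J`-invariant, and `f` has no zeros, so `df ∧ θ` is
    -- invariant as well.
    have inv : ∀ u v, fderiv ℝ fl y (modelJ E u) * G y (fieldIn p ξ y) (modelJ E v)
          - fderiv ℝ fl y (modelJ E v) * G y (fieldIn p ξ y) (modelJ E u)
        = fderiv ℝ fl y u * G y (fieldIn p ξ y) v - fderiv ℝ fl y v * G y (fieldIn p ξ y) u := by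
      intro u v
      have e1 := T₁inv u v
      rw [rel, rel, T₀inv] at e1
      exact mul_left_cancel₀ (mul_ne_zero two_ne_zero fy) (add_right_cancel e1)
    have col := collinear_of_invariant sG JG df0 inv
    have Ξ0 : fieldIn p ξ y ≠ 0 := fun h0 ↦ hne (by rw [← frame_fieldIn ξ hy, h0, map_zero])
    have N0 := (metricIn_pos g hy Ξ0).ne'
    refine ⟨fderiv ℝ fl y (modelJ E (fieldIn p ξ y)) / G y (fieldIn p ξ y) (fieldIn p ξ y), ?_⟩
    rw [← frame_fieldIn ξ hy, ← frame_modelJ hs, ← map_smul]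
    have e2 : gradient g f ((chartAt E p).symm y) = frame p _ (fieldIn p (gradient g f) y) :=
      (frame_fieldIn (gradient g f) hy).symm
    rw [e2]
    congr 1
    refine eq_of_forall_inner (B := G y) (fun u hu ↦ metricIn_pos g hy hu) fun w ↦ ?_
    have e3 : G y (fieldIn p (gradient g f) y) w = fderiv ℝ fl y w := by
      rw [← mvfderiv_frame hy (hf.contMDiffAt.mdifferentiableAt (by simp))]
      exact inner_sharp_in g (mvfderiv 𝓘(ℝ, E) f) hy w
    rw [e3, map_smul, smul_apply, smul_eq_mul, div_mul_eq_mul_div, eq_div_iff N0]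
    exact col w

end Conclusion

end EinsteinWeyl

end

theorem proposition3p1 {E : Type*} [NormedAddCommGroup E] [NormedSpace ℂ E] [FiniteDimensional ℂ E]
    (hdim : 2 ≤ Module.finrank ℂ E)
    {M : Type*} [TopologicalSpace M] [T2Space M] [CompactSpace M] [ChartedSpace E M]
    [IsManifold 𝓘(ℂ, E) ω M]
    (g g₁ : EinsteinWeyl.Metric E M) (D : EinsteinWeyl.Connection E M)
    (θ : Π x : M, TangentSpace 𝓘(ℝ, E) x →L[ℝ] ℝ) (f : M → ℝ)
    (hg : EinsteinWeyl.IsHermitian g)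
    (hEW : EinsteinWeyl.IsEinsteinWeyl g D θ)
    (hstd : EinsteinWeyl.IsStandard g θ)
    (hf : ContMDiff 𝓘(ℝ, E) 𝓘(ℝ, ℝ) ∞ f)
    (hg₁ : ∀ (x : M) (u v : TangentSpace 𝓘(ℝ, E) x),
      g₁.inner x u v = f x ^ 2 * g.inner x u v)
    (hK : EinsteinWeyl.IsKaehler g₁)
    (hric : ∀ (x : M) (u v : TangentSpace 𝓘(ℝ, E) x),
      EinsteinWeyl.ricci D x (EinsteinWeyl.J x u) (EinsteinWeyl.J x v)
        = EinsteinWeyl.ricci D x u v) :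
    EinsteinWeyl.IsHolomorphicField (EinsteinWeyl.sharp g θ) ∧
    EinsteinWeyl.IsKilling g₁ (EinsteinWeyl.sharp g θ) ∧
    ∀ x : M, EinsteinWeyl.sharp g θ x ≠ 0 →
      ∃ c : ℝ, EinsteinWeyl.gradient g f x = c • EinsteinWeyl.J x (EinsteinWeyl.sharp g θ x) := by
  obtain ⟨D₀, hD₀, hδ⟩ := hstd
  obtain ⟨hH, D₁, hD₁, hJ⟩ := hK
  exact hEW.holomorphic_killing_collinear hdim hg hD₀ hδ hf hg₁ hH hD₁ hJ hric
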